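/- Let $k$ be a field and $e\ge 6$. Let $S_{2,3}\subset\mathbb N$ be the numerical semigroup generated by $e+i$, $i\in[0,e-1]\setminus\{2,3\}$, let $R=k[X_i \mid i\in[0,e-1]\setminus\{2,3\}]$, and let $I_{2,3}$ be the defining ideal of $S_{2,3}$, i.e. the kernel of the $k$-algebra map $R\to k[S_{2,3}]$, $X_i\mapsto t^{e+i}$, so that $k[S_{2,3}]\cong R/I_{2,3}$. Put $X_e=X_0^2$, $X_{e+1}=X_0X_1$, $X_{e+2}=X_1^2$ and $$A_{2,3}=\begin{bmatrix} X_0 & X_4 & X_5 & \cdots & X_{e-2} & X_{e-1}\\ X_1 & X_5 & X_6 & \cdots & X_{e-1} & X_e\end{bmatrix}.$$ Let $F$ be the free $R$-module with basis $f_i$, $i\in\{0\}\cup[4,e-1]$, let $G=Rg_1\oplus Rg_2$, and let $\phi:F\to G$, $\phi(f_i)=X_ig_1+X_{i+1}g_2$, be the map with matrix $A_{2,3}$. Let $\mathbf E$ be the Eagon–Northcott complex of $\phi$, with $E_0=R$ and $E_i=\wedge^{i+1}F\otimes D_{i-1}G^*$ for $1\le i\le e-4$, and let $\mathbf E^*$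 be its dual, regarded as a chain complex whose module in degree $i$ is $\operatorname{Hom}_R(E_{e-4-i},R)$. Identify the degree-zero module $\operatorname{Hom}_R(\wedge^{e-3}F\otimes D_{e-5}G^*,R)$ of $\mathbf E^*$ with the free module on the monomials $g_1^jg_2^{e-5-j}$, $0\le j\le e-5$, which form the basis dual to the divided power basis (with respect to the generator $f_0\wedge f_4\wedge\cdots\wedge f_{e-1}$ of $\wedge^{e-3}F$). Define $\psi$ from this module to $E_0=R$ by $$\psi(g_1^jg_2^{e-5-j})=(-1)^j\,(X_1X_{j+7}-X_4X_{j+4}),\qquad 0\le j\le e-5 .$$ Then $\psi$ extends to a map of complexes $\mathbf E^*\to\mathbf E$ (one whose degree-zero component is $\psi$), and the mapping cone of every such extension is a minimal free resolution of $R/I_{2,3}\cong k[S_{2,3}]$: it is a resolution by finitely generated free modules, and all its differentials are zero modulo the ideal $(X_i \mid i\in[0,e-1]\setminus\{2,3\})$. Consequently the Betti numbers $\beta_t=\dim_k\operatorname{Tor}^R_t(k,k[S_{2,3}])$ are $$\beta_t=\frac{t(e-1)}{e-t-2}\binom{e-3}{t+1}\quad(1\le t\le e-4),\qquad \beta_0=\beta_{e-3}=1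 .$$ -/

import Mathlib

open CategoryTheory

universe u

/-! ### The Eagon–Northcott complex of a matrix with two rows -/

section EagonNorthcott

variable {R : Type u} [CommRing R] {ι : Type} [LinearOrder ι]

/-- The basis of the Eagon–Northcott complex of `φ : F → G`, where `F` is free with basis
`(f i)`, `i : ι`, and `G` is free with basis `g₁, g₂`.  The element `none` is the basis `1` of the
module `R` in homological degree `0`.  The element `some ⟨T, a⟩`, with `a + b + 2 = #T`, is
`f_T ⊗ (g₁*)^(a) (g₂*)^(b)` in `⋀^(#T) F ⊗ D_(#T - 2) G*`, where `f_T` is the wedge of the `f i`,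
`i ∈ T`, in increasing order.  (The type `Fin (#T - 1)` of the exponents `a` is empty unless
`2 ≤ #T`.) -/
abbrev ENGen (ι : Type) : Type := Option (Σ T : Finset ι, Fin (T.card - 1))

/-- The homological degree of a basis element: `⋀^(i+1) F ⊗ D_(i-1) G*` sits in degree `i ≥ 1`. -/
def ENGen.hdeg : ENGen ι → ℕ
  | none => 0
  | some ⟨T, _⟩ => T.card - 1

/-- The sign `(-1)^#{t ∈ T | t < k}` of `f_(T \ {k})` in the boundary of `f_T`. -/
def enSign (R : Type u) [CommRing R] (T : Finset ι) (k : ι) : R :=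
  (-1) ^ (T.filter (fun t => t < k)).card

/-- The coefficient at `(g₁*)^(a) (g₂*)^(b)` of the contraction of `(g₁*)^(c) (g₂*)^(d)` with
`φ(f k) = A 0 k • g₁ + A 1 k • g₂`, where `c + d = a + b + 1`: it is `A 0 k` if `c = a + 1` (and
`d = b`), and it is `A 1 k` if `c = a` (and `d = b + 1`). -/
def enContract (A : Matrix (Fin 2) ι R) (a c : ℕ) (k : ι) : R :=
  (if c = a + 1 then A 0 k else 0) + (if c = a then A 1 k else 0)

/-- The entries of the differential of the Eagon–Northcott complex: `enEntry A x y` is the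
coefficient at the basis element `x` of the boundary of the basis element `y`.  In degree `1` the
boundary of `f_i ∧ f_j`, `i < j`, is the minor of `A` on the columns `i, j`; in degrees `≥ 2` it is
the boundary of the exterior factor combined with the contraction of the divided power factor. -/
def enEntry (A : Matrix (Fin 2) ι R) : ENGen ι → ENGen ι → R
  | none, some ⟨T, _⟩ =>
      if T.card = 2 then
        ∑ i ∈ T, ∑ j ∈ T, if i < j then A 0 i * A 1 j - A 0 j * A 1 i else 0
      else 0
  | some ⟨U, a⟩, some ⟨T, c⟩ =>
      ∑ k ∈ T, if U = T.erase k then enSign R T k * enContract A a c k else 0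
  | _, none => 0

lemma enEntry_eq_zero (A : Matrix (Fin 2) ι R) (x y : ENGen ι) (h : y.hdeg ≠ x.hdeg + 1) :
    enEntry A x y = 0 := by
  rcases y with _ | ⟨T, c⟩
  · rcases x with _ | ⟨U, a⟩ <;> rfl
  · rcases x with _ | ⟨U, a⟩
    · simp only [ENGen.hdeg] at h
      simp only [enEntry]
      rw [if_neg (by omega)]
    · simp only [enEntry]
      refine Finset.sum_eq_zero fun k hk => ?_
      rw [if_neg]
      rintro rfl
      have := a.2
      simp only [ENGen.hdeg] at h
      have h' := Finset.card_erase_of_mem hk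
      omega

lemma enContract_sum (A : Matrix (Fin 2) ι R) (a c n : ℕ) (ha : a + 1 < n) (k l : ι) :
    ∑ b : Fin n, enContract A a b l * enContract A b c k =
      A 0 l * enContract A (a + 1) c k + A 1 l * enContract A a c k := by
  rw [Fin.sum_univ_eq_sum_range (fun b => enContract A a b l * enContract A b c k) n]
  rw [show (fun b => enContract A a b l * enContract A b c k) = fun b =>
      (if b = a + 1 then A 0 l * enContract A b c k else 0) +
      (if b = a then A 1 l * enContract A b c k else 0) by
    funext b
    rw [enContract, add_mul]
    split_ifs <;> simp]
  rw [Finset.sum_add_distrib, Finset.sum_ite_eq', Finset.sum_ite_eq', if_pos, if_pos] <;>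
    simp <;> omega

lemma enContract_sum_symm (A : Matrix (Fin 2) ι R) (a c n : ℕ) (ha : a + 1 < n) (k l : ι) :
    ∑ b : Fin n, enContract A a b l * enContract A b c k =
      ∑ b : Fin n, enContract A a b k * enContract A b c l := by
  rw [enContract_sum A a c n ha, enContract_sum A a c n ha]
  simp only [enContract]
  split_ifs <;> first | omega | ring

lemma enSign_erase (T : Finset ι) {k l : ι} (hk : k ∈ T) (hl : l ∈ T) (h : k ≠ l) :
    enSign R (T.erase k) l * enSign R T k = -(enSign R (T.erase l) k * enSign R T l) := by
  have key : ∀ {k l : ι}, k ∈ T → k < l →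
      enSign R (T.erase k) l * enSign R T k = -(enSign R (T.erase l) k * enSign R T l) := by
    intro k l hk h
    have h1 : ((T.erase k).filter (fun t => t < l)).card + 1 =
        (T.filter (fun t => t < l)).card := by
      rw [Finset.filter_erase]
      exact Finset.card_erase_add_one (by simp [hk, h])
    have h2 : (T.erase l).filter (fun t => t < k) = T.filter (fun t => t < k) := by
      rw [Finset.filter_erase]
      exact Finset.erase_eq_of_notMem (by simp [h.le])
    simp only [enSign]
    rw [h2, ← h1]
    ring
  rcases lt_or_gt_of_ne h with h | h
  · exact key hk h
  · rw [key hl h, neg_neg]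

lemma exists_lt_lt_of_card_eq_three {T : Finset ι} (h : T.card = 3) :
    ∃ x y z, x < y ∧ y < z ∧ T = {x, y, z} := by
  let f := T.orderEmbOfFin h
  refine ⟨f 0, f 1, f 2, f.strictMono (by decide), f.strictMono (by decide), ?_⟩
  have key : Finset.image f Finset.univ = T := T.image_orderEmbOfFin_univ h
  rw [← key]
  ext t
  simp [Fin.exists_fin_succ, eq_comm]

lemma sum_mul_enEntry [Fintype ι] (A : Matrix (Fin 2) ι R) (w : ENGen ι → R) (T : Finset ι)
    (c : Fin (T.card - 1)) :
    ∑ y, w y * enEntry A y (some ⟨T, c⟩) = w none * enEntry A none (some ⟨T, c⟩) +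
      ∑ k ∈ T, ∑ b : Fin ((T.erase k).card - 1),
        w (some ⟨T.erase k, b⟩) * (enSign R T k * enContract A b c k) := by
  rw [Fintype.sum_option, Fintype.sum_sigma]
  congr 1
  simp only [enEntry, Finset.mul_sum, mul_ite, mul_zero]
  rw [Finset.sum_congr rfl fun U _ => Finset.sum_comm, Finset.sum_comm]
  refine Finset.sum_congr rfl fun k _ => ?_
  rw [Finset.sum_eq_single (T.erase k)]
  · simp
  · intro U _ hU
    simp [hU]
  · simp

/-- The differential of the Eagon–Northcott complex squares to zero. -/
lemma enEntry_sum_mul [Fintype ι] (A : Matrix (Fin 2) ι R) (x z : ENGen ι) :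
    ∑ y, enEntry A x y * enEntry A y z = 0 := by
  rcases z with _ | ⟨T, c⟩
  · refine Finset.sum_eq_zero fun y _ => ?_
    rcases y with _ | ⟨U, b⟩ <;> simp [enEntry]
  rw [sum_mul_enEntry]
  have h0 : enEntry A x none = 0 := by
    rcases x with _ | ⟨V, a⟩ <;> simp [enEntry]
  rw [h0, zero_mul, zero_add]
  rcases x with _ | ⟨V, a⟩
  · by_cases hT : T.card = 3
    · have h1 : ∀ k ∈ T, ∑ b : Fin ((T.erase k).card - 1),
          enEntry A none (some ⟨T.erase k, b⟩) * (enSign R T k * enContract A b c k) =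
          (∑ i ∈ T.erase k, ∑ j ∈ T.erase k,
            if i < j then A 0 i * A 1 j - A 0 j * A 1 i else 0) *
            (enSign R T k * enContract A 0 c k) := by
        intro k hk
        have h2 : (T.erase k).card = 2 := by rw [Finset.card_erase_of_mem hk, hT]
        simp only [enEntry, h2, if_true]
        rw [Fin.sum_univ_eq_sum_range (fun b => (∑ i ∈ T.erase k, ∑ j ∈ T.erase k,
            if i < j then A 0 i * A 1 j - A 0 j * A 1 i else 0) *
            (enSign R T k * enContract A b c k)) ((T.erase k).card - 1), h2]
        simp
      rw [Finset.sum_congr rfl h1]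
      have hc := c.2
      generalize (c : ℕ) = c' at hc
      obtain ⟨x, y, z, hxy, hyz, rfl⟩ := exists_lt_lt_of_card_eq_three hT
      have hxz := hxy.trans hyz
      have e1 : ({x, y, z} : Finset ι).erase x = {y, z} := by
        ext t; simp; grind
      have e2 : ({x, y, z} : Finset ι).erase y = {x, z} := by
        ext t; simp; grind
      have e3 : ({x, y, z} : Finset ι).erase z = {x, y} := by
        ext t; simp; grind
      rw [hT] at hc
      simp only [enSign, enContract]
      rw [Finset.sum_insert (by simp [hxy.ne, hxz.ne]), Finset.sum_insert (by simp [hyz.ne]),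
        Finset.sum_singleton, e1, e2, e3]
      simp only [Finset.sum_pair hxy.ne, Finset.sum_pair hxz.ne, Finset.sum_pair hyz.ne,
        Finset.filter_insert, Finset.filter_singleton, hxy, hxz, hyz, hxy.not_gt, hxz.not_gt,
        hyz.not_gt, lt_irrefl, if_true, if_false]
      have e4 : (insert x (insert y (∅ : Finset ι))).card = 2 := Finset.card_pair hxy.ne
      have e5 : (insert x (∅ : Finset ι)).card = 1 := Finset.card_singleton x
      rw [e4, e5]
      interval_cases c' <;> simp <;> ring
    · refine Finset.sum_eq_zero fun k hk => Finset.sum_eq_zero fun b _ => ?_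
      have := Finset.card_erase_of_mem hk
      have := b.2
      simp only [enEntry]
      rw [if_neg (by omega), zero_mul]
  · have h1 : ∀ k ∈ T, ∑ b : Fin ((T.erase k).card - 1),
        enEntry A (some ⟨V, a⟩) (some ⟨T.erase k, b⟩) * (enSign R T k * enContract A b c k) =
        ∑ l ∈ T.erase k, if V = (T.erase k).erase l then
          (enSign R (T.erase k) l * enSign R T k) *
          ∑ b : Fin (T.card - 2), enContract A a b l * enContract A b c k else 0 := by
      intro k hk
      have h2 : (T.erase k).card - 1 = T.card - 2 := by rw [Finset.card_erase_of_mem hk]; rfl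
      simp only [enEntry, Finset.sum_mul]
      rw [Finset.sum_comm]
      refine Finset.sum_congr rfl fun l _ => ?_
      split_ifs with hV
      · rw [Fin.sum_univ_eq_sum_range (fun b => enSign R (T.erase k) l * enContract A a b l *
          (enSign R T k * enContract A b c k)), h2, Finset.mul_sum,
          Fin.sum_univ_eq_sum_range (fun b => enSign R (T.erase k) l * enSign R T k *
          (enContract A a b l * enContract A b c k))]
        exact Finset.sum_congr rfl fun b _ => by ring
      · simp
    rw [Finset.sum_congr rfl h1, Finset.sum_sigma']
    refine Finset.sum_involution (fun p _ => ⟨p.2, p.1⟩) ?_ ?_ ?_ ?_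
    · rintro ⟨k, l⟩ h
      simp only [Finset.mem_sigma, Finset.mem_erase] at h
      obtain ⟨hk, hlk, hl⟩ := h
      simp only
      rw [Finset.erase_right_comm (a := l) (b := k)]
      split_ifs with hV
      · have h3 := Finset.card_erase_of_mem hk
        have h4 := Finset.card_erase_of_mem (Finset.mem_erase.2 ⟨hlk, hl⟩)
        rw [← hV] at h4
        have h5 := a.2
        rw [enContract_sum_symm A a c (T.card - 2) (by omega) k l,
          enSign_erase T hk hl (Ne.symm hlk)]
        ring
      · simp
    · rintro ⟨k, l⟩ h _ h'
      simp only [Finset.mem_sigma, Finset.mem_erase] at h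
      simp only [Sigma.mk.injEq] at h'
      exact h.2.1 h'.1
    · rintro ⟨k, l⟩ h
      simp only [Finset.mem_sigma, Finset.mem_erase] at h ⊢
      exact ⟨h.2.2, h.2.1.symm, h.1⟩
    · rintro ⟨k, l⟩ h
      rfl

/-- The Eagon–Northcott complex of the map `φ : F → G` with matrix `A`. -/
noncomputable def eagonNorthcott [Fintype ι] (A : Matrix (Fin 2) ι R) :
    ChainComplex (ModuleCat.{u} R) ℕ where
  X i := ModuleCat.of R ({x : ENGen ι // x.hdeg = i} → R)
  d i j := ModuleCat.ofHom (Matrix.mulVecLin (Matrix.of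
    fun (x : {x : ENGen ι // x.hdeg = j}) (y : {y : ENGen ι // y.hdeg = i}) =>
      enEntry A x.1 y.1))
  shape i j h := by
    rw [show (Matrix.of fun (x : {x : ENGen ι // x.hdeg = j}) (y : {y : ENGen ι // y.hdeg = i}) =>
      enEntry A x.1 y.1) = 0 from Matrix.ext fun x y => enEntry_eq_zero A _ _ fun h' => h (by
        have := x.2; have := y.2; simp only [ComplexShape.down_Rel]; omega), Matrix.mulVecLin_zero]
    rfl
  d_comp_d' i j l hij hjl := by
    rw [← ModuleCat.ofHom_comp, ← Matrix.mulVecLin_mul]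
    simp only [ComplexShape.down_Rel] at hij hjl
    have h0 : (Matrix.of fun (x : {x : ENGen ι // x.hdeg = l}) (y : {y : ENGen ι // y.hdeg = j}) =>
        enEntry A x.1 y.1) * (Matrix.of fun (x : {x : ENGen ι // x.hdeg = j})
          (y : {y : ENGen ι // y.hdeg = i}) => enEntry A x.1 y.1) = 0 := by
      ext x z
      simp only [Matrix.mul_apply, Matrix.of_apply, Matrix.zero_apply]
      rw [← enEntry_sum_mul A x.1 z.1]
      refine Fintype.sum_of_injective Subtype.val Subtype.val_injective _ _ (fun y hy => ?_)
        fun _ => rfl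
      rw [enEntry_eq_zero A x.1 y, zero_mul]
      intro h
      exact hy ⟨⟨y, by have := x.2; omega⟩, rfl⟩
    rw [h0, Matrix.mulVecLin_zero]
    rfl

/-- The dual `Hom(E, R)` of the Eagon–Northcott complex `E` of `A`, a complex of length `p - 1`
where `p` is the number of columns of `A`, written as a chain complex: its `i`-th module is
`Hom(E_(p-1-i), R)` with the dual basis, and its differentials are the transposes of those of `E`. -/
noncomputable def eagonNorthcottDual [Fintype ι] (A : Matrix (Fin 2) ι R) :
    ChainComplex (ModuleCat.{u} R) ℕ where
  X i := ModuleCat.of R ({x : ENGen ι // x.hdeg + i = Fintype.card ι - 1} → R)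
  d i j := ModuleCat.ofHom (Matrix.mulVecLin (Matrix.of
    fun (x : {x : ENGen ι // x.hdeg + j = Fintype.card ι - 1})
      (y : {y : ENGen ι // y.hdeg + i = Fintype.card ι - 1}) => enEntry A y.1 x.1))
  shape i j h := by
    rw [show (Matrix.of fun (x : {x : ENGen ι // x.hdeg + j = Fintype.card ι - 1})
      (y : {y : ENGen ι // y.hdeg + i = Fintype.card ι - 1}) => enEntry A y.1 x.1) = 0 from
      Matrix.ext fun x y => enEntry_eq_zero A _ _ fun h' => h (by
        have := x.2; have := y.2; simp only [ComplexShape.down_Rel]; omega), Matrix.mulVecLin_zero]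
    rfl
  d_comp_d' i j l hij hjl := by
    rw [← ModuleCat.ofHom_comp, ← Matrix.mulVecLin_mul]
    simp only [ComplexShape.down_Rel] at hij hjl
    have h0 : (Matrix.of fun (x : {x : ENGen ι // x.hdeg + l = Fintype.card ι - 1})
        (y : {y : ENGen ι // y.hdeg + j = Fintype.card ι - 1}) => enEntry A y.1 x.1) *
        (Matrix.of fun (x : {x : ENGen ι // x.hdeg + j = Fintype.card ι - 1})
        (y : {y : ENGen ι // y.hdeg + i = Fintype.card ι - 1}) => enEntry A y.1 x.1) = 0 := by
      ext x z
      simp only [Matrix.mul_apply, Matrix.of_apply, Matrix.zero_apply]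
      rw [← enEntry_sum_mul A z.1 x.1]
      refine Fintype.sum_of_injective Subtype.val Subtype.val_injective _ _ (fun y hy => ?_)
        fun _ => mul_comm _ _
      rw [enEntry_eq_zero A z.1 y, zero_mul]
      intro h
      exact hy ⟨⟨y, by have := z.2; omega⟩, rfl⟩
    rw [h0, Matrix.mulVecLin_zero]
    rfl

end EagonNorthcott

/-! ### Minimal free resolutions and Betti numbers over a polynomial ring -/

section Resolutions

/-- The chain complex `C`, in nonnegative degrees, is a free resolution of the `R`-module `M` by
finitely generated free modules, minimal with respect to the maximal ideal `𝔪`: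
`⋯ → C₂ → C₁ → C₀ → M → 0` is exact, and the image of each differential `C_(n+1) → C_n` lies in
`𝔪 C_n`. -/
def IsMinimalFreeResolution {R : Type u} [CommRing R] (𝔪 : Ideal R)
    (C : ChainComplex (ModuleCat.{u} R) ℕ) (M : Type u) [AddCommGroup M] [Module R M] : Prop :=
  (∀ n, Module.Free R (C.X n) ∧ Module.Finite R (C.X n)) ∧
  (∃ ε : C.X 0 →ₗ[R] M, Function.Surjective ε ∧ Function.Exact (C.d 1 0).hom ε) ∧
  (∀ n, Function.Exact (C.d (n + 2) (n + 1)).hom (C.d (n + 1) n).hom) ∧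
  (∀ n, LinearMap.range (C.d (n + 1) n).hom ≤ 𝔪 • (⊤ : Submodule R (C.X n)))

/-- The ideal of a polynomial ring generated by the variables. -/
noncomputable def variablesIdeal (σ : Type) (k : Type u) [Field k] : Ideal (MvPolynomial σ k) :=
  Ideal.span (Set.range MvPolynomial.X)

/-- The `t`-th Betti number `β_t(M) = dim_k Tor_t^R(k, M)` of a module `M` over the polynomial ring
`R = k[X_i | i ∈ σ]`, where `k = R ⧸ (X_i | i ∈ σ)`. -/
noncomputable def bettiNumber {σ : Type} (k : Type u) [Field k] (M : Type u) [AddCommGroup M]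
    [Module (MvPolynomial σ k) M] (t : ℕ) : ℕ :=
  Module.finrank k ((ModuleCat.restrictScalars (algebraMap k (MvPolynomial σ k))).obj
    (((Tor (ModuleCat.{u} (MvPolynomial σ k)) t).obj
      (ModuleCat.of _ (MvPolynomial σ k ⧸ variablesIdeal σ k))).obj (ModuleCat.of _ M)))

end Resolutions

/-! ### The Sally semigroup `S_{2,3}` of multiplicity `e` -/

namespace Sally

/-- The indices `i ∈ [0, e-1] \ {2, 3}` of the variables. -/
abbrev VarIdx (e : ℕ) : Type := {i : Fin e // (i : ℕ) ≠ 2 ∧ (i : ℕ) ≠ 3}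

/-- The numerical semigroup `S_{2,3}` generated by `e + i`, `i ∈ [0, e-1] \ {2, 3}`. -/
def semigroup (e : ℕ) : AddSubmonoid ℕ :=
  AddSubmonoid.closure (Set.range fun i : VarIdx e => e + (i.1 : ℕ))

/-- The polynomial ring `R_{2,3} = k[X_i | i ∈ [0, e-1] \ {2, 3}]`. -/
abbrev PolyRing (e : ℕ) (k : Type u) [Field k] : Type u := MvPolynomial (VarIdx e) k

/-- The semigroup ring `k[S_{2,3}]`. -/
noncomputable abbrev SemigroupRing (e : ℕ) (k : Type u) [Field k] : Type u := AddMonoidAlgebra k (semigroup e)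

/-- The `k`-algebra homomorphism `R_{2,3} → k[S_{2,3}]`, `X_i ↦ t^(e+i)`. -/
noncomputable def param (e : ℕ) (k : Type u) [Field k] : PolyRing e k →ₐ[k] SemigroupRing e k :=
  MvPolynomial.aeval fun i : VarIdx e =>
    AddMonoidAlgebra.single
      (⟨e + (i.1 : ℕ), AddSubmonoid.subset_closure ⟨i, rfl⟩⟩ : semigroup e) (1 : k)

/-- So `k[S_{2,3}]` is the quotient of `R_{2,3}` by the defining ideal. -/
lemma param_surjective (e : ℕ) (k : Type u) [Field k] : Function.Surjective (param e k) := by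
  have key : ∀ (s : ℕ) (hs : s ∈ semigroup e),
      AddMonoidAlgebra.single (⟨s, hs⟩ : semigroup e) (1 : k) ∈ (param e k).range := by
    intro s hs
    induction hs using AddSubmonoid.closure_induction with
    | mem s hs =>
      obtain ⟨i, rfl⟩ := hs
      exact ⟨MvPolynomial.X i, by simp [param]⟩
    | zero => exact one_mem _
    | add a b ha hb iha ihb =>
      have h := mul_mem iha ihb
      rwa [AddMonoidAlgebra.single_mul_single, one_mul] at h
  intro p
  change p ∈ (param e k).range
  induction p using AddMonoidAlgebra.induction_on with
  | of s => exact key _ (Subtype.property s)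
  | add p q hp hq => exact add_mem hp hq
  | smul r p hp => exact Subalgebra.smul_mem _ hp r

/-- The defining ideal `I_{2,3}` of `S_{2,3}`. -/
noncomputable def definingIdeal (e : ℕ) (k : Type u) [Field k] : Ideal (PolyRing e k) :=
  RingHom.ker (param e k)

/-- The elements `X_i ∈ R_{2,3}` for `i ∈ [0, e+2] \ {2, 3}`: the variables for `i < e`, and
`X_e = X_0^2`, `X_(e+1) = X_0 X_1`, `X_(e+2) = X_1^2` (`0` for all other `i`, which do not occur). -/
noncomputable def x (e : ℕ) (k : Type u) [Field k] (i : ℕ) : PolyRing e k :=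
  let v : ℕ → PolyRing e k := fun i =>
    if h : i < e ∧ i ≠ 2 ∧ i ≠ 3 then MvPolynomial.X ⟨⟨i, h.1⟩, h.2⟩ else 0
  if i = e then v 0 ^ 2 else if i = e + 1 then v 0 * v 1 else if i = e + 2 then v 1 ^ 2 else v i

/-- The indices `i ∈ {0} ∪ [4, e-1]` of the columns of `A_{2,3}`. -/
abbrev ColIdx (e : ℕ) : Type := {i : Fin e // (i : ℕ) ≠ 1 ∧ (i : ℕ) ≠ 2 ∧ (i : ℕ) ≠ 3}

/-- The matrix `A_{2,3}`, whose column of index `i` is `(X_i, X_(i+1))`. -/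
noncomputable def matA (e : ℕ) (k : Type u) [Field k] :
    Matrix (Fin 2) (ColIdx e) (PolyRing e k) :=
  Matrix.of fun r i => x e k ((i.1 : ℕ) + (r : ℕ))

/-- The map `ψ : D_(e-5) G = E*_0 → E_0 = R_{2,3}`,
`g₁^j g₂^(e-5-j) ↦ (-1)^j (X_1 X_(j+7) - X_4 X_(j+4))`.  The basis of `E*_0` consists of the
dual basis elements of the `some ⟨T, j⟩` with `T` the set of all columns and `0 ≤ j ≤ e - 5`. -/
noncomputable def psi (e : ℕ) (k : Type u) [Field k] :
    (eagonNorthcottDual (matA e k)).X 0 ⟶ (eagonNorthcott (matA e k)).X 0 :=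
  ModuleCat.ofHom (Matrix.mulVecLin (Matrix.of
    fun (_ : {y : ENGen (ColIdx e) // y.hdeg = 0})
      (y : {y : ENGen (ColIdx e) // y.hdeg + 0 = Fintype.card (ColIdx e) - 1}) =>
      match y.1 with
      | none => 0
      | some ⟨_, j⟩ =>
        (-1) ^ (j : ℕ) * (x e k 1 * x e k ((j : ℕ) + 7) - x e k 4 * x e k ((j : ℕ) + 4))))

end Sally

/-!
Write `I₂` for the ideal of `2 × 2` minors of `A_{2,3}` and `ω = H₀(E*)`.  The mapping cone of an
extension of `ψ` resolves `R ⧸ I_{2,3}` because `E` resolves `R ⧸ I₂`, `E*` resolves `ω`, and `ψ`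
induces an injection `ω → R ⧸ I₂` whose image is `I_{2,3} ⧸ I₂`.

*Exactness of `E` and `E*`.*  Multiplication by a minor is null-homotopic on the Eagon–Northcott
complex, hence also on its dual (`minor_mem_nullHomotopyIdeal`).  If each member of a regular
sequence of length `n` is null-homotopic on a free complex of length `n`, then the complex is exact
in positive degrees (`exists_boundary_of_isWeaklyRegular`): a cycle `z` has `r z = D w`, so `w` is a
cycle modulo `r`, and one proceeds by induction on the sequence.  This needs no depth theory, only a
regular sequence of length `e - 4` in `I₂`, and `Sally.exists_isWeaklyRegular` provides the sequence
consisting of `X_0^(e-2) - X_1^(e-4) X_4` and `X_i^(e-4) - X_4^s X_0^(2t)`, `i ∈ [5, e-1]`, which is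
triangular in the sense that each member is monic in a variable that does not occur in the previous
ones.  It stays regular with `X_1` in front, so that `X_1` is a nonzerodivisor on `R ⧸ I₂` and on
`ω`.

*Injectivity.*  Since `X_1` is a nonzerodivisor modulo `I₂`, this ideal is the kernel of the map
`X_i ↦ X_0^2 (X_1 / X_0)^(i-e)`, `i ≥ 4`, that fixes `X_0` and `X_1`
(`Sally.minorIdeal_eq_ker_surfaceParam`); in particular it is prime.  A power of `X_1` carries any
element of `ω` to a multiple `r g_1^(e-5)`.  If the element is in the kernel of `ψ`, then
`r ψ(g_1^(e-5)) ∈ I₂`, so `r ∈ I₂`, which kills `ω` (`Sally.exists_of_psiTotal_mem`).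

*Image.*  Modulo `I₂` and the values of `ψ` every polynomial is a combination of monomials whose
images in `k[S_{2,3}]` are distinct powers of `t`, so these elements generate `I_{2,3}`
(`Sally.definingIdeal_eq_coneIdeal`).

*Minimality.*  The maps `g_1^j g_2^(e-5-j) ↦ (-1)^j X_(j+c)` induce maps `ω → R ⧸ I₂` for
`4 ≤ c ≤ 7`, and `ψ = X_1 α - X_4 β` with `α`, `β` the ones for `c = 7` and `c = 4`.  Lifting `α` and
`β` gives an extension of `ψ` that vanishes modulo the variables (`Sally.exists_extension_psi`), and
any other extension differs from it by `d h + h d`, which vanishes modulo the variables as well.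

The Betti numbers are then the ranks of the modules in the cone.
-/

/-! ### Acyclicity of a complex with null-homotopic multiplications -/

section Acyclicity

variable {R : Type u} [CommRing R] {X Y Z : Type} [Fintype X] [Fintype Y] [Fintype Z]

/-- The action of a matrix over `R` on vectors with entries in an `R`-module. -/
def Matrix.smulVecLin (M : Type*) [AddCommGroup M] [Module R M] (D : Matrix X Y R) :
    (Y → M) →ₗ[R] (X → M) where
  toFun v x := ∑ y, D x y • v y
  map_add' v w := by ext x; simp [Finset.sum_add_distrib]
  map_smul' r v := by ext x; simp [Finset.smul_sum, smul_comm r]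

omit [Fintype X] in
lemma Matrix.smulVecLin_apply {M : Type*} [AddCommGroup M] [Module R M] (D : Matrix X Y R)
    (v : Y → M) (x : X) : D.smulVecLin M v x = ∑ y, D x y • v y := rfl

omit [Fintype X] in
lemma Matrix.smulVecLin_mul {M : Type*} [AddCommGroup M] [Module R M] (D : Matrix X Y R)
    (E : Matrix Y Z R) (v : Z → M) :
    (D * E).smulVecLin M v = D.smulVecLin M (E.smulVecLin M v) := by
  ext x
  simp only [smulVecLin_apply, Matrix.mul_apply, Finset.sum_smul, Finset.smul_sum, smul_smul]
  exact Finset.sum_comm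

/-- The elements `r` such that multiplication by `r` is null-homotopic on the complex with
differential `D`. -/
def nullHomotopyIdeal [DecidableEq X] (D : Matrix X X R) : Ideal R where
  carrier := {r | ∃ H : Matrix X X R, D * H + H * D = r • (1 : Matrix X X R)}
  add_mem' := by
    rintro a b ⟨H, hH⟩ ⟨K, hK⟩
    exact ⟨H + K, by rw [mul_add, add_mul, add_smul, ← hH, ← hK]; abel⟩
  zero_mem' := ⟨0, by simp⟩
  smul_mem' := by
    rintro c a ⟨H, hH⟩
    exact ⟨c • H, by rw [Matrix.mul_smul, Matrix.smul_mul, ← smul_add, hH, smul_smul]; rfl⟩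

lemma nullHomotopyIdeal_transpose_le [DecidableEq X] (D : Matrix X X R) :
    nullHomotopyIdeal D ≤ nullHomotopyIdeal D.transpose := by
  rintro r ⟨H, hH⟩
  refine ⟨H.transpose, ?_⟩
  have := congrArg Matrix.transpose hH
  rw [Matrix.transpose_add, Matrix.transpose_mul, Matrix.transpose_mul, Matrix.transpose_smul,
    Matrix.transpose_one] at this
  rw [← this, add_comm]

/-- A null-homotopic multiplication kills the homology. -/
lemma exists_smulVecLin_eq_smul [DecidableEq X] {M : Type*} [AddCommGroup M] [Module R M]
    {D : Matrix X X R} {r : R} (hr : r ∈ nullHomotopyIdeal D) {z : X → M}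
    (hz : D.smulVecLin M z = 0) : ∃ v, D.smulVecLin M v = r • z := by
  obtain ⟨H, hH⟩ := hr
  refine ⟨H.smulVecLin M z, ?_⟩
  have h1 : (D * H + H * D).smulVecLin M z = r • z := by
    rw [hH]
    ext x
    simp [Matrix.smulVecLin_apply, Matrix.one_apply, ite_smul]
  rw [← h1]
  have h2 : (D * H + H * D).smulVecLin M z = (D * H).smulVecLin M z + (H * D).smulVecLin M z := by
    ext x
    simp [Matrix.smulVecLin_apply, add_smul, Finset.sum_add_distrib]
  rw [h2, Matrix.smulVecLin_mul, Matrix.smulVecLin_mul, hz, map_zero, add_zero]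

/-- A boundary of degree `j` is the boundary of an element of degree `j + 1`. -/
lemma exists_supported_smulVecLin_eq {M : Type*} [AddCommGroup M] [Module R M]
    {D : Matrix X X R} {deg : X → ℕ} (hdeg : ∀ x y, D x y ≠ 0 → deg y = deg x + 1) {j : ℕ}
    {z v : X → M} (hz : ∀ x, deg x ≠ j → z x = 0) (hv : D.smulVecLin M v = z) :
    ∃ w : X → M, (∀ x, deg x ≠ j + 1 → w x = 0) ∧ D.smulVecLin M w = z := by
  classical
  refine ⟨fun x => if deg x = j + 1 then v x else 0, fun x hx => if_neg hx, ?_⟩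
  ext x
  by_cases hx : deg x = j
  · rw [← hv]
    simp only [Matrix.smulVecLin_apply]
    refine Finset.sum_congr rfl fun y _ => ?_
    by_cases h : D x y = 0
    · simp [h]
    · rw [if_pos (by rw [hdeg x y h, hx])]
  · rw [hz x hx]
    simp only [Matrix.smulVecLin_apply]
    refine Finset.sum_eq_zero fun y _ => ?_
    by_cases h : D x y = 0
    · simp [h]
    · have := hdeg x y h
      rw [if_neg (by omega), smul_zero]

/-- If `r` is regular on `M` and the complex with coefficients in `M ⧸ r M` is exact in degree
`j + 1`, then `r` is regular on the homology in degree `j` of the complex with coefficients in `M`: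
if `r z = D w`, then `w` is a cycle modulo `r`, so `w = D u + r v`, and `z = D v`. -/
lemma exists_boundary_of_smul_eq {D : Matrix X X R} (hD : D * D = 0)
    {deg : X → ℕ} (hdeg : ∀ x y, D x y ≠ 0 → deg y = deg x + 1)
    {M : Type*} [AddCommGroup M] [Module R M] {r : R} (hr : IsSMulRegular M r) {j : ℕ}
    (hex : ∀ z : X → QuotSMulTop r M, (∀ x, deg x ≠ j + 1 → z x = 0) →
      D.smulVecLin _ z = 0 → ∃ v, D.smulVecLin _ v = z)
    {z w₀ : X → M} (hz : ∀ x, deg x ≠ j → z x = 0) (hw₀ : D.smulVecLin M w₀ = r • z) :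
    ∃ v : X → M, (∀ x, deg x ≠ j + 1 → v x = 0) ∧ D.smulVecLin M v = z := by
  obtain ⟨w, hw, hDw⟩ := exists_supported_smulVecLin_eq hdeg (j := j) (z := r • z)
    (fun x hx => by simp [hz x hx]) hw₀
  let π : M →ₗ[R] QuotSMulTop r M := Submodule.mkQ _
  have hπ : ∀ v : X → M, D.smulVecLin (QuotSMulTop r M) (fun x => π (v x)) =
      fun x => π (D.smulVecLin M v x) := by
    intro v
    funext x
    simp [Matrix.smulVecLin_apply, map_sum]
  have hπr : ∀ m : M, π (r • m) = 0 := fun m =>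
    (Submodule.Quotient.mk_eq_zero _).2 (Submodule.smul_mem_pointwise_smul m r ⊤ trivial)
  obtain ⟨u', hDu'⟩ := hex (fun x => π (w x)) (fun x hx => by simp [hw x hx]) (by
    rw [hπ, hDw]
    exact funext fun x => hπr _)
  have hπs : Function.Surjective π := Submodule.mkQ_surjective _
  choose u hu using fun x => hπs (u' x)
  have h1 : ∀ x, ∃ v : M, r • v = w x - D.smulVecLin M u x := by
    intro x
    have h2 : π (w x - D.smulVecLin M u x) = 0 := by
      rw [map_sub, sub_eq_zero, ← congrFun hDu' x, ← congrFun (hπ u) x]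
      exact congrArg (fun v => D.smulVecLin (QuotSMulTop r M) v x)
        (funext fun y => (hu y).symm)
    obtain ⟨v, -, hv⟩ := (Submodule.mem_smul_pointwise_iff_exists _ _ _).1
      ((Submodule.Quotient.mk_eq_zero _).1 h2)
    exact ⟨v, hv⟩
  choose v hv using h1
  have h3 : D.smulVecLin M v = z := by
    have h4 : r • D.smulVecLin M v = r • z := by
      rw [← map_smul, show r • v = w - D.smulVecLin M u from funext hv, map_sub, hDw,
        ← Matrix.smulVecLin_mul, hD]
      simp [funext_iff, Matrix.smulVecLin_apply]
    ext x
    exact hr (congrFun h4 x)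
  exact exists_supported_smulVecLin_eq hdeg hz h3

open RingTheory.Sequence in
/-- **Acyclicity lemma.**  If each member of an `M`-regular sequence is null-homotopic on a free
complex of length `n`, then the complex with coefficients in `M` is exact in the top
`rs.length` degrees. -/
theorem exists_boundary_of_isWeaklyRegular [DecidableEq X] {D : Matrix X X R} (hD : D * D = 0)
    {deg : X → ℕ} (hdeg : ∀ x y, D x y ≠ 0 → deg y = deg x + 1) {n : ℕ} (hn : ∀ x, deg x ≤ n)
    (rs : List R) (hrs : ∀ r ∈ rs, r ∈ nullHomotopyIdeal D)
    (M : Type*) [AddCommGroup M] [Module R M] (hM : IsWeaklyRegular M rs)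
    {j : ℕ} (hj : n < j + rs.length) {z : X → M} (hz : ∀ x, deg x ≠ j → z x = 0)
    (hDz : D.smulVecLin M z = 0) :
    ∃ v : X → M, (∀ x, deg x ≠ j + 1 → v x = 0) ∧ D.smulVecLin M v = z := by
  induction rs generalizing M j with
  | nil =>
    refine ⟨0, fun _ _ => rfl, ?_⟩
    rw [map_zero]
    ext x
    rw [hz x (by have := hn x; simp at hj; omega)]
    rfl
  | cons r rs ih =>
    rw [isWeaklyRegular_cons_iff] at hM
    obtain ⟨w₀, hw₀⟩ := exists_smulVecLin_eq_smul (hrs r (by simp)) hDz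
    refine exists_boundary_of_smul_eq hD hdeg hM.1 (fun z' hz' hDz' => ?_) hz hw₀
    obtain ⟨v, -, hv⟩ := ih (fun s hs => hrs s (by simp [hs])) (QuotSMulTop r M) hM.2
      (j := j + 1) (by simp at hj; omega) hz' hDz'
    exact ⟨v, hv⟩

end Acyclicity

/-! ### The minors are null-homotopic on the Eagon–Northcott complex -/

section Exterior

variable {R : Type u} [CommRing R] {ι : Type} [LinearOrder ι]

/-- Left multiplication by `∑ x k • ε k` on the exterior algebra with basis `ε T`, `T` a finite set
of indices; an element is given by its coefficients. -/
def extMul (x : ι → R) (v : Finset ι → R) (T : Finset ι) : R :=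
  ∑ k ∈ T, enSign R T k * x k * v (T.erase k)

/-- The contraction of the exterior algebra dual to left multiplication by the basis vector
`l`. -/
def extContract (l : ι) (v : Finset ι → R) (T : Finset ι) : R :=
  if l ∈ T then 0 else enSign R T l * v (insert l T)

lemma enSign_mul_self (T : Finset ι) (k : ι) : enSign R T k * enSign R T k = 1 := by
  rw [enSign, ← mul_pow]; simp

lemma enSign_erase_self (T : Finset ι) (k : ι) : enSign R (T.erase k) k = enSign R T k := by
  rw [enSign, enSign, Finset.filter_erase, Finset.erase_eq_of_notMem (by simp)]

lemma extMul_add (x : ι → R) (v w : Finset ι → R) :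
    extMul x (v + w) = extMul x v + extMul x w := by
  ext T; simp [extMul, mul_add, Finset.sum_add_distrib]

lemma extMul_smul (x : ι → R) (r : R) (v : Finset ι → R) :
    extMul x (r • v) = r • extMul x v := by
  ext T; simp only [extMul, Pi.smul_apply, smul_eq_mul, Finset.mul_sum]
  exact Finset.sum_congr rfl fun _ _ => by ring

lemma extContract_add (l : ι) (v w : Finset ι → R) :
    extContract l (v + w) = extContract l v + extContract l w := by
  ext T; simp only [extContract, Pi.add_apply]; split_ifs <;> ring

lemma extMul_sub (x : ι → R) (v w : Finset ι → R) :
    extMul x (v - w) = extMul x v - extMul x w := by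
  ext T; simp [extMul, mul_sub, Finset.sum_sub_distrib]

lemma extContract_sub (l : ι) (v w : Finset ι → R) :
    extContract l (v - w) = extContract l v - extContract l w := by
  ext T; simp only [extContract, Pi.sub_apply]; split_ifs <;> ring

lemma extMul_extMul_apply (x y : ι → R) (v : Finset ι → R) (T : Finset ι) :
    extMul x (extMul y v) T = ∑ p ∈ T.sigma fun k => T.erase k,
      enSign R (T.erase p.1) p.2 * enSign R T p.1 * (x p.1 * y p.2) *
        v ((T.erase p.1).erase p.2) := by
  rw [Finset.sum_sigma]
  simp only [extMul, Finset.mul_sum]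
  exact Finset.sum_congr rfl fun _ _ => Finset.sum_congr rfl fun _ _ => by ring

lemma extMul_extMul (x y : ι → R) (v : Finset ι → R) :
    extMul x (extMul y v) = -extMul y (extMul x v) := by
  ext T
  rw [Pi.neg_apply, extMul_extMul_apply, extMul_extMul_apply, ← Finset.sum_neg_distrib]
  refine Finset.sum_nbij' (fun p => ⟨p.2, p.1⟩) (fun p => ⟨p.2, p.1⟩) ?_ ?_ (fun _ _ => rfl)
    (fun _ _ => rfl) ?_
  · rintro ⟨k, l⟩ h
    simp only [Finset.mem_sigma, Finset.mem_erase] at h ⊢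
    exact ⟨h.2.2, h.2.1.symm, h.1⟩
  · rintro ⟨k, l⟩ h
    simp only [Finset.mem_sigma, Finset.mem_erase] at h ⊢
    exact ⟨h.2.2, h.2.1.symm, h.1⟩
  · rintro ⟨k, l⟩ h
    simp only [Finset.mem_sigma, Finset.mem_erase] at h
    simp only
    rw [enSign_erase T h.1 h.2.2 h.2.1.symm, Finset.erase_right_comm (a := l) (b := k)]
    ring

lemma extMul_self (x : ι → R) (v : Finset ι → R) : extMul x (extMul x v) = 0 := by
  ext T
  rw [extMul_extMul_apply]
  refine Finset.sum_involution (fun p _ => ⟨p.2, p.1⟩) ?_ ?_ ?_ fun _ _ => rfl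
  · rintro ⟨k, l⟩ h
    simp only [Finset.mem_sigma, Finset.mem_erase] at h
    simp only
    rw [enSign_erase T h.1 h.2.2 h.2.1.symm, Finset.erase_right_comm (a := l) (b := k)]
    ring
  · rintro ⟨k, l⟩ h _ h'
    simp only [Finset.mem_sigma, Finset.mem_erase] at h
    simp only [Sigma.mk.injEq] at h'
    exact h.2.1 h'.1
  · rintro ⟨k, l⟩ h
    simp only [Finset.mem_sigma, Finset.mem_erase] at h ⊢
    exact ⟨h.2.2, h.2.1.symm, h.1⟩

/-- Contraction is an antiderivation of the exterior algebra. -/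
lemma extContract_extMul (l : ι) (x : ι → R) (v : Finset ι → R) :
    extContract l (extMul x v) = x l • v - extMul x (extContract l v) := by
  ext T
  rw [Pi.sub_apply, Pi.smul_apply, smul_eq_mul, eq_sub_iff_add_eq]
  by_cases hl : l ∈ T
  · rw [extContract, if_pos hl, zero_add, extMul, Finset.sum_eq_single l]
    · rw [extContract, if_neg (Finset.notMem_erase l T), Finset.insert_erase hl,
        enSign_erase_self]
      linear_combination x l * v T * enSign_mul_self (R := R) T l
    · intro k hk hkl
      rw [extContract, if_pos (Finset.mem_erase.2 ⟨hkl.symm, hl⟩), mul_zero]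
    · exact fun h => absurd hl h
  · have hT : (insert l T).erase l = T := Finset.erase_insert hl
    have h0 : enSign R (insert l T) l = enSign R T l := by
      rw [← enSign_erase_self (insert l T), hT]
    rw [extContract, if_neg hl, extMul, Finset.sum_insert hl, hT, h0, extMul, mul_add,
      Finset.mul_sum, add_assoc, ← Finset.sum_add_distrib, Finset.sum_eq_zero, add_zero]
    · linear_combination x l * v T * enSign_mul_self (R := R) T l
    · intro k hk
      have hkl : l ≠ k := fun h => hl (h ▸ hk)
      have hlk : l ∉ T.erase k := fun h => hl (Finset.mem_of_mem_erase h)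
      rw [extContract, if_neg hlk, ← Finset.erase_insert_of_ne hkl]
      have h1 := enSign_erase (R := R) (insert l T) (Finset.mem_insert_of_mem hk)
        (Finset.mem_insert_self l T) hkl.symm
      rw [hT, h0, Finset.erase_insert_of_ne hkl, ← enSign_erase_self (insert l (T.erase k)),
        Finset.erase_insert hlk] at h1
      rw [Finset.erase_insert_of_ne hkl]
      have h2 := enSign_mul_self (R := R) T l
      have h3 := enSign_mul_self (R := R) T k
      have h4 := enSign_mul_self (R := R) (T.erase k) l
      generalize v (insert l (T.erase k)) = V
      generalize enSign R T l = a at *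
      generalize enSign R T k = b at *
      generalize enSign R (T.erase k) l = c at *
      generalize enSign R (insert l T) k = d at *
      linear_combination V * x k * (a * c * h1 - a * d * h4 - b * c * h2)

lemma extContract_smul (l : ι) (r : R) (v : Finset ι → R) :
    extContract l (r • v) = r • extContract l v := by
  ext T; simp only [extContract, Pi.smul_apply, smul_eq_mul]; split_ifs <;> ring

/-- Multiplication by `x g + y` on the exterior algebra over `R[g]`; the argument `a : ℕ` of a
vector is the exponent of `g`. -/
def koszulMul (x y : ι → R) (v : ℕ → Finset ι → R) : ℕ → Finset ι → R
  | 0 => extMul y (v 0)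
  | a + 1 => extMul y (v (a + 1)) + extMul x (v a)

/-- A homotopy for the minor `x i * y j - x j * y i` on the complex with differential `koszulMul`.
With `α = y j f_i - y i f_j`, which is orthogonal to `y` and pairs to the minor with `x`, it is the
contraction by `α` combined with the division by `g`; the correction in `g`-degree zero makes up
for the constant terms that the division drops. -/
def koszulHomotopy (x y : ι → R) (i j : ι) (v : ℕ → Finset ι → R) : ℕ → Finset ι → R
  | 0 => y j • extContract i (v 1) - y i • extContract j (v 1) +
      extMul x (extContract i (extContract j (v 0)))
  | a + 1 => y j • extContract i (v (a + 2)) - y i • extContract j (v (a + 2))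

lemma koszulMul_koszulHomotopy (x y : ι → R) (i j : ι) (v : ℕ → Finset ι → R) :
    koszulMul x y (koszulHomotopy x y i j v) + koszulHomotopy x y i j (koszulMul x y v) =
      (x i * y j - x j * y i) • v := by
  funext a
  rcases a with _ | _ | a
  all_goals
    simp only [Pi.add_apply, koszulMul, koszulHomotopy, extMul_add, extMul_sub, extMul_smul,
      extContract_add, extContract_extMul, extContract_sub, extContract_smul, extMul_self,
      Pi.smul_apply]
    try rw [extMul_extMul y x]
    module

end Exterior

section Minors

variable {R : Type u} [CommRing R] {ι : Type} [LinearOrder ι]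

/-- The embedding of the dual of the Eagon–Northcott complex of the matrix with rows `x`, `y` into
the exterior algebra over `R[g]` with differential `koszulMul x y`.  The generator in degree zero
is sent to `-x`, because its coboundary is the element `-y ∧ x` formed by the minors. -/
noncomputable def enCochain (x : ι → R) (w : ENGen ι → R) (a : ℕ) (T : Finset ι) : R :=
  (∑ b : Fin (T.card - 1), if a = b then w (some ⟨T, b⟩) else 0) -
    if a = 0 then w none * extMul x (Pi.single ∅ 1) T else 0

lemma extMul_single_empty (x : ι → R) (T : Finset ι) :
    extMul x (Pi.single ∅ 1) T = if T.card = 1 then ∑ k ∈ T, x k else 0 := by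
  split_ifs with h
  · obtain ⟨k, rfl⟩ := Finset.card_eq_one.1 h
    simp [extMul, enSign, Finset.filter_singleton]
  · refine Finset.sum_eq_zero fun k hk => ?_
    rw [Pi.single_eq_of_ne, mul_zero]
    intro h'
    have := Finset.card_erase_add_one hk
    rw [h', Finset.card_empty] at this
    omega

lemma enCochain_of_lt (x : ι → R) (w : ENGen ι → R) {a : ℕ} {T : Finset ι} (h : a < T.card - 1) :
    enCochain x w a T = w (some ⟨T, ⟨a, h⟩⟩) := by
  rw [enCochain, Finset.sum_eq_single ⟨a, h⟩]
  · rw [extMul_single_empty, if_neg (show T.card ≠ 1 by omega)]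
    simp
  · intro b _ hb
    exact if_neg fun h' => hb (Fin.ext h'.symm)
  · simp

lemma enCochain_of_le (x : ι → R) (w : ENGen ι → R) {a : ℕ} {T : Finset ι} (h : T.card - 1 ≤ a) :
    enCochain x w a T = -if a = 0 then w none * extMul x (Pi.single ∅ 1) T else 0 := by
  rw [enCochain, Finset.sum_eq_zero, zero_sub]
  intro b _
  exact if_neg (by have := b.2; omega)

lemma extMul_extMul_single_empty (x y : ι → R) {T : Finset ι} (h : T.card ≠ 2) :
    extMul y (extMul x (Pi.single ∅ 1)) T = 0 := by
  refine Finset.sum_eq_zero fun k hk => ?_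
  rw [extMul_single_empty, if_neg, mul_zero]
  rw [Finset.card_erase_of_mem hk]
  have := Finset.card_pos.2 ⟨k, hk⟩
  omega

lemma enEntry_none_eq (A : Matrix (Fin 2) ι R) (T : Finset ι) (c : Fin (T.card - 1)) :
    enEntry A none (some ⟨T, c⟩) = -extMul (A 1) (extMul (A 0) (Pi.single ∅ 1)) T := by
  simp only [enEntry]
  split_ifs with h
  · obtain ⟨k, l, hkl, rfl⟩ : ∃ k l, k < l ∧ T = {k, l} := by
      obtain ⟨k, l, hkl, rfl⟩ := Finset.card_eq_two.1 h
      rcases lt_or_gt_of_ne hkl with h' | h'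
      · exact ⟨k, l, h', rfl⟩
      · exact ⟨l, k, h', Finset.pair_comm _ _⟩
    have e1 : ({k, l} : Finset ι).erase k = {l} := by ext t; simp; grind
    have e2 : ({k, l} : Finset ι).erase l = {k} := by ext t; simp; grind
    rw [extMul]
    simp only [extMul_single_empty, Finset.sum_pair hkl.ne, e1, e2, hkl, hkl.not_gt, enSign,
      Finset.filter_insert, Finset.filter_singleton, lt_irrefl, if_true, if_false]
    simp
    ring
  · rw [extMul_extMul_single_empty _ _ h, neg_zero]

variable [Fintype ι]

/-- `enCochain` is a map of complexes. -/
lemma enCochain_vecMul (A : Matrix (Fin 2) ι R) (w : ENGen ι → R) :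
    enCochain (A 0) (Matrix.vecMul w (Matrix.of (enEntry A))) =
      koszulMul (A 0) (A 1) (enCochain (A 0) w) := by
  have h0 : Matrix.vecMul w (Matrix.of (enEntry A)) none = 0 := by
    refine Finset.sum_eq_zero fun x _ => ?_
    rcases x with _ | ⟨U, a⟩ <;> simp [enEntry]
  have hs : ∀ (z : ι → R) (a : ℕ) (T : Finset ι), extMul z (enCochain (A 0) w a) T =
      (∑ k ∈ T, enSign R T k * z k *
        ∑ b : Fin ((T.erase k).card - 1), if a = b then w (some ⟨T.erase k, b⟩) else 0) -
      if a = 0 then w none * extMul z (extMul (A 0) (Pi.single ∅ 1)) T else 0 := by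
    intro z a T
    simp only [extMul, enCochain, mul_sub, Finset.sum_sub_distrib]
    congr 1
    split_ifs with h
    · rw [Finset.mul_sum]
      refine Finset.sum_congr rfl fun k _ => ?_
      ring
    · simp
  funext a T
  rcases lt_or_ge a (T.card - 1) with h | h
  · rw [enCochain_of_lt _ _ h]
    have h1 : Matrix.vecMul w (Matrix.of (enEntry A)) (some ⟨T, ⟨a, h⟩⟩) =
        ∑ y, w y * enEntry A y (some ⟨T, ⟨a, h⟩⟩) := rfl
    rw [h1, sum_mul_enEntry, enEntry_none_eq]
    rcases a with _ | a
    · simp only [koszulMul, hs, if_true]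
      have : ∀ k ∈ T, ∑ b : Fin ((T.erase k).card - 1),
          w (some ⟨T.erase k, b⟩) * (enSign R T k * enContract A b 0 k) =
          enSign R T k * A 1 k * ∑ b : Fin ((T.erase k).card - 1),
            if 0 = (b : ℕ) then w (some ⟨T.erase k, b⟩) else 0 := by
        intro k _
        rw [Finset.mul_sum]
        refine Finset.sum_congr rfl fun b _ => ?_
        simp only [enContract]
        split_ifs <;> first | omega | contradiction | ring
      rw [Finset.sum_congr rfl this]
      ring
    · simp only [koszulMul, hs, Pi.add_apply, extMul_self]
      have : ∀ k ∈ T, ∑ b : Fin ((T.erase k).card - 1),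
          w (some ⟨T.erase k, b⟩) * (enSign R T k * enContract A b (a + 1) k) =
          enSign R T k * A 1 k * (∑ b : Fin ((T.erase k).card - 1),
            if a + 1 = (b : ℕ) then w (some ⟨T.erase k, b⟩) else 0) +
          enSign R T k * A 0 k * ∑ b : Fin ((T.erase k).card - 1),
            if a = (b : ℕ) then w (some ⟨T.erase k, b⟩) else 0 := by
        intro k _
        rw [Finset.mul_sum, Finset.mul_sum, ← Finset.sum_add_distrib]
        refine Finset.sum_congr rfl fun b _ => ?_
        simp only [enContract]
        split_ifs <;> first | omega | ring
      rw [Finset.sum_congr rfl this, Finset.sum_add_distrib,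
        extMul_extMul_single_empty _ _ (by omega)]
      simp
  · rw [enCochain_of_le _ _ h, h0]
    have hz : ∀ (z : ι → R) (a : ℕ), T.card - 2 ≤ a →
        extMul z (enCochain (A 0) w a) T =
        -if a = 0 then w none * extMul z (extMul (A 0) (Pi.single ∅ 1)) T else 0 := by
      intro z a ha
      rw [hs, Finset.sum_eq_zero, zero_sub]
      intro k hk
      rw [Finset.sum_eq_zero, mul_zero]
      intro b _
      have h1 := b.2
      have h2 := Finset.card_erase_of_mem hk
      exact if_neg (by omega)
    rcases a with _ | a
    · simp only [koszulMul, if_true]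
      rw [hz (A 1) 0 (by omega), if_pos rfl, extMul_extMul_single_empty _ _ (by omega)]
      simp
    · simp only [koszulMul, Pi.add_apply]
      rw [hz (A 1) (a + 1) (by omega), hz (A 0) a (by omega)]
      simp [extMul_self]

/-- The homotopy `koszulHomotopy`, restricted to the dual of the Eagon–Northcott complex. -/
noncomputable def enHomotopy (A : Matrix (Fin 2) ι R) (i j : ι) (w : ENGen ι → R) : ENGen ι → R
  | none => -extContract i (extContract j (enCochain (A 0) w 0)) ∅
  | some ⟨T, a⟩ => koszulHomotopy (A 0) (A 1) i j (enCochain (A 0) w) a T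

omit [Fintype ι] in
/-- The image of `enCochain` is stable under `koszulHomotopy`.  The point is the coefficient of
`g^0` on the one-element sets, where the correction term of `koszulHomotopy` yields a multiple of
`x`, as it must for an element in the image. -/
lemma enCochain_enHomotopy (A : Matrix (Fin 2) ι R) (i j : ι) (w : ENGen ι → R) :
    enCochain (A 0) (enHomotopy A i j w) =
      koszulHomotopy (A 0) (A 1) i j (enCochain (A 0) w) := by
  funext a T
  rcases lt_or_ge a (T.card - 1) with h | h
  · rw [enCochain_of_lt _ _ h]
    rfl
  · have hz : ∀ k, extContract k (enCochain (A 0) w (a + 1)) T = 0 := by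
      intro k
      rw [extContract]
      split_ifs with hk
      · rfl
      · rw [enCochain_of_le, if_neg (by omega), neg_zero, mul_zero]
        rw [Finset.card_insert_of_notMem hk]
        omega
    rw [enCochain_of_le _ _ h]
    rcases a with _ | a
    · have h1 : ∀ u : Finset ι → R, extMul (A 0) u T =
          u ∅ * extMul (A 0) (Pi.single ∅ 1) T := by
        intro u
        simp only [extMul, Finset.mul_sum]
        refine Finset.sum_congr rfl fun k hk => ?_
        have h2 : T.erase k = ∅ := by
          rw [← Finset.card_eq_zero, Finset.card_erase_of_mem hk]
          omega
        rw [h2, Pi.single_eq_same]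
        ring
      simp only [koszulHomotopy, Pi.add_apply, Pi.sub_apply, Pi.smul_apply, hz]
      rw [h1 (extContract i _)]
      simp [enHomotopy]
    · simp only [koszulHomotopy, Pi.sub_apply, Pi.smul_apply, hz]
      simp

lemma enHomotopy_vecMul (A : Matrix (Fin 2) ι R) (i j : ι) (w : ENGen ι → R) :
    Matrix.vecMul (enHomotopy A i j w) (Matrix.of (enEntry A)) +
      enHomotopy A i j (Matrix.vecMul w (Matrix.of (enEntry A))) =
      (A 0 i * A 1 j - A 0 j * A 1 i) • w := by
  have h := koszulMul_koszulHomotopy (A 0) (A 1) i j (enCochain (A 0) w)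
  funext y
  rcases y with _ | ⟨T, a⟩
  · have h0 : Matrix.vecMul (enHomotopy A i j w) (Matrix.of (enEntry A)) none = 0 := by
      refine Finset.sum_eq_zero fun x _ => ?_
      rcases x with _ | ⟨U, a⟩ <;> simp [enEntry]
    rw [Pi.add_apply, h0, zero_add]
    have h1 : ∀ k, extContract k (enCochain (A 0) w 0) ∅ = -(w none * A 0 k) := by
      intro k
      rw [extContract, if_neg (Finset.notMem_empty k), enCochain_of_le _ _ (by simp), if_pos rfl,
        extMul_single_empty]
      simp [enSign]
    simp only [enHomotopy, enCochain_vecMul, koszulMul, extContract_extMul, extContract_sub,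
      extContract_smul, Pi.sub_apply, Pi.smul_apply, smul_eq_mul, h1]
    simp only [extMul, Finset.sum_empty]
    ring
  · rw [← enCochain_enHomotopy, ← enCochain_vecMul, ← enCochain_vecMul,
      ← enCochain_enHomotopy] at h
    have h1 := congrFun (congrFun h a) T
    simp only [Pi.add_apply, Pi.smul_apply] at h1
    rw [enCochain_of_lt _ _ a.2, enCochain_of_lt _ _ a.2, enCochain_of_lt _ _ a.2] at h1
    exact h1

omit [Fintype ι] in
lemma enCochain_add (x : ι → R) (w w' : ENGen ι → R) :
    enCochain x (w + w') = enCochain x w + enCochain x w' := by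
  funext a T
  rcases lt_or_ge a (T.card - 1) with h | h
  · simp [enCochain_of_lt _ _ h]
  · simp only [enCochain_of_le _ _ h, Pi.add_apply]
    split_ifs <;> ring

omit [Fintype ι] in
lemma enCochain_smul (x : ι → R) (r : R) (w : ENGen ι → R) :
    enCochain x (r • w) = r • enCochain x w := by
  funext a T
  rcases lt_or_ge a (T.card - 1) with h | h
  · simp [enCochain_of_lt _ _ h]
  · simp only [enCochain_of_le _ _ h, Pi.smul_apply, smul_eq_mul]
    split_ifs <;> ring

omit [Fintype ι] in
lemma enHomotopy_add (A : Matrix (Fin 2) ι R) (i j : ι) (w w' : ENGen ι → R) :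
    enHomotopy A i j (w + w') = enHomotopy A i j w + enHomotopy A i j w' := by
  funext y
  rcases y with _ | ⟨T, a⟩
  · simp only [enHomotopy, enCochain_add, Pi.add_apply, extContract_add]
    ring
  · simp only [enHomotopy, enCochain_add, Pi.add_apply]
    rcases (a : ℕ) with _ | a <;>
      simp only [koszulHomotopy, Pi.add_apply, Pi.sub_apply, Pi.smul_apply, extContract_add,
        extMul_add, smul_eq_mul] <;> ring

omit [Fintype ι] in
lemma enHomotopy_smul (A : Matrix (Fin 2) ι R) (i j : ι) (r : R) (w : ENGen ι → R) :
    enHomotopy A i j (r • w) = r • enHomotopy A i j w := by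
  funext y
  rcases y with _ | ⟨T, a⟩
  · simp only [enHomotopy, enCochain_smul, Pi.smul_apply, extContract_smul, smul_eq_mul]
    ring
  · simp only [enHomotopy, enCochain_smul, Pi.smul_apply]
    rcases (a : ℕ) with _ | a <;>
      simp only [koszulHomotopy, Pi.add_apply, Pi.sub_apply, Pi.smul_apply, extContract_smul,
        extMul_smul, smul_eq_mul] <;> ring

/-- Multiplication by a minor is null-homotopic on the Eagon–Northcott complex. -/
theorem minor_mem_nullHomotopyIdeal (A : Matrix (Fin 2) ι R) (i j : ι) :
    A 0 i * A 1 j - A 0 j * A 1 i ∈ nullHomotopyIdeal (Matrix.of (enEntry A)) := by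
  let h : (ENGen ι → R) →ₗ[R] (ENGen ι → R) :=
    { toFun := enHomotopy A i j
      map_add' := enHomotopy_add A i j
      map_smul' := enHomotopy_smul A i j }
  let D : Matrix (ENGen ι) (ENGen ι) R := Matrix.of (enEntry A)
  have key : D.transpose * LinearMap.toMatrix' h + LinearMap.toMatrix' h * D.transpose =
      (A 0 i * A 1 j - A 0 j * A 1 i) • (1 : Matrix (ENGen ι) (ENGen ι) R) := by
    apply Matrix.toLin'.injective
    ext1 w
    ext1
    simp only [LinearMap.comp_apply, Matrix.toLin'_apply, Matrix.add_mulVec, ← Matrix.mulVec_mulVec,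
      Matrix.mulVec_transpose, Matrix.smul_mulVec, Matrix.one_mulVec, LinearMap.toMatrix'_mulVec]
    exact enHomotopy_vecMul A i j _
  refine ⟨(LinearMap.toMatrix' h).transpose, ?_⟩
  have := congrArg Matrix.transpose key
  rw [Matrix.transpose_add, Matrix.transpose_mul, Matrix.transpose_mul, Matrix.transpose_smul,
    Matrix.transpose_one, Matrix.transpose_transpose] at this
  rw [← this, add_comm]

end Minors

section ENExact

variable {R : Type u} [CommRing R] {ι : Type} [LinearOrder ι] [Fintype ι]

/-- The ideal generated by the `2 × 2` minors of a matrix with two rows. -/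
def minorIdeal {R : Type*} [CommRing R] {ι : Type*} (A : Matrix (Fin 2) ι R) : Ideal R :=
  Ideal.span (Set.range fun p : ι × ι => A 0 p.1 * A 1 p.2 - A 0 p.2 * A 1 p.1)

/-- The total differential of the Eagon–Northcott complex. -/
abbrev enMatrix (A : Matrix (Fin 2) ι R) : Matrix (ENGen ι) (ENGen ι) R := Matrix.of (enEntry A)

lemma minorIdeal_le_nullHomotopyIdeal (A : Matrix (Fin 2) ι R) :
    minorIdeal A ≤ nullHomotopyIdeal (enMatrix A) := by
  rw [minorIdeal, Ideal.span_le]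
  rintro _ ⟨p, rfl⟩
  exact minor_mem_nullHomotopyIdeal A p.1 p.2

lemma minorIdeal_le_nullHomotopyIdeal_transpose (A : Matrix (Fin 2) ι R) :
    minorIdeal A ≤ nullHomotopyIdeal (enMatrix A).transpose :=
  (minorIdeal_le_nullHomotopyIdeal A).trans (nullHomotopyIdeal_transpose_le _)

lemma enMatrix_mul_self (A : Matrix (Fin 2) ι R) : enMatrix A * enMatrix A = 0 :=
  Matrix.ext fun x z => by simpa [Matrix.mul_apply] using enEntry_sum_mul A x z

lemma enMatrix_transpose_mul_self (A : Matrix (Fin 2) ι R) :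
    (enMatrix A).transpose * (enMatrix A).transpose = 0 := by
  rw [← Matrix.transpose_mul, enMatrix_mul_self, Matrix.transpose_zero]

omit [LinearOrder ι] in
lemma ENGen.hdeg_le (x : ENGen ι) : x.hdeg ≤ Fintype.card ι - 1 := by
  rcases x with _ | ⟨T, a⟩
  · exact Nat.zero_le _
  · exact Nat.sub_le_sub_right (Finset.card_le_univ T) 1

omit [Fintype ι] in
lemma enMatrix_deg (A : Matrix (Fin 2) ι R) (x y : ENGen ι) (h : enMatrix A x y ≠ 0) :
    y.hdeg = x.hdeg + 1 :=
  not_imp_comm.1 (enEntry_eq_zero A x y) h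

/-- The degree of a basis element in the dual of the Eagon–Northcott complex. -/
def ENGen.dualDeg (x : ENGen ι) : ℕ := Fintype.card ι - 1 - x.hdeg

lemma enMatrix_transpose_deg (A : Matrix (Fin 2) ι R) (x y : ENGen ι)
    (h : (enMatrix A).transpose x y ≠ 0) : y.dualDeg = x.dualDeg + 1 := by
  have h1 := enMatrix_deg A y x h
  have h2 := x.hdeg_le
  simp only [ENGen.dualDeg]
  omega

open RingTheory.Sequence

variable {A : Matrix (Fin 2) ι R} {rs : List R}

/-- The Eagon–Northcott complex is exact in positive degrees if the ideal of minors contains a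
regular sequence whose length is the length of the complex. -/
theorem enMatrix_exact (hrs : ∀ r ∈ rs, r ∈ minorIdeal A) (hlen : rs.length = Fintype.card ι - 1)
    {M : Type*} [AddCommGroup M] [Module R M] (hreg : IsWeaklyRegular M rs) {j : ℕ} (hj : 1 ≤ j)
    {z : ENGen ι → M} (hz : ∀ x, x.hdeg ≠ j → z x = 0) (hDz : (enMatrix A).smulVecLin M z = 0) :
    ∃ v : ENGen ι → M, (∀ x, x.hdeg ≠ j + 1 → v x = 0) ∧ (enMatrix A).smulVecLin M v = z :=
  exists_boundary_of_isWeaklyRegular (enMatrix_mul_self A) (enMatrix_deg A) ENGen.hdeg_le rs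
    (fun r hr => minorIdeal_le_nullHomotopyIdeal A (hrs r hr)) M hreg (by omega) hz hDz

/-- The dual of the Eagon–Northcott complex is exact in positive degrees under the same
hypothesis. -/
theorem enMatrix_transpose_exact (hrs : ∀ r ∈ rs, r ∈ minorIdeal A)
    (hlen : rs.length = Fintype.card ι - 1)
    {M : Type*} [AddCommGroup M] [Module R M] (hreg : IsWeaklyRegular M rs) {j : ℕ} (hj : 1 ≤ j)
    {z : ENGen ι → M} (hz : ∀ x, x.dualDeg ≠ j → z x = 0)
    (hDz : (enMatrix A).transpose.smulVecLin M z = 0) :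
    ∃ v : ENGen ι → M, (∀ x, x.dualDeg ≠ j + 1 → v x = 0) ∧
      (enMatrix A).transpose.smulVecLin M v = z :=
  exists_boundary_of_isWeaklyRegular (enMatrix_transpose_mul_self A) (enMatrix_transpose_deg A)
    (fun _ => Nat.sub_le _ _) rs
    (fun r hr => minorIdeal_le_nullHomotopyIdeal_transpose A (hrs r hr)) M hreg (by omega) hz hDz

/-- The boundaries in degree zero form the ideal of minors. -/
lemma mem_minorIdeal_iff {r : R} : r ∈ minorIdeal A ↔
    ∃ w, (enMatrix A).smulVecLin R w = Pi.single none r := by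
  constructor
  · intro hr
    have h0 : (enMatrix A).smulVecLin R (Pi.single none 1) = 0 := by
      ext x
      rw [Matrix.smulVecLin_apply, Finset.sum_eq_zero]
      · rfl
      · rintro (_ | y) _
        · rcases x with _ | ⟨U, a⟩ <;> simp [enEntry]
        · rw [Pi.single_eq_of_ne (by simp), smul_zero]
    obtain ⟨w, hw⟩ := exists_smulVecLin_eq_smul (minorIdeal_le_nullHomotopyIdeal A hr) h0
    refine ⟨w, hw.trans ?_⟩
    rw [← Pi.single_smul, smul_eq_mul, mul_one]
  · rintro ⟨w, hw⟩
    have h1 := congrFun hw none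
    rw [Pi.single_eq_same, Matrix.smulVecLin_apply] at h1
    rw [← h1]
    refine Ideal.sum_mem _ fun y _ => ?_
    rw [smul_eq_mul]
    refine Ideal.mul_mem_right _ _ ?_
    rcases y with _ | ⟨T, c⟩
    · exact zero_mem _
    · simp only [Matrix.of_apply, enEntry]
      split_ifs
      · refine Ideal.sum_mem _ fun i _ => Ideal.sum_mem _ fun j _ => ?_
        split_ifs
        · exact Ideal.subset_span ⟨(i, j), rfl⟩
        · exact zero_mem _
      · exact zero_mem _

/-- If `r` followed by a maximal regular sequence of the ideal of minors is a regular sequence,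
then `r` is a nonzerodivisor modulo the minors. -/
theorem mem_minorIdeal_of_mul_mem (hrs : ∀ r ∈ rs, r ∈ minorIdeal A)
    (hlen : rs.length = Fintype.card ι - 1) {r : R} (hreg : IsWeaklyRegular R (r :: rs)) {p : R}
    (h : r * p ∈ minorIdeal A) : p ∈ minorIdeal A := by
  rw [isWeaklyRegular_cons_iff] at hreg
  obtain ⟨w, hw⟩ := mem_minorIdeal_iff.1 h
  obtain ⟨v, -, hv⟩ := exists_boundary_of_smul_eq (enMatrix_mul_self A) (enMatrix_deg A) hreg.1
    (j := 0) (z := Pi.single none p) (w₀ := w) (fun z hz hDz => by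
      obtain ⟨v, -, hv⟩ := enMatrix_exact hrs hlen hreg.2 le_rfl hz hDz
      exact ⟨v, hv⟩) (by
      rintro (_ | y) hx
      · exact absurd rfl hx
      · exact Pi.single_eq_of_ne (by simp) _) (by rw [hw, ← Pi.single_smul]; rfl)
  exact mem_minorIdeal_iff.2 ⟨v, hv⟩

/-- Under the same hypothesis, `r` is a nonzerodivisor on the zeroth homology of the dual
complex. -/
theorem exists_transpose_boundary_of_smul_eq (hrs : ∀ r ∈ rs, r ∈ minorIdeal A)
    (hlen : rs.length = Fintype.card ι - 1) {r : R} (hreg : IsWeaklyRegular R (r :: rs))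
    {z w : ENGen ι → R} (hz : ∀ x, x.dualDeg ≠ 0 → z x = 0)
    (h : (enMatrix A).transpose.smulVecLin R w = r • z) :
    ∃ v, (enMatrix A).transpose.smulVecLin R v = z := by
  rw [isWeaklyRegular_cons_iff] at hreg
  obtain ⟨v, -, hv⟩ := exists_boundary_of_smul_eq (enMatrix_transpose_mul_self A)
    (enMatrix_transpose_deg A) hreg.1 (j := 0) (z := z) (w₀ := w) (fun z hz hDz => by
      obtain ⟨v, -, hv⟩ := enMatrix_transpose_exact hrs hlen hreg.2 le_rfl hz hDz
      exact ⟨v, hv⟩) hz h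
  exact ⟨v, hv⟩

end ENExact

/-! ### Triangular regular sequences in polynomial rings -/

section Triangular

open MvPolynomial RingTheory.Sequence

/-- The step of a triangular regular sequence.  The homomorphism from `A[X_σ]` to polynomials
over `A[X_σ] ⧸ (S)` that sends `X i` to the new variable has kernel `(S)`, because evaluation at
the class of `X i` gives back the class of a polynomial; and it sends `X i ^ N - b` to a monic
polynomial. -/
lemma mem_span_of_X_pow_sub_mul_mem {σ A : Type*} [CommRing A] (i : σ)
    {S : Set (MvPolynomial σ A)} (hS : S ⊆ supported A {i}ᶜ) {b : MvPolynomial σ A}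
    (hb : b ∈ supported A {i}ᶜ) {N : ℕ} (hN : N ≠ 0) {p : MvPolynomial σ A}
    (h : (X i ^ N - b) * p ∈ Ideal.span S) : p ∈ Ideal.span S := by
  classical
  let π := Ideal.Quotient.mkₐ A (Ideal.span S)
  let Θ : MvPolynomial σ A →ₐ[A] Polynomial (MvPolynomial σ A ⧸ Ideal.span S) :=
    aeval fun j => if j = i then Polynomial.X else Polynomial.C (π (X j))
  have hΘ : ∀ q ∈ supported A {i}ᶜ, Θ q = Polynomial.C (π q) := by
    intro q hq
    rw [supported_eq_adjoin_X] at hq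
    induction hq using Algebra.adjoin_induction with
    | mem q hq =>
      obtain ⟨j, hj, rfl⟩ := hq
      simp only [Θ, aeval_X]
      rw [if_neg (by simpa using hj)]
    | algebraMap r => simp only [AlgHom.commutes]; rfl
    | add q r _ _ hq hr => rw [map_add, map_add, map_add, hq, hr]
    | mul q r _ _ hq hr => rw [map_mul, map_mul, map_mul, hq, hr]
  have hev : ∀ q, (Θ q).eval (π (X i)) = π q := by
    intro q
    induction q using MvPolynomial.induction_on with
    | C a =>
      rw [← algebraMap_eq, AlgHom.commutes, AlgHom.commutes, Polynomial.algebraMap_apply,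
        Polynomial.eval_C]
    | add q r hq hr => rw [map_add, Polynomial.eval_add, hq, hr, map_add]
    | mul_X q j hq =>
      rw [map_mul, Polynomial.eval_mul, hq, map_mul]
      congr 1
      simp only [Θ, aeval_X]
      split_ifs with hj
      · rw [hj, Polynomial.eval_X]
      · rw [Polynomial.eval_C]
  have hzero : ∀ q ∈ Ideal.span S, Θ q = 0 := by
    intro q hq
    have : Ideal.span S ≤ RingHom.ker Θ := by
      rw [Ideal.span_le]
      intro s hs
      rw [SetLike.mem_coe, RingHom.mem_ker, hΘ s (hS hs)]
      rw [show π s = 0 from Ideal.Quotient.eq_zero_iff_mem.2 (Ideal.subset_span hs), map_zero]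
    exact this hq
  have h1 := hzero _ h
  have h2 : Θ (X i ^ N - b) = Polynomial.X ^ N - Polynomial.C (π b) := by
    rw [map_sub, map_pow, hΘ b hb]
    simp [Θ]
  rw [map_mul, h2] at h1
  replace h1 := (Polynomial.monic_X_pow_sub_C _ hN).mul_right_eq_zero_iff.1 h1
  rw [← Ideal.Quotient.eq_zero_iff_mem]
  change π p = 0
  rw [← hev, h1, Polynomial.eval_zero]

lemma isWeaklyRegular_concat {R : Type*} [CommRing R] {rs : List R} {r : R}
    (h : IsWeaklyRegular R rs) (hr : ∀ p, r * p ∈ Ideal.ofList rs → p ∈ Ideal.ofList rs) :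
    IsWeaklyRegular R (rs ++ [r]) := by
  rw [isWeaklyRegular_append_iff]
  refine ⟨h, ?_⟩
  rw [isWeaklyRegular_singleton_iff]
  refine (isSMulRegular_iff_right_eq_zero_of_smul).2 fun q hq => ?_
  obtain ⟨p, rfl⟩ := Submodule.mkQ_surjective _ q
  rw [Submodule.mkQ_apply, ← Submodule.Quotient.mk_smul, Submodule.Quotient.mk_eq_zero] at hq
  rw [Submodule.mkQ_apply, Submodule.Quotient.mk_eq_zero]
  have hT : (Ideal.ofList rs • ⊤ : Submodule R R) = Ideal.ofList rs := by simp
  rw [hT] at hq ⊢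
  exact hr p hq

/-- Polynomials `X i ^ N - b`, such that `i` does not occur in `b` or in the preceding members of
the sequence, form a regular sequence. -/
theorem isWeaklyRegular_of_triangular {σ A : Type*} [CommRing A]
    (l : List (σ × ℕ × MvPolynomial σ A)) (h0 : ∀ t ∈ l, t.2.1 ≠ 0)
    (hb : ∀ t ∈ l, t.2.2 ∈ supported A {t.1}ᶜ)
    (hl : l.Pairwise fun s t => (X s.1 ^ s.2.1 - s.2.2 : MvPolynomial σ A) ∈ supported A {t.1}ᶜ) :
    IsWeaklyRegular (MvPolynomial σ A)
      (l.map fun t => (X t.1 ^ t.2.1 - t.2.2 : MvPolynomial σ A)) := by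
  induction l using List.reverseRecOn with
  | nil => exact IsWeaklyRegular.nil _ _
  | append_singleton l t ih =>
    rw [List.pairwise_append] at hl
    rw [List.map_append, List.map_singleton]
    refine isWeaklyRegular_concat (ih (fun s hs => h0 s (by simp [hs]))
      (fun s hs => hb s (by simp [hs])) hl.1) fun p hp => ?_
    refine mem_span_of_X_pow_sub_mul_mem t.1 ?_ (hb t (by simp)) (h0 t (by simp)) hp
    intro q hq
    obtain ⟨s, hs, rfl⟩ := List.mem_map.1 hq
    exact hl.2.2 s hs t (by simp)

end Triangular

/-! ### The ideal of minors -/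

section Ratio

/-- If `z i / z (i + 1)` is a constant ratio in the range `i ≤ n`, then `z i ^ n` is a product of
powers of `z 0` and `z n`. -/
lemma exists_pow_eq_of_ratio {B : Type*} [CommRing B] (z : ℕ → B) {n : ℕ} (hn : 0 < n)
    (hz : ∀ i j, i < n → j < n → z i * z (j + 1) = z j * z (i + 1)) {i : ℕ} (hi : i ≤ n) :
    ∃ s t, z i ^ n = z 0 ^ s * z n ^ t := by
  have h1 : ∀ i j, i + j ≤ n → z i * z j = z 0 * z (i + j) := by
    intro i
    induction i with
    | zero => intro j _; rw [zero_add]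
    | succ i ih =>
      intro j hj
      rw [mul_comm, ← hz i j (by omega) (by omega), ih (j + 1) (by omega)]
      congr 2; omega
  have h2 : ∀ d i j, i + d = n → j + d ≤ n + j → n ≤ i + j → i ≤ n → j ≤ n →
      z i * z j = z (i + j - n) * z n := by
    intro d
    induction d with
    | zero =>
      intro i j hi _ _ _ _
      obtain rfl : i = n := by omega
      rw [mul_comm]; congr 2; omega
    | succ d ih =>
      intro i j hi _ hij _ _
      obtain ⟨j, rfl⟩ : ∃ j', j = j' + 1 := ⟨j - 1, by omega⟩
      rw [hz i j (by omega) (by omega), mul_comm, ih (i + 1) j (by omega) (by omega) (by omega)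
        (by omega) (by omega)]
      congr 2; omega
  have h3 : ∀ m, ∃ q r s, q * n + r = i * (m + 1) ∧ r ≤ n ∧
      z i ^ (m + 1) = z 0 ^ s * z r * z n ^ q := by
    intro m
    induction m with
    | zero => exact ⟨0, i, 0, by ring, hi, by ring⟩
    | succ m ih =>
      obtain ⟨q, r, s, hq, hr, h⟩ := ih
      rcases le_total (r + i) n with h' | h'
      · refine ⟨q, r + i, s + 1, by rw [mul_add i, ← hq]; ring, h', ?_⟩
        rw [pow_succ, h]
        linear_combination z 0 ^ s * z n ^ q * h1 r i h'
      · refine ⟨q + 1, r + i - n, s, ?_, by omega, ?_⟩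
        · have : (q + 1) * n = q * n + n := by ring
          have : i * (m + 1 + 1) = i * (m + 1) + i := by ring
          omega
        · rw [pow_succ, h]
          linear_combination z 0 ^ s * z n ^ q *
            h2 (n - r) r i (by omega) (by omega) h' hr hi
  obtain ⟨q, r, s, hq, hr, h⟩ := h3 (n - 1)
  rw [Nat.sub_add_cancel hn] at hq h
  have h4 : r = 0 ∨ r = n := by
    have h5 : n ∣ r := (Nat.dvd_add_right ⟨q, mul_comm _ _⟩).1 (hq ▸ ⟨i, mul_comm _ _⟩)
    rcases Nat.eq_zero_or_pos r with h6 | h6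
    · exact Or.inl h6
    · exact Or.inr (le_antisymm hr (Nat.le_of_dvd h6 h5))
  rcases h4 with rfl | rfl
  · exact ⟨s + 1, q, by rw [h]; ring⟩
  · exact ⟨s, q + 1, by rw [h]; ring⟩

end Ratio

namespace Sally

variable {e : ℕ} {k : Type u} [Field k]

lemma x_of_lt {i : ℕ} (h : i < e) (h' : i ≠ 2 ∧ i ≠ 3) :
    x e k i = MvPolynomial.X ⟨⟨i, h⟩, h'⟩ := by
  simp only [x]
  rw [if_neg (by omega), if_neg (by omega), if_neg (by omega), dif_pos ⟨h, h'⟩]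

lemma X_eq_x (i : VarIdx e) : (MvPolynomial.X i : PolyRing e k) = x e k i.1 :=
  (x_of_lt i.1.2 i.2).symm

lemma x_mult (he : 6 ≤ e) : x e k e = x e k 0 * x e k 0 := by
  rw [x_of_lt (show 0 < e by omega) (by omega)]
  simp only [x]
  rw [if_pos trivial, dif_pos (by omega), pow_two]

lemma x_mult_add_one (he : 6 ≤ e) : x e k (e + 1) = x e k 0 * x e k 1 := by
  rw [x_of_lt (show 0 < e by omega) (by omega), x_of_lt (show 1 < e by omega) (by omega)]
  simp only [x]
  rw [if_neg (by omega), if_pos trivial, dif_pos (by omega), dif_pos (by omega)]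

lemma x_mult_add_two (he : 6 ≤ e) : x e k (e + 2) = x e k 1 * x e k 1 := by
  rw [x_of_lt (show 1 < e by omega) (by omega)]
  simp only [x]
  rw [if_neg (by omega), if_neg (by omega), if_pos trivial, dif_pos (by omega), pow_two]

/-- The minors formed by the columns `(X_i, X_(i+1))` lie in the ideal of minors also for
`i = e, e + 1`, because then `(X_i, X_(i+1))` is a multiple of `(X_0, X_1)`. -/
lemma x_minor_mem (he : 6 ≤ e) {i j : ℕ} (hi : i = 0 ∨ 4 ≤ i ∧ i ≤ e + 1)
    (hj : j = 0 ∨ 4 ≤ j ∧ j ≤ e + 1) :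
    x e k i * x e k (j + 1) - x e k j * x e k (i + 1) ∈ minorIdeal (matA e k) := by
  have key : ∀ {i : ℕ}, (i = 0 ∨ 4 ≤ i ∧ i ≤ e + 1) → ∃ (c : PolyRing e k) (l : ColIdx e),
      x e k i = c * matA e k 0 l ∧ x e k (i + 1) = c * matA e k 1 l := by
    intro i hi
    by_cases h : i < e
    · exact ⟨1, ⟨⟨i, h⟩, by simp only; omega⟩, by simp [matA], by simp [matA]⟩
    · obtain rfl | rfl : i = e ∨ i = e + 1 := by omega
      · exact ⟨x i k 0, ⟨⟨0, by omega⟩, by simp⟩, by simp [matA, x_mult he],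
          by simp [matA, x_mult_add_one he]⟩
      · exact ⟨x e k 1, ⟨⟨0, by omega⟩, by simp⟩, by simp [matA, x_mult_add_one he, mul_comm],
          by simp [matA, x_mult_add_two he]⟩
  obtain ⟨c, l, h1, h2⟩ := key hi
  obtain ⟨d, m, h3, h4⟩ := key hj
  rw [h1, h2, h3, h4]
  have h5 : matA e k 0 l * matA e k 1 m - matA e k 0 m * matA e k 1 l ∈ minorIdeal (matA e k) :=
    Ideal.subset_span ⟨(l, m), rfl⟩
  have h6 := Ideal.mul_mem_left _ (c * d) h5
  convert h6 using 1
  ring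

lemma mk_x_mul (he : 6 ≤ e) {J : Ideal (PolyRing e k)} (hJ : minorIdeal (matA e k) ≤ J) {i j : ℕ}
    (hi : i = 0 ∨ 4 ≤ i ∧ i ≤ e + 1) (hj : j = 0 ∨ 4 ≤ j ∧ j ≤ e + 1) :
    Ideal.Quotient.mk J (x e k i) * Ideal.Quotient.mk J (x e k (j + 1)) =
      Ideal.Quotient.mk J (x e k j) * Ideal.Quotient.mk J (x e k (i + 1)) := by
  rw [← map_mul, ← map_mul, Ideal.Quotient.eq]
  exact hJ (x_minor_mem he hi hj)

/-- `X_1^m X_i = X_0^m X_(i+m)` modulo the minors. -/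
lemma mk_x_one_pow_mul (he : 6 ≤ e) {i m : ℕ} (hi : 4 ≤ i) (him : i + m ≤ e + 2) :
    Ideal.Quotient.mk (minorIdeal (matA e k)) (x e k 1 ^ m * x e k i) =
      Ideal.Quotient.mk (minorIdeal (matA e k)) (x e k 0 ^ m * x e k (i + m)) := by
  induction m with
  | zero => simp
  | succ m ih =>
    have h1 := ih (by omega)
    have h2 := mk_x_mul (k := k) he le_rfl (i := 0) (j := i + m) (by omega) (by omega)
    simp only [map_mul, map_pow, zero_add] at h1 h2 ⊢
    rw [← add_assoc, pow_succ, pow_succ, mul_assoc, mul_left_comm, h1, mul_assoc _ _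
      (Ideal.Quotient.mk _ (x e k (i + m + 1))), h2]
    ring

/-- Modulo the minors `X_4, …, X_e` are in geometric progression, so `X_i^(e-4)` is a monomial in
`X_4` and `X_e = X_0^2`. -/
lemma exists_x_pow_sub_mem (he : 6 ≤ e) {i : ℕ} (hi : 4 ≤ i) (hie : i ≤ e) :
    ∃ s t, x e k i ^ (e - 4) - x e k 4 ^ s * (x e k 0 * x e k 0) ^ t ∈ minorIdeal (matA e k) := by
  obtain ⟨s, t, h⟩ := exists_pow_eq_of_ratio
    (fun j => Ideal.Quotient.mk (minorIdeal (matA e k)) (x e k (4 + j))) (n := e - 4) (by omega)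
    (fun a b ha hb => mk_x_mul he le_rfl (i := 4 + a) (j := 4 + b) (by omega) (by omega))
    (i := i - 4) (by omega)
  refine ⟨s, t, ?_⟩
  rw [← Ideal.Quotient.eq, map_pow, map_mul, map_pow, map_pow, ← x_mult he]
  convert h using 3 <;> congr 2 <;> omega

open RingTheory.Sequence in
/-- The ideal of minors contains a regular sequence of length `e - 4` that remains regular when
`X_1` is put in front of it. -/
lemma exists_isWeaklyRegular (he : 6 ≤ e) : ∃ rs : List (PolyRing e k),
    (∀ r ∈ rs, r ∈ minorIdeal (matA e k)) ∧ rs.length = e - 4 ∧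
      IsWeaklyRegular (PolyRing e k) rs ∧ IsWeaklyRegular (PolyRing e k) (x e k 1 :: rs) := by
  classical
  choose s t hst using fun (i : VarIdx e) (hi : 5 ≤ (i.1 : ℕ)) =>
    exists_x_pow_sub_mem (k := k) he (i := i.1) (by omega) (by omega)
  let v0 : VarIdx e := ⟨⟨0, by omega⟩, by simp⟩
  let v1 : VarIdx e := ⟨⟨1, by omega⟩, by simp⟩
  have hv0 : x e k 0 = MvPolynomial.X v0 := x_of_lt _ _
  have hv1 : x e k 1 = MvPolynomial.X v1 := x_of_lt _ _
  let b : VarIdx e → PolyRing e k := fun i =>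
    if h : 5 ≤ (i.1 : ℕ) then x e k 4 ^ s i h * (x e k 0 * x e k 0) ^ t i h else 0
  let F : Finset (VarIdx e) := Finset.univ.filter fun i => 5 ≤ (i.1 : ℕ)
  -- the regular sequence `X_0^(e-2) - X_1^(e-4) X_4`, `X_i^(e-4) - X_4^s X_0^(2t)` for `i ≥ 5`
  let l : List (VarIdx e × ℕ × PolyRing e k) :=
    (v0, e - 2, x e k 1 ^ (e - 4) * x e k 4) :: F.toList.map fun i => (i, e - 4, b i)
  have hX : ∀ (j : ℕ) (i : VarIdx e), j < e → j ≠ 2 ∧ j ≠ 3 → j ≠ i.1 →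
      x e k j ∈ MvPolynomial.supported k {i}ᶜ := by
    intro j i h h' hij
    rw [x_of_lt h h']
    refine MvPolynomial.X_mem_supported.2 fun h2 => hij ?_
    rw [Set.mem_singleton_iff] at h2
    rw [← h2]
  have hbX : ∀ i j : VarIdx e, 5 ≤ (i.1 : ℕ) → 5 ≤ (j.1 : ℕ) →
      b i ∈ MvPolynomial.supported k {j}ᶜ := by
    intro i j hi hj
    simp only [b, dif_pos hi]
    have h0 := hX 0 j (by omega) (by omega) (by omega)
    exact mul_mem (pow_mem (hX 4 j (by omega) (by omega) (by omega)) _)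
      (pow_mem (mul_mem h0 h0) _)
  have hcard : F.card = e - 5 := by
    have h1 : F.card = (Finset.Ico 5 e).card := by
      refine Finset.card_bij (fun i _ => (i.1 : ℕ)) ?_ ?_ ?_
      · intro i hi
        simp only [F, Finset.mem_filter, Finset.mem_univ, true_and] at hi
        simp only [Finset.mem_Ico]
        exact ⟨hi, i.1.2⟩
      · intro i _ j _ h
        exact Subtype.ext (Fin.ext h)
      · intro i hi
        simp only [Finset.mem_Ico] at hi
        exact ⟨⟨⟨i, hi.2⟩, by simp only; omega⟩, by simp [F, hi.1], rfl⟩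
    rw [h1, Nat.card_Ico]
  have hlF : ∀ p ∈ F.toList.map (fun i => (i, e - 4, b i)),
      5 ≤ (p.1.1 : ℕ) ∧ p = (p.1, e - 4, b p.1) := by
    intro p hp
    obtain ⟨i, hi, rfl⟩ := List.mem_map.1 hp
    simp only [Finset.mem_toList, F, Finset.mem_filter, Finset.mem_univ, true_and] at hi
    exact ⟨hi, rfl⟩
  have hl0 : ∀ p ∈ l, p.2.1 ≠ 0 := by
    intro p hp
    rcases List.mem_cons.1 hp with rfl | hp
    · change e - 2 ≠ 0
      omega
    · rw [(hlF p hp).2]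
      change e - 4 ≠ 0
      omega
  have hlb : ∀ p ∈ l, p.2.2 ∈ MvPolynomial.supported k {p.1}ᶜ := by
    intro p hp
    rcases List.mem_cons.1 hp with rfl | hp
    · exact mul_mem (pow_mem (hX 1 v0 (by omega) (by omega) (by simp [v0])) _)
        (hX 4 v0 (by omega) (by omega) (by simp [v0]))
    · rw [(hlF p hp).2]
      exact hbX _ _ (hlF p hp).1 (hlF p hp).1
  have hlp : l.Pairwise fun s t =>
      (MvPolynomial.X s.1 ^ s.2.1 - s.2.2 : PolyRing e k) ∈ MvPolynomial.supported k {t.1}ᶜ := by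
    refine List.pairwise_cons.2 ⟨?_, ?_⟩
    · intro p hp
      have := (hlF p hp).1
      refine sub_mem (pow_mem ?_ _) (mul_mem (pow_mem ?_ _) ?_)
      · rw [X_eq_x]
        exact hX 0 p.1 (by omega) (by omega) (by omega)
      · exact hX 1 p.1 (by omega) (by omega) (by omega)
      · exact hX 4 p.1 (by omega) (by omega) (by omega)
    · rw [List.pairwise_map]
      refine List.Pairwise.imp_of_mem ?_ (Finset.nodup_toList F)
      intro i j hi hj hij
      simp only [Finset.mem_toList, F, Finset.mem_filter, Finset.mem_univ, true_and] at hi hj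
      refine sub_mem (pow_mem ?_ _) (hbX i j hi hj)
      exact MvPolynomial.X_mem_supported.2 hij
  have hreg := isWeaklyRegular_of_triangular l hl0 hlb hlp
  refine ⟨_, ?_, ?_, hreg, ?_⟩
  · intro r hr
    obtain ⟨p, hp, rfl⟩ := List.mem_map.1 hr
    rcases List.mem_cons.1 hp with rfl | hp
    · change MvPolynomial.X v0 ^ (e - 2) - x e k 1 ^ (e - 4) * x e k 4 ∈ _
      rw [← Ideal.Quotient.eq, mk_x_one_pow_mul he le_rfl (by omega), ← hv0,
        show 4 + (e - 4) = e by omega, x_mult he]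
      congr 1
      rw [← mul_assoc, ← pow_succ, ← pow_succ]
      congr 1; omega
    · obtain ⟨h5, h6⟩ := hlF p hp
      rw [h6]
      simp only [b, dif_pos h5]
      rw [X_eq_x]
      exact hst p.1 h5
  · simp only [l, List.map_cons, List.length_cons, List.length_map, Finset.length_toList, hcard]
    omega
  · have h := isWeaklyRegular_of_triangular ((v1, 1, 0) :: l) ?_ ?_ ?_
    · rw [hv1]
      simpa using h
    · intro p hp
      rcases List.mem_cons.1 hp with rfl | hp
      · simp
      · exact hl0 p hp
    · intro p hp
      rcases List.mem_cons.1 hp with rfl | hp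
      · exact zero_mem _
      · exact hlb p hp
    · refine List.pairwise_cons.2 ⟨?_, hlp⟩
      intro p hp
      refine sub_mem (pow_mem ?_ _) (zero_mem _)
      rw [X_eq_x]
      rcases List.mem_cons.1 hp with rfl | hp
      · exact hX 1 v0 (by omega) (by omega) (by simp [v0])
      · have := (hlF p hp).1
        exact hX 1 p.1 (by omega) (by omega) (by omega)

end Sally

/-! ### The ideal of minors is the kernel of a monomial parametrization -/

namespace Sally

variable {e : ℕ} {k : Type u} [Field k]

lemma card_colIdx (he : 6 ≤ e) : Fintype.card (ColIdx e) = e - 3 := by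
  have h1 : Fintype.card (ColIdx e) = (insert 0 (Finset.Ico 4 e)).card := by
    rw [← Finset.card_univ]
    refine Finset.card_bij (fun i _ => (i.1 : ℕ)) ?_ ?_ ?_
    · intro i _
      have h1 := i.2
      have h2 := i.1.2
      simp only [Finset.mem_insert, Finset.mem_Ico]
      omega
    · intro i _ j _ h
      exact Subtype.ext (Fin.ext h)
    · intro i hi
      simp only [Finset.mem_insert, Finset.mem_Ico] at hi
      exact ⟨⟨⟨i, by omega⟩, by simp only; omega⟩, Finset.mem_univ _, rfl⟩
  rw [h1, Finset.card_insert_of_notMem (by simp), Nat.card_Ico]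
  omega

lemma x_one_mul_mem (he : 6 ≤ e) {p : PolyRing e k} (h : x e k 1 * p ∈ minorIdeal (matA e k)) :
    p ∈ minorIdeal (matA e k) := by
  obtain ⟨rs, h1, h2, -, h3⟩ := exists_isWeaklyRegular (k := k) he
  exact mem_minorIdeal_of_mul_mem h1 (by rw [h2, card_colIdx he]; omega) h3 h

lemma x_one_pow_mul_mem (he : 6 ≤ e) {p : PolyRing e k} (L : ℕ)
    (h : x e k 1 ^ L * p ∈ minorIdeal (matA e k)) : p ∈ minorIdeal (matA e k) := by
  induction L with
  | zero => simpa using h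
  | succ L ih => exact ih (x_one_mul_mem he (by rwa [← mul_assoc, ← pow_succ']))

variable (e k) in
/-- The inclusion of the polynomial ring into its field of fractions. -/
noncomputable abbrev toFrac : PolyRing e k →+* FractionRing (PolyRing e k) :=
  algebraMap (PolyRing e k) (FractionRing (PolyRing e k))

variable (e k) in
/-- The parametrization of the zero set of the minors by `X_0`, `X_1`: in terms of
`t = X_1 / X_0` it sends `X_i`, `i ≥ 4`, to `X_0^2 t^(i-e)`. -/
noncomputable def surfaceParam : PolyRing e k →ₐ[k] FractionRing (PolyRing e k) :=
  MvPolynomial.aeval fun i =>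
    if (i.1 : ℕ) < 2 then toFrac e k (MvPolynomial.X i) else
      toFrac e k (x e k 0) ^ 2 *
        (toFrac e k (x e k 1) / toFrac e k (x e k 0)) ^
          ((i.1 : ℤ) - e)

lemma x_ne_zero {i : ℕ} (h : i < e) (h' : i ≠ 2 ∧ i ≠ 3) : x e k i ≠ 0 := by
  rw [x_of_lt h h']
  exact MvPolynomial.X_ne_zero _

lemma surfaceParam_x_of_lt_two (he : 6 ≤ e) {i : ℕ} (hi : i < 2) :
    surfaceParam e k (x e k i) = toFrac e k (x e k i) := by
  rw [x_of_lt (by omega) (by omega), surfaceParam, MvPolynomial.aeval_X, if_pos hi]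

lemma surfaceParam_x_of_ge (he : 6 ≤ e) {i : ℕ} (hi : 4 ≤ i) (hie : i ≤ e) :
    surfaceParam e k (x e k i) = toFrac e k (x e k 0) ^ 2 *
        (toFrac e k (x e k 1) / toFrac e k (x e k 0)) ^
          ((i : ℤ) - e) := by
  rcases hie.lt_or_eq with h | rfl
  · rw [x_of_lt h (by omega), surfaceParam, MvPolynomial.aeval_X, if_neg (by simp only; omega)]
  · rw [x_mult he, map_mul, surfaceParam_x_of_lt_two he (by omega), sub_self, zpow_zero]
    ring

lemma minorIdeal_le_ker_surfaceParam (he : 6 ≤ e) :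
    minorIdeal (matA e k) ≤ RingHom.ker (surfaceParam e k) := by
  have hu : toFrac e k (x e k 0) ≠ 0 := by
    simpa using x_ne_zero (k := k) (e := e) (i := 0) (by omega) (by omega)
  have hv : toFrac e k (x e k 1) ≠ 0 := by
    simpa using x_ne_zero (k := k) (e := e) (i := 1) (by omega) (by omega)
  have key : ∀ i : ColIdx e, surfaceParam e k (matA e k 1 i) =
      toFrac e k (x e k 1) / toFrac e k (x e k 0) *
        surfaceParam e k (matA e k 0 i) := by
    intro i
    have h1 := i.2
    have h2 := i.1.2
    simp only [matA, Matrix.of_apply, Fin.val_zero, Fin.val_one, add_zero]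
    by_cases h : (i.1 : ℕ) = 0
    · rw [h, surfaceParam_x_of_lt_two he (by omega), surfaceParam_x_of_lt_two he (by omega)]
      field_simp
    · rw [surfaceParam_x_of_ge he (by omega) (by omega),
        surfaceParam_x_of_ge he (by omega) (by omega), mul_left_comm,
        ← zpow_one_add₀ (div_ne_zero hv hu)]
      congr 2
      push_cast
      ring
  rw [minorIdeal, Ideal.span_le]
  rintro _ ⟨p, rfl⟩
  rw [SetLike.mem_coe, RingHom.mem_ker, map_sub, map_mul, map_mul, key, key]
  ring

/-- Modulo the minors, a power of `X_1` carries every polynomial into `k[X_0, X_1]`. -/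
lemma exists_x_one_pow_mul_sub_mem (he : 6 ≤ e) (p : PolyRing e k) :
    ∃ L, ∃ q ∈ Algebra.adjoin k {x e k 0, x e k 1},
      x e k 1 ^ L * p - q ∈ minorIdeal (matA e k) := by
  have h0 : x e k 0 ∈ Algebra.adjoin k {x e k 0, x e k 1} := Algebra.subset_adjoin (by simp)
  have h1 : x e k 1 ∈ Algebra.adjoin k {x e k 0, x e k 1} := Algebra.subset_adjoin (by simp)
  induction p using MvPolynomial.induction_on with
  | C a => exact ⟨0, MvPolynomial.C a, Subalgebra.algebraMap_mem _ a, by simp⟩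
  | add p p' hp hp' =>
    obtain ⟨L, q, hq, h⟩ := hp
    obtain ⟨L', q', hq', h'⟩ := hp'
    refine ⟨L + L', x e k 1 ^ L' * q + x e k 1 ^ L * q',
      add_mem (mul_mem (pow_mem h1 _) hq) (mul_mem (pow_mem h1 _) hq'), ?_⟩
    convert add_mem (Ideal.mul_mem_left _ (x e k 1 ^ L') h)
      (Ideal.mul_mem_left _ (x e k 1 ^ L) h') using 1
    ring
  | mul_X p i hp =>
    obtain ⟨L, q, hq, h⟩ := hp
    rw [X_eq_x]
    have h2 := i.2
    have h3 := i.1.2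
    by_cases hi : (i.1 : ℕ) < 2
    · refine ⟨L, q * x e k i.1, mul_mem hq ?_, ?_⟩
      · obtain h | h : (i.1 : ℕ) = 0 ∨ (i.1 : ℕ) = 1 := by omega
        · rwa [h]
        · rwa [h]
      · convert Ideal.mul_mem_right (x e k i.1) _ h using 1
        ring
    · have h4 := mk_x_one_pow_mul (k := k) he (i := i.1) (m := e - i.1) (by omega) (by omega)
      rw [show (i.1 : ℕ) + (e - i.1) = e by omega, x_mult he, Ideal.Quotient.eq] at h4
      refine ⟨L + (e - i.1), q * (x e k 0 ^ (e - i.1) * (x e k 0 * x e k 0)),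
        mul_mem hq (mul_mem (pow_mem h0 _) (mul_mem h0 h0)), ?_⟩
      convert add_mem (Ideal.mul_mem_right (x e k 1 ^ (e - i.1) * x e k i.1) _ h)
        (Ideal.mul_mem_left _ q h4) using 1
      ring

lemma surfaceParam_of_mem_adjoin (he : 6 ≤ e) {q : PolyRing e k}
    (hq : q ∈ Algebra.adjoin k {x e k 0, x e k 1}) :
    surfaceParam e k q = toFrac e k q := by
  induction hq using Algebra.adjoin_induction with
  | mem q hq =>
    obtain rfl | rfl := hq
    · exact surfaceParam_x_of_lt_two he (by omega)
    · exact surfaceParam_x_of_lt_two he (by omega)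
  | algebraMap r => rw [AlgHom.commutes, ← IsScalarTower.algebraMap_apply]
  | add q r _ _ hq hr => rw [map_add, map_add, hq, hr]
  | mul q r _ _ hq hr => rw [map_mul, map_mul, hq, hr]

/-- The ideal of minors is prime, being the kernel of `surfaceParam`. -/
theorem minorIdeal_eq_ker_surfaceParam (he : 6 ≤ e) :
    minorIdeal (matA e k) = RingHom.ker (surfaceParam e k) := by
  refine le_antisymm (minorIdeal_le_ker_surfaceParam he) fun p hp => ?_
  obtain ⟨L, q, hq, h⟩ := exists_x_one_pow_mul_sub_mem he p
  have h1 := minorIdeal_le_ker_surfaceParam he h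
  rw [RingHom.mem_ker, map_sub, map_mul, RingHom.mem_ker.1 hp, mul_zero, zero_sub, neg_eq_zero,
    surfaceParam_of_mem_adjoin he hq] at h1
  rw [FaithfulSMul.algebraMap_eq_zero_iff] at h1
  rw [h1, sub_zero] at h
  exact x_one_pow_mul_mem he L h

/-- `X_1^3 - X_4 X_(e-1)` is a nonzerodivisor modulo the minors. -/
lemma mem_minorIdeal_of_mul_gen_mem (he : 6 ≤ e) {r : PolyRing e k}
    (h : r * (x e k 1 * x e k (e + 2) - x e k 4 * x e k (e - 1)) ∈ minorIdeal (matA e k)) :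
    r ∈ minorIdeal (matA e k) := by
  rw [minorIdeal_eq_ker_surfaceParam he, RingHom.mem_ker] at h ⊢
  rw [map_mul, mul_eq_zero] at h
  refine h.resolve_right fun h1 => ?_
  rw [← RingHom.mem_ker, ← minorIdeal_eq_ker_surfaceParam he] at h1
  -- after multiplication by a power of `X_1` the element becomes `X_1^e - X_0^(e+1)`
  have h2 : x e k 1 ^ e - x e k 0 ^ (e + 1) ∈ minorIdeal (matA e k) := by
    have h3 := mk_x_one_pow_mul (k := k) he (i := 4) (m := e - 4) le_rfl (by omega)
    have h4 := mk_x_one_pow_mul (k := k) he (i := e - 1) (m := 1) (by omega) (by omega)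
    rw [show 4 + (e - 4) = e by omega, x_mult he, Ideal.Quotient.eq] at h3
    rw [show e - 1 + 1 = e by omega, x_mult he, Ideal.Quotient.eq] at h4
    have h5 := Ideal.mul_mem_left _ (x e k 1 ^ (e - 3)) h1
    rw [x_mult_add_two he] at h5
    convert add_mem h5 (add_mem (Ideal.mul_mem_right (x e k 1 ^ 1 * x e k (e - 1)) _ h3)
      (Ideal.mul_mem_left _ (x e k 0 ^ (e - 4) * (x e k 0 * x e k 0)) h4)) using 1
    obtain ⟨n, rfl⟩ : ∃ n, e = n + 4 := ⟨e - 4, by omega⟩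
    rw [show n + 4 - 3 = n + 1 by omega, show n + 4 - 4 = n by omega]
    ring
  rw [minorIdeal_eq_ker_surfaceParam he, RingHom.mem_ker, surfaceParam_of_mem_adjoin he,
    FaithfulSMul.algebraMap_eq_zero_iff] at h2
  · -- but this polynomial has the value `1` at `X_0 = 0`, `X_1 = 1`
    have h3 := congrArg
      (MvPolynomial.eval fun i : VarIdx e => if (i.1 : ℕ) = 0 then (0 : k) else 1) h2
    rw [x_of_lt (show 1 < e by omega) (by omega), x_of_lt (show 0 < e by omega) (by omega)] at h3
    simp at h3
  · exact sub_mem (pow_mem (Algebra.subset_adjoin (by simp)) _)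
      (pow_mem (Algebra.subset_adjoin (by simp)) _)

end Sally

/-! ### Generators of the defining ideal -/

namespace Sally

variable {e : ℕ} {k : Type u} [Field k]

variable (e k) in
/-- The map `X_i ↦ t^(e+i)` into the monoid algebra of `ℕ`. -/
noncomputable def natParam : PolyRing e k →ₐ[k] AddMonoidAlgebra k ℕ :=
  (AddMonoidAlgebra.mapDomainAlgHom k k (semigroup e).subtype).comp (param e k)

lemma ker_natParam : RingHom.ker (natParam e k) = definingIdeal e k := by
  ext p
  rw [definingIdeal, RingHom.mem_ker, RingHom.mem_ker, natParam, AlgHom.comp_apply]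
  refine ⟨fun h => ?_, fun h => by rw [h, map_zero]⟩
  exact AddMonoidAlgebra.mapDomain_injective (R := k) (f := (semigroup e).subtype)
    Subtype.val_injective (h.trans (AddMonoidAlgebra.mapDomain_zero _).symm)

lemma natParam_x (he : 6 ≤ e) {i : ℕ} (h : i ≤ e + 2) (h' : i ≠ 2 ∧ i ≠ 3) :
    natParam e k (x e k i) = AddMonoidAlgebra.single (e + i) 1 := by
  have key : ∀ {i : ℕ}, i < e → i ≠ 2 ∧ i ≠ 3 →
      natParam e k (x e k i) = AddMonoidAlgebra.single (e + i) 1 := by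
    intro i h h'
    rw [x_of_lt h h', natParam, AlgHom.comp_apply, param, MvPolynomial.aeval_X]
    simp
  by_cases hi : i < e
  · exact key hi h'
  · obtain rfl | rfl | rfl : i = e ∨ i = e + 1 ∨ i = e + 2 := by omega
    · rw [x_mult he, map_mul, key (by omega) (by omega), AddMonoidAlgebra.single_mul_single,
        one_mul]
      congr 1
    · rw [x_mult_add_one he, map_mul, key (by omega) (by omega), key (by omega) (by omega),
        AddMonoidAlgebra.single_mul_single, one_mul]
      congr 1
    · rw [x_mult_add_two he, map_mul, key (by omega) (by omega),
        AddMonoidAlgebra.single_mul_single, one_mul]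
      congr 1; omega

variable (e k) in
/-- The generators `X_1 X_(j+7) - X_4 X_(j+4)` of the defining ideal modulo the minors. -/
noncomputable def psiGen (j : ℕ) : PolyRing e k :=
  x e k 1 * x e k (j + 7) - x e k 4 * x e k (j + 4)

variable (e k) in
/-- The ideal generated by the minors and the values of `ψ`. -/
noncomputable def coneIdeal : Ideal (PolyRing e k) :=
  minorIdeal (matA e k) ⊔ Ideal.span (psiGen e k '' {j | j ≤ e - 5})

lemma minorIdeal_le_coneIdeal : minorIdeal (matA e k) ≤ coneIdeal e k := le_sup_left

lemma psiGen_mem_coneIdeal {j : ℕ} (hj : j ≤ e - 5) : psiGen e k j ∈ coneIdeal e k :=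
  Ideal.mem_sup_right (Ideal.subset_span ⟨j, hj, rfl⟩)

lemma coneIdeal_le (he : 6 ≤ e) : coneIdeal e k ≤ definingIdeal e k := by
  rw [← ker_natParam, coneIdeal, sup_le_iff, minorIdeal, Ideal.span_le, Ideal.span_le]
  constructor
  · rintro _ ⟨p, rfl⟩
    have h1 := p.1.2
    have h2 := p.2.2
    have h3 := p.1.1.2
    have h4 := p.2.1.2
    simp only [matA, Matrix.of_apply, Fin.val_zero, Fin.val_one, add_zero]
    rw [SetLike.mem_coe, RingHom.mem_ker, map_sub, map_mul, map_mul,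
      natParam_x he (by omega) (by omega), natParam_x he (by omega) (by omega),
      natParam_x he (by omega) (by omega), natParam_x he (by omega) (by omega),
      AddMonoidAlgebra.single_mul_single, AddMonoidAlgebra.single_mul_single, sub_eq_zero]
    congr 1; omega
  · rintro _ ⟨j, hj, rfl⟩
    simp only [Set.mem_ofPred_eq] at hj
    rw [SetLike.mem_coe, RingHom.mem_ker, psiGen, map_sub, map_mul, map_mul,
      natParam_x he (by omega) (by omega), natParam_x he (by omega) (by omega),
      natParam_x he (by omega) (by omega), natParam_x he (by omega) (by omega),
      AddMonoidAlgebra.single_mul_single, AddMonoidAlgebra.single_mul_single, sub_eq_zero]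
    congr 1; omega

/-- Modulo the minors, `X_i X_j` with `i, j ≥ 4` depends only on `i + j`. -/
lemma x_mul_x_sub_mem (he : 6 ≤ e) {i j : ℕ} (d : ℕ) (hi : 4 ≤ i) (hj : 4 ≤ j) (hie : i + d ≤ e + 2)
    (hje : j + d ≤ e + 2) :
    x e k (i + d) * x e k j - x e k i * x e k (j + d) ∈ minorIdeal (matA e k) := by
  induction d generalizing j with
  | zero => simp
  | succ d ih =>
    have h1 := ih (j := j + 1) (by omega) (by omega) (by omega)
    have h2 := x_minor_mem (k := k) he (i := j) (j := i + d) (by omega) (by omega)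
    rw [show j + (d + 1) = j + 1 + d by omega]
    convert add_mem h1 h2 using 1
    rw [← add_assoc]
    ring

variable (e k) in
/-- Monomial representatives of the elements of the semigroup: the powers of `X_0` times
`1, X_1, X_1^2, X_1^3, X_4, …, X_(e-1)`, which represent the Apéry set of the multiplicity. -/
noncomputable def normalMonomial (p : ℕ × Fin e) : PolyRing e k :=
  x e k 0 ^ p.1 * if (p.2 : ℕ) < 4 then x e k 1 ^ (p.2 : ℕ) else x e k p.2

variable (e) in
/-- The degree of `normalMonomial`. -/
def normalDegree (p : ℕ × Fin e) : ℕ :=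
  e * p.1 + if (p.2 : ℕ) < 4 then (e + 1) * p.2 else e + p.2

lemma natParam_normalMonomial (he : 6 ≤ e) (p : ℕ × Fin e) :
    natParam e k (normalMonomial e k p) = AddMonoidAlgebra.single (normalDegree e p) 1 := by
  rw [normalMonomial, normalDegree, map_mul, map_pow, natParam_x he (by omega) (by omega),
    AddMonoidAlgebra.single_pow]
  split_ifs with h
  · rw [map_pow, natParam_x he (by omega) (by omega), AddMonoidAlgebra.single_pow,
      AddMonoidAlgebra.single_mul_single]
    simp [mul_comm]
  · rw [natParam_x he (by omega) (by omega), AddMonoidAlgebra.single_mul_single]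
    simp [mul_comm]

/-- The elements of a numerical semigroup are determined by their residue modulo `e` and the
multiple of `e` that is added to the corresponding element of the Apéry set. -/
lemma normalDegree_injective (he : 6 ≤ e) : Function.Injective (normalDegree e) := by
  have hmod : ∀ p : ℕ × Fin e, normalDegree e p % e = p.2 := by
    intro p
    have h1 : ∃ c, normalDegree e p = p.2 + e * c := by
      rw [normalDegree]
      split_ifs
      · exact ⟨p.1 + p.2, by ring⟩
      · exact ⟨p.1 + 1, by ring⟩
    obtain ⟨c, hc⟩ := h1
    rw [hc, Nat.add_mul_mod_self_left, Nat.mod_eq_of_lt p.2.2]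
  rintro ⟨a, r⟩ ⟨b, s⟩ h
  have h1 : r = s := Fin.ext (by rw [← hmod (a, r), ← hmod (b, s), h])
  subst h1
  simp only [normalDegree, Nat.add_right_cancel_iff] at h
  rw [Nat.eq_of_mul_eq_mul_left (by omega) h]

variable (e k) in
/-- The polynomials congruent to a combination of normal monomials modulo `coneIdeal`. -/
noncomputable def normalSpan : Submodule k (PolyRing e k) :=
  Submodule.span k (Set.range (normalMonomial e k)) ⊔ (coneIdeal e k).restrictScalars k

lemma mem_normalSpan_of_sub_mem {p q : PolyRing e k} (h : p - q ∈ coneIdeal e k)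
    (hq : q ∈ normalSpan e k) : p ∈ normalSpan e k := by
  rw [← sub_add_cancel p q]
  exact add_mem (Submodule.mem_sup_right h) hq

lemma normalMonomial_mem (a r : ℕ) (hr : r < e) :
    (x e k 0 ^ a * if r < 4 then x e k 1 ^ r else x e k r) ∈ normalSpan e k :=
  Submodule.mem_sup_left (Submodule.subset_span ⟨(a, ⟨r, hr⟩), rfl⟩)

lemma mul_mem_normalSpan {y : PolyRing e k}
    (h : ∀ p, y * normalMonomial e k p ∈ normalSpan e k) {q : PolyRing e k}
    (hq : q ∈ normalSpan e k) : y * q ∈ normalSpan e k := by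
  have h1 : normalSpan e k ≤ (normalSpan e k).comap (LinearMap.mulLeft k y) := by
    conv_lhs => rw [normalSpan]
    refine sup_le (Submodule.span_le.2 ?_) fun r hr => ?_
    · rintro _ ⟨p, rfl⟩
      exact h p
    · exact Submodule.mem_sup_right (Ideal.mul_mem_left _ y hr)
  exact h1 hq

lemma x_zero_mul_mem {q : PolyRing e k} (hq : q ∈ normalSpan e k) :
    x e k 0 * q ∈ normalSpan e k := by
  refine mul_mem_normalSpan (fun p => ?_) hq
  rw [normalMonomial, ← mul_assoc, ← pow_succ']
  exact normalMonomial_mem _ _ p.2.2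

lemma x_zero_pow_mul_mem (a : ℕ) {q : PolyRing e k} (hq : q ∈ normalSpan e k) :
    x e k 0 ^ a * q ∈ normalSpan e k := by
  induction a with
  | zero => simpa using hq
  | succ a ih => rw [pow_succ', mul_assoc]; exact x_zero_mul_mem ih

lemma x_one_pow_mem (he : 6 ≤ e) {r : ℕ} (hr : r < 4) : x e k 1 ^ r ∈ normalSpan e k := by
  simpa [hr] using normalMonomial_mem (k := k) 0 r (show r < e by omega)

lemma x_mem_normalSpan (he : 6 ≤ e) {i : ℕ} (hi : 4 ≤ i) (hie : i ≤ e + 2) :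
    x e k i ∈ normalSpan e k := by
  by_cases h : i < e
  · simpa [show ¬ i < 4 by omega] using normalMonomial_mem (k := k) 0 i h
  · obtain rfl | rfl | rfl : i = e ∨ i = e + 1 ∨ i = e + 2 := by omega
    · rw [x_mult he, ← pow_two]
      simpa using x_zero_pow_mul_mem 2 (x_one_pow_mem (k := k) he (r := 0) (by omega))
    · rw [x_mult_add_one he]
      simpa using x_zero_mul_mem (x_one_pow_mem (k := k) he (r := 1) (by omega))
    · rw [x_mult_add_two he, ← pow_two]
      exact x_one_pow_mem he (by omega)

lemma x_one_mul_x_sub_mem (he : 6 ≤ e) {i : ℕ} (hi : 4 ≤ i) (hie : i ≤ e + 1) :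
    x e k 1 * x e k i - x e k 0 * x e k (i + 1) ∈ coneIdeal e k := by
  have h := x_minor_mem (k := k) he (i := i) (j := 0) (by omega) (by omega)
  rw [zero_add] at h
  convert minorIdeal_le_coneIdeal h using 1
  ring

lemma x_one_mul_x_mem (he : 6 ≤ e) {i : ℕ} (hi : 4 ≤ i) (hie : i ≤ e + 2) :
    x e k 1 * x e k i ∈ normalSpan e k := by
  rcases hie.lt_or_eq with h | rfl
  · exact mem_normalSpan_of_sub_mem (x_one_mul_x_sub_mem he hi (by omega))
      (x_zero_mul_mem (x_mem_normalSpan he (by omega) (by omega)))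
  · rw [x_mult_add_two he, ← pow_two, ← pow_succ']
    exact x_one_pow_mem he (by omega)

lemma x_one_pow_mul_x_mem (he : 6 ≤ e) (r : ℕ) {i : ℕ} (hi : 4 ≤ i) (hie : i + r ≤ e + 2) :
    x e k 1 ^ r * x e k i ∈ normalSpan e k := by
  induction r generalizing i with
  | zero => simpa using x_mem_normalSpan he hi hie
  | succ r ih =>
    refine mem_normalSpan_of_sub_mem ?_ (x_zero_mul_mem (ih (i := i + 1) (by omega) (by omega)))
    convert Ideal.mul_mem_left _ (x e k 1 ^ r) (x_one_mul_x_sub_mem (k := k) he hi (by omega))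
      using 1
    ring

/-- For `i + j ≥ e + 4` the product is `X_0^2 X_(i+j-e)` modulo the minors; otherwise it is
`X_4 X_(i+j-4)` modulo the minors, which a value of `ψ` replaces by `X_1 X_(i+j-1)`. -/
lemma x_mul_x_mem (he : 6 ≤ e) {i j : ℕ} (hi : 4 ≤ i) (hie : i < e) (hj : 4 ≤ j) (hje : j < e) :
    x e k i * x e k j ∈ normalSpan e k := by
  rcases le_or_gt (e + 4) (i + j) with h | h
  · have h1 := x_mul_x_sub_mem (k := k) he (i := i) (j := i + j - e) (e - i) hi (by omega)
      (by omega) (by omega)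
    rw [show i + (e - i) = e by omega, show i + j - e + (e - i) = j by omega, x_mult he] at h1
    refine mem_normalSpan_of_sub_mem (q := x e k 0 * x e k 0 * x e k (i + j - e)) ?_ ?_
    · rw [← neg_mem_iff, neg_sub]
      exact minorIdeal_le_coneIdeal h1
    · rw [mul_assoc]
      exact x_zero_mul_mem (x_zero_mul_mem (x_mem_normalSpan he (by omega) (by omega)))
  · have h1 := x_mul_x_sub_mem (k := k) he (i := 4) (j := j) (i - 4) le_rfl hj
      (by omega) (by omega)
    rw [show 4 + (i - 4) = i by omega] at h1
    have h2 : psiGen e k (i + j - 8) ∈ coneIdeal e k :=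
      Ideal.mem_sup_right (Ideal.subset_span ⟨_, by simp only [Set.mem_ofPred_eq]; omega, rfl⟩)
    rw [psiGen, show i + j - 8 + 4 = j + (i - 4) by omega,
      show i + j - 8 + 7 = i + j - 1 by omega] at h2
    refine mem_normalSpan_of_sub_mem (q := x e k 1 * x e k (i + j - 1)) ?_
      (x_one_mul_x_mem he (by omega) (by omega))
    convert sub_mem (minorIdeal_le_coneIdeal h1) h2 using 1
    ring

/-- `X_1^4` is congruent to `X_0^3 X_4`, because `X_1^3 - X_4 X_(e-1)` is a value of `ψ` and
`X_1 X_(e-1) - X_0 X_e` is a minor. -/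
lemma x_one_pow_four_mem (he : 6 ≤ e) : x e k 1 ^ 4 ∈ normalSpan e k := by
  have h1 : psiGen e k (e - 5) ∈ coneIdeal e k :=
    psiGen_mem_coneIdeal (by omega)
  rw [psiGen, show e - 5 + 7 = e + 2 by omega, show e - 5 + 4 = e - 1 by omega,
    x_mult_add_two he] at h1
  have h2 := x_one_mul_x_sub_mem (k := k) he (i := e - 1) (by omega) (by omega)
  rw [show e - 1 + 1 = e by omega, x_mult he] at h2
  refine mem_normalSpan_of_sub_mem ?_
    (x_zero_pow_mul_mem 3 (x_mem_normalSpan (k := k) he (i := 4) le_rfl (by omega)))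
  convert add_mem (Ideal.mul_mem_left _ (x e k 1) h1) (Ideal.mul_mem_left _ (x e k 4) h2) using 1
  ring

lemma normalSpan_eq_top (he : 6 ≤ e) : normalSpan e k = ⊤ := by
  rw [eq_top_iff]
  rintro p -
  induction p using MvPolynomial.induction_on with
  | C a =>
    rw [← mul_one (MvPolynomial.C a), ← MvPolynomial.smul_eq_C_mul]
    exact Submodule.smul_mem _ _ (by simpa using x_one_pow_mem (k := k) he (r := 0) (by omega))
  | add p q hp hq => exact add_mem hp hq
  | mul_X p i hp =>
    rw [mul_comm, X_eq_x]
    refine mul_mem_normalSpan (fun q => ?_) hp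
    have h2 := i.2
    have h3 := i.1.2
    have h4 := q.2.2
    rw [normalMonomial, mul_left_comm]
    refine x_zero_pow_mul_mem _ ?_
    obtain h | h | h : (i.1 : ℕ) = 0 ∨ (i.1 : ℕ) = 1 ∨ 4 ≤ (i.1 : ℕ) := by omega
    · rw [h]
      refine x_zero_mul_mem ?_
      simpa using normalMonomial_mem (k := k) 0 q.2 h4
    · rw [h]
      split_ifs with hr
      · rw [← pow_succ']
        obtain h5 | h5 : (q.2 : ℕ) + 1 < 4 ∨ (q.2 : ℕ) + 1 = 4 := by omega
        · exact x_one_pow_mem he h5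
        · rw [h5]
          exact x_one_pow_four_mem he
      · exact x_one_mul_x_mem he (by omega) (by omega)
    · split_ifs with hr
      · rw [mul_comm]
        exact x_one_pow_mul_x_mem he _ h (by omega)
      · exact x_mul_x_mem he h h3 (by omega) h4

/-- The defining ideal is generated by the minors and the values of `ψ`: every polynomial is
congruent to a combination of normal monomials, and these have distinct degrees. -/
theorem definingIdeal_eq_coneIdeal (he : 6 ≤ e) : definingIdeal e k = coneIdeal e k := by
  refine le_antisymm (fun p hp => ?_) (coneIdeal_le he)
  have h1 : p ∈ normalSpan e k := normalSpan_eq_top (k := k) he ▸ Submodule.mem_top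
  obtain ⟨w, hw, q, hq, rfl⟩ := Submodule.mem_sup.1 h1
  have h2 : natParam e k w = 0 := by
    have h3 := coneIdeal_le he hq
    rw [← ker_natParam, RingHom.mem_ker] at hp h3
    rwa [map_add, h3, add_zero] at hp
  have hli : LinearIndependent k fun p : ℕ × Fin e => natParam e k (normalMonomial e k p) := by
    have h3 : (fun p : ℕ × Fin e => natParam e k (normalMonomial e k p)) =
        fun p => (AddMonoidAlgebra.single (normalDegree e p) 1 : AddMonoidAlgebra k ℕ) :=
      funext fun p => natParam_normalMonomial he p
    rw [h3]
    refine LinearIndependent.of_comp (AddMonoidAlgebra.coeffLinearEquiv k).toLinearMap ?_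
    exact (Finsupp.linearIndependent_single_one k ℕ).comp _ (normalDegree_injective he)
  obtain ⟨c, rfl⟩ := (Finsupp.mem_span_range_iff_exists_finsupp).1 hw
  have h4 : c = 0 := by
    refine linearIndependent_iff.1 hli c ?_
    rw [Finsupp.linearCombination_apply, ← h2, map_finsuppSum]
    simp
  rw [h4]
  simpa using hq

end Sally

/-! ### The map induced by `ψ` on the canonical module -/

lemma enContract_sum_mul {R : Type u} [CommRing R] {ι : Type} (A : Matrix (Fin 2) ι R) (f : ℕ → R)
    {a n : ℕ} (ha : a + 1 < n) (k : ι) :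
    ∑ j : Fin n, f j * enContract A a j k = A 0 k * f (a + 1) + A 1 k * f a := by
  rw [Fin.sum_univ_eq_sum_range (fun j => f j * enContract A a j k) n]
  simp only [enContract, mul_add, Finset.sum_add_distrib, mul_ite, mul_zero, Finset.sum_ite_eq',
    Finset.mem_range]
  rw [if_pos ha, if_pos (by omega)]
  ring

lemma ENGen.exists_of_dualDeg_eq_zero {ι : Type} [Fintype ι] (hι : 2 ≤ Fintype.card ι)
    {y : ENGen ι} (hy : y.dualDeg = 0) :
    ∃ j : Fin ((Finset.univ : Finset ι).card - 1), y = some ⟨Finset.univ, j⟩ := by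
  rcases y with _ | ⟨T, j⟩
  · simp only [ENGen.dualDeg, ENGen.hdeg] at hy
    omega
  · have hT : T = Finset.univ := by
      rw [← Finset.card_eq_iff_eq_univ]
      have h1 := T.card_le_univ
      simp only [ENGen.dualDeg, ENGen.hdeg] at hy
      omega
    subst hT
    exact ⟨j, rfl⟩

section TopDegree

variable {R : Type u} [CommRing R] {ι : Type} [LinearOrder ι] [Fintype ι]

/-- The functional with values `f j` on the basis elements `g₁^j g₂^(p-2-j)`, `p` the number of
columns, of the degree zero part of the dual of the Eagon–Northcott complex. -/
noncomputable def enFunctional (f : ℕ → R) : (ENGen ι → R) →ₗ[R] R where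
  toFun a := ∑ j : Fin ((Finset.univ : Finset ι).card - 1), f j * a (some ⟨Finset.univ, j⟩)
  map_add' a b := by simp [mul_add, Finset.sum_add_distrib]
  map_smul' r a := by simp [Finset.mul_sum, mul_left_comm]

omit [LinearOrder ι] in
lemma enFunctional_apply (f : ℕ → R) (a : ENGen ι → R) : enFunctional f a =
    ∑ j : Fin ((Finset.univ : Finset ι).card - 1), f j * a (some ⟨Finset.univ, j⟩) := rfl

/-- A functional with `x_l f (a + 1) + y_l f a ∈ I` for all columns `(x_l, y_l)` sends boundaries
into `I`. -/
lemma enFunctional_transpose_mem (A : Matrix (Fin 2) ι R) (hι : 3 ≤ Fintype.card ι) (f : ℕ → R)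
    (I : Ideal R) (hf : ∀ l a, a + 2 < Fintype.card ι → A 0 l * f (a + 1) + A 1 l * f a ∈ I)
    (w : ENGen ι → R) : enFunctional f ((enMatrix A).transpose.smulVecLin R w) ∈ I := by
  rw [enFunctional_apply]
  simp only [Matrix.smulVecLin_apply, Finset.mul_sum, Matrix.transpose_apply, Matrix.of_apply,
    smul_eq_mul]
  rw [Finset.sum_comm]
  refine Ideal.sum_mem _ fun y _ => ?_
  simp only [← mul_assoc]
  rw [← Finset.sum_mul]
  refine Ideal.mul_mem_right _ _ ?_
  rcases y with _ | ⟨U, a⟩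
  · have h : (Finset.univ : Finset ι).card ≠ 2 := by rw [Finset.card_univ]; omega
    simp only [enEntry, if_neg h, mul_zero, Finset.sum_const_zero]
    exact zero_mem _
  · simp only [enEntry, Finset.mul_sum]
    rw [Finset.sum_comm]
    refine Ideal.sum_mem _ fun l _ => ?_
    by_cases hU : U = Finset.univ.erase l
    · have h1 : U.card = Fintype.card ι - 1 := by
        rw [hU, Finset.card_erase_of_mem (Finset.mem_univ _), Finset.card_univ]
      have h2 := a.2
      simp only [if_pos hU]
      rw [Finset.sum_congr rfl fun j _ => mul_left_comm _ _ _, ← Finset.mul_sum,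
        enContract_sum_mul A f (by rw [Finset.card_univ]; omega)]
      exact Ideal.mul_mem_left _ _ (hf l a (by omega))
    · simp only [if_neg hU, mul_zero, Finset.sum_const_zero]
      exact zero_mem _

variable (R ι) in
/-- The basis element `g₁^j g₂^(p-2-j)` of the degree zero part of the dual complex. -/
noncomputable def topGen (j : Fin ((Finset.univ : Finset ι).card - 1)) : ENGen ι → R :=
  Pi.single (some ⟨Finset.univ, j⟩) 1

lemma topGen_apply (j i : Fin ((Finset.univ : Finset ι).card - 1)) :
    topGen R ι j (some ⟨Finset.univ, i⟩) = if i = j then 1 else 0 := by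
  by_cases h : i = j
  · rw [h, topGen, Pi.single_eq_same, if_pos rfl]
  · rw [topGen, Pi.single_eq_of_ne, if_neg h]
    simpa only [ne_eq, Option.some.injEq, Sigma.mk.injEq, heq_eq_eq, true_and] using h

lemma topGen_apply_of_ne (j : Fin ((Finset.univ : Finset ι).card - 1))
    {T : Finset ι} (hT : T ≠ Finset.univ) (i : Fin (T.card - 1)) :
    topGen R ι j (some ⟨T, i⟩) = 0 := by
  rw [topGen, Pi.single_eq_of_ne]
  intro h
  simp only [Option.some.injEq, Sigma.mk.injEq] at h
  exact hT h.1

lemma topGen_none (j : Fin ((Finset.univ : Finset ι).card - 1)) :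
    topGen R ι j none = 0 := by
  rw [topGen, Pi.single_eq_of_ne (by simp)]

lemma enFunctional_topGen (f : ℕ → R) (j : Fin ((Finset.univ : Finset ι).card - 1)) :
    enFunctional f (topGen R ι j) = f j := by
  simp only [enFunctional_apply, topGen_apply, mul_ite, mul_one, mul_zero, Finset.sum_ite_eq',
    Finset.mem_univ, if_true]

/-- The relation between consecutive generators of the canonical module given by a column. -/
lemma topGen_relation (A : Matrix (Fin 2) ι R) (l : ι) {j : ℕ}
    (hj : j + 1 < (Finset.univ : Finset ι).card - 1) :
    A 1 l • topGen R ι ⟨j, by omega⟩ + A 0 l • topGen R ι ⟨j + 1, hj⟩ ∈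
      LinearMap.range ((enMatrix A).transpose.smulVecLin R) := by
  have hU : ((Finset.univ : Finset ι).erase l).card = (Finset.univ : Finset ι).card - 1 :=
    Finset.card_erase_of_mem (Finset.mem_univ _)
  refine ⟨Pi.single (some ⟨Finset.univ.erase l, ⟨j, by omega⟩⟩) (enSign _ Finset.univ l), ?_⟩
  funext y
  rw [Matrix.smulVecLin_apply, Finset.sum_eq_single (some ⟨Finset.univ.erase l, ⟨j, by omega⟩⟩)]
  · rw [Pi.single_eq_same]
    simp only [Matrix.transpose_apply, Matrix.of_apply, smul_eq_mul, Pi.add_apply, Pi.smul_apply]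
    rcases y with _ | ⟨T, c⟩
    · simp only [enEntry, topGen_none, zero_mul, mul_zero, add_zero]
    · by_cases hT : T = Finset.univ
      · subst hT
        simp only [enEntry, topGen_apply]
        rw [Finset.sum_eq_single l]
        · rw [if_pos rfl, enContract]
          simp only [Fin.ext_iff]
          have := enSign_mul_self (R := R) Finset.univ l
          split_ifs
          · omega
          · linear_combination A 0 l * this
          · linear_combination A 1 l * this
          · ring
        · intro m _ hm
          refine if_neg fun h => hm ?_
          by_contra h'
          have h1 : m ∈ Finset.univ.erase l := Finset.mem_erase.2 ⟨h', Finset.mem_univ _⟩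
          rw [h] at h1
          exact Finset.notMem_erase m _ h1
        · exact fun h => absurd (Finset.mem_univ _) h
      · rw [topGen_apply_of_ne _ hT, topGen_apply_of_ne _ hT]
        simp only [enEntry, mul_zero, add_zero]
        rw [Finset.sum_eq_zero, zero_mul]
        intro m hm
        refine if_neg fun h => hT ?_
        rw [← Finset.card_eq_iff_eq_univ]
        have h1 := Finset.card_erase_add_one hm
        rw [← h, hU] at h1
        rw [← h1, ← Finset.card_univ]
        omega
  · intro z _ hz
    rw [Pi.single_eq_of_ne hz, smul_zero]
  · exact fun h => absurd (Finset.mem_univ _) h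

lemma eq_sum_smul_topGen (hι : 2 ≤ Fintype.card ι) {a : ENGen ι → R}
    (ha : ∀ y, y.dualDeg ≠ 0 → a y = 0) :
    a = ∑ j, a (some ⟨Finset.univ, j⟩) • topGen R ι j := by
  funext y
  rw [Finset.sum_apply]
  simp only [Pi.smul_apply, smul_eq_mul]
  by_cases hy : y.dualDeg = 0
  · obtain ⟨i, rfl⟩ := y.exists_of_dualDeg_eq_zero hι hy
    simp only [topGen_apply, mul_ite, mul_one, mul_zero, Finset.sum_ite_eq, Finset.mem_univ,
      if_true]
  · rw [ha y hy, Finset.sum_eq_zero]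
    intro j _
    rw [topGen, Pi.single_eq_of_ne, mul_zero]
    rintro rfl
    refine hy ?_
    simp [ENGen.dualDeg, ENGen.hdeg]

/-- A power of the entry `A 1 l` carries the canonical module into the submodule generated by the
last generator. -/
lemma exists_smul_topGen_sub_mem (A : Matrix (Fin 2) ι R) (l : ι) {N : ℕ}
    (hN : N + 1 = (Finset.univ : Finset ι).card - 1) {a : ENGen ι → R}
    (ha : ∀ y, y.dualDeg ≠ 0 → a y = 0) :
    ∃ r : R, A 1 l ^ N • a - r • topGen R ι ⟨N, by omega⟩ ∈
      LinearMap.range ((enMatrix A).transpose.smulVecLin R) := by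
  have h1 : ∀ d j (hj : j + d = N), ∃ r : R,
      A 1 l ^ d • topGen R ι ⟨j, by omega⟩ - r • topGen R ι ⟨N, by omega⟩ ∈
      LinearMap.range ((enMatrix A).transpose.smulVecLin R) := by
    intro d
    induction d with
    | zero =>
      intro j hj
      obtain rfl : j = N := by omega
      exact ⟨1, by simp⟩
    | succ d ih =>
      intro j hj
      obtain ⟨r, hr⟩ := ih (j + 1) (by omega)
      have h2 := topGen_relation A l (j := j) (by omega)
      refine ⟨-A 0 l * r, ?_⟩
      convert sub_mem (Submodule.smul_mem _ (A 1 l ^ d) h2) (Submodule.smul_mem _ (A 0 l) hr)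
        using 1
      module
  have h2 : ∀ j : Fin ((Finset.univ : Finset ι).card - 1), ∃ r : R,
      A 1 l ^ N • topGen R ι j - r • topGen R ι ⟨N, by omega⟩ ∈
      LinearMap.range ((enMatrix A).transpose.smulVecLin R) := by
    intro j
    have hj := j.2
    obtain ⟨r, hr⟩ := h1 (N - j) j (by omega)
    refine ⟨A 1 l ^ (j : ℕ) * r, ?_⟩
    convert Submodule.smul_mem _ (A 1 l ^ (j : ℕ)) hr using 1
    rw [smul_sub, smul_smul, smul_smul, ← pow_add]
    congr 3; omega
  choose r hr using h2
  refine ⟨∑ j, a (some ⟨Finset.univ, j⟩) * r j, ?_⟩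
  have h3 := eq_sum_smul_topGen (by rw [Finset.card_univ] at hN; omega) ha
  have h4 : A 1 l ^ N • a - (∑ j, a (some ⟨Finset.univ, j⟩) * r j) • topGen R ι ⟨N, by omega⟩ =
      ∑ j, a (some ⟨Finset.univ, j⟩) •
        (A 1 l ^ N • topGen R ι j - r j • topGen R ι ⟨N, by omega⟩) := by
    simp only [smul_sub, Finset.sum_sub_distrib, smul_smul]
    rw [← Finset.sum_smul]
    congr 1
    simp only [mul_comm _ (A 1 l ^ N), ← smul_smul]
    rw [← Finset.smul_sum, ← h3]
  rw [h4]
  exact sum_mem fun j _ => Submodule.smul_mem _ _ (hr j)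

/-- The minors kill the canonical module. -/
lemma exists_transpose_eq_smul_topGen (A : Matrix (Fin 2) ι R) {r : R}
    (hr : r ∈ minorIdeal A) (j : Fin ((Finset.univ : Finset ι).card - 1)) :
    ∃ v, (enMatrix A).transpose.smulVecLin R v = r • topGen R ι j := by
  refine exists_smulVecLin_eq_smul (minorIdeal_le_nullHomotopyIdeal_transpose _ hr) ?_
  funext y
  rw [Matrix.smulVecLin_apply, Finset.sum_eq_zero]
  · rfl
  intro z _
  by_cases hz : z = some ⟨Finset.univ, j⟩
  · by_cases h3 : (enMatrix A).transpose y z = 0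
    · rw [h3, zero_smul]
    · have h4 := enMatrix_transpose_deg _ _ _ h3
      rw [hz] at h4
      simp only [ENGen.dualDeg, ENGen.hdeg, ← Finset.card_univ] at h4
      omega
  · rw [topGen, Pi.single_eq_of_ne hz, smul_zero]

end TopDegree

namespace Sally

variable {e : ℕ} {k : Type u} [Field k]

/-- The functionals `g₁^j g₂^(e-5-j) ↦ (-1)^j X_(j+c)` induce maps from the canonical module to the
quotient by the minors, because the ratio `-X_(j+c+1) / X_(j+c)` does not depend on `j`. -/
lemma shiftFunctional_transpose_mem (he : 6 ≤ e) {c : ℕ} (hc : 4 ≤ c) (hc' : c ≤ 7)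
    (w : ENGen (ColIdx e) → PolyRing e k) :
    enFunctional (fun j => (-1) ^ j * x e k (j + c))
      ((enMatrix (matA e k)).transpose.smulVecLin _ w) ∈ minorIdeal (matA e k) := by
  refine enFunctional_transpose_mem _ (by rw [card_colIdx he]; omega) _ _ (fun l a ha => ?_) w
  rw [card_colIdx he] at ha
  have h3 := l.2
  have h4 := l.1.2
  have h5 := x_minor_mem (k := k) he (i := l.1) (j := a + c) (by omega) (by omega)
  change x e k l.1 * _ + x e k (l.1 + 1) * _ ∈ _
  convert Ideal.mul_mem_left _ (-(-1) ^ a) h5 using 1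
  rw [show a + 1 + c = a + c + 1 by omega]
  ring

variable (e k) in
/-- The map `ψ` as a functional on the total module. -/
noncomputable def psiTotal : (ENGen (ColIdx e) → PolyRing e k) →ₗ[PolyRing e k] PolyRing e k :=
  enFunctional fun j => (-1) ^ j * psiGen e k j

lemma psiTotal_apply_eq (a : ENGen (ColIdx e) → PolyRing e k) : psiTotal e k a =
    x e k 1 * enFunctional (fun j => (-1) ^ j * x e k (j + 7)) a -
      x e k 4 * enFunctional (fun j => (-1) ^ j * x e k (j + 4)) a := by
  simp only [psiTotal, enFunctional_apply, Finset.mul_sum, ← Finset.sum_sub_distrib, psiGen]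
  exact Finset.sum_congr rfl fun j _ => by ring

lemma psiTotal_transpose_mem (he : 6 ≤ e) (w : ENGen (ColIdx e) → PolyRing e k) :
    psiTotal e k ((enMatrix (matA e k)).transpose.smulVecLin _ w) ∈ minorIdeal (matA e k) := by
  rw [psiTotal_apply_eq]
  exact sub_mem
    (Ideal.mul_mem_left _ _ (shiftFunctional_transpose_mem he (by omega) (by omega) w))
    (Ideal.mul_mem_left _ _ (shiftFunctional_transpose_mem he (by omega) (by omega) w))

/-- The map from the canonical module to the quotient by the minors induced by `ψ` is injective:
both modules are torsion-free of rank one. -/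
theorem exists_of_psiTotal_mem (he : 6 ≤ e) {a : ENGen (ColIdx e) → PolyRing e k}
    (ha : ∀ y, y.dualDeg ≠ 0 → a y = 0) (h : psiTotal e k a ∈ minorIdeal (matA e k)) :
    ∃ w, (enMatrix (matA e k)).transpose.smulVecLin _ w = a := by
  have hcard : (Finset.univ : Finset (ColIdx e)).card = e - 3 := card_colIdx he
  have hN : e - 5 + 1 = (Finset.univ : Finset (ColIdx e)).card - 1 := by omega
  -- modulo boundaries `X_1^(e-5) a = r g_1^(e-5)`
  obtain ⟨r, w, hw⟩ := exists_smul_topGen_sub_mem (matA e k) ⟨⟨0, by omega⟩, by simp⟩ hN ha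
  rw [show matA e k 1 ⟨⟨0, by omega⟩, by simp⟩ = x e k 1 from rfl] at hw
  -- so `r ψ(g_1^(e-5))` is in the ideal of minors, and `ψ(g_1^(e-5))` is not
  have h1 : r ∈ minorIdeal (matA e k) := by
    have h2 := psiTotal_transpose_mem he w
    rw [hw, map_sub, map_smul, map_smul, psiTotal, enFunctional_topGen, psiGen, smul_eq_mul,
      smul_eq_mul] at h2
    have h3 := (Submodule.sub_mem_iff_right _ (Ideal.mul_mem_left _ (x e k 1 ^ (e - 5)) h)).1 h2
    have h4 := Ideal.mul_mem_left _ ((-1) ^ (e - 5)) h3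
    refine mem_minorIdeal_of_mul_gen_mem he ?_
    convert h4 using 1
    simp only [show e - 5 + 7 = e + 2 by omega, show e - 5 + 4 = e - 1 by omega]
    have h5 : ((-1 : PolyRing e k) ^ (e - 5)) * (-1) ^ (e - 5) = 1 := by
      rw [← mul_pow]; simp
    linear_combination -(r * (x e k 1 * x e k (e + 2) - x e k 4 * x e k (e - 1))) * h5
  obtain ⟨v, hv⟩ := exists_transpose_eq_smul_topGen (matA e k) h1
    ⟨e - 5, by omega⟩
  obtain ⟨rs, h2, h3, -, h4⟩ := exists_isWeaklyRegular (k := k) he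
  -- `X_1` is a nonzerodivisor on the canonical module
  have h5 : ∀ L, (∃ w, (enMatrix (matA e k)).transpose.smulVecLin _ w = x e k 1 ^ L • a) →
      ∃ w, (enMatrix (matA e k)).transpose.smulVecLin _ w = a := by
    intro L
    induction L with
    | zero => simp
    | succ L ih =>
      rintro ⟨w, hw⟩
      refine ih (exists_transpose_boundary_of_smul_eq h2 (by rw [h3, card_colIdx he]; omega) h4
        (z := x e k 1 ^ L • a) (w := w) (fun y hy => ?_) ?_)
      · rw [Pi.smul_apply, ha y hy, smul_zero]
      · rw [hw, smul_smul, ← pow_succ']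
  exact h5 (e - 5) ⟨w + v, by rw [map_add, hw, hv, sub_add_cancel]⟩

end Sally

/-! ### The Eagon–Northcott complexes degree by degree -/

section Graded

variable {R : Type u} [CommRing R] {X : Type}

lemma extend_val_of_mem {P : X → Prop} (v : {x // P x} → R) {x : X} (hx : P x) :
    Function.extend Subtype.val v (0 : X → R) x = v ⟨x, hx⟩ :=
  Subtype.val_injective.extend_apply _ _ (⟨x, hx⟩ : {x // P x})

lemma extend_val_of_not {P : X → Prop} (v : {x // P x} → R) {x : X} (hx : ¬ P x) :
    Function.extend Subtype.val v (0 : X → R) x = 0 :=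
  Function.extend_apply' _ _ _ (by simpa using hx)

lemma Matrix.smulVecLin_extend [Fintype X] (D : Matrix X X R) {P Q : X → Prop} [Fintype {y // P y}]
    (h : ∀ x y, D x y ≠ 0 → P y → Q x) (v : {y // P y} → R) :
    D.smulVecLin R (Function.extend Subtype.val v 0) = Function.extend Subtype.val
      ((Matrix.of fun (x : {x // Q x}) (y : {y // P y}) => D x.1 y.1).mulVec v) 0 := by
  have key : ∀ x, D.smulVecLin R (Function.extend Subtype.val v 0) x =
      ∑ y : {y // P y}, D x y.1 * v y := by
    intro x
    rw [Matrix.smulVecLin_apply]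
    symm
    refine Fintype.sum_of_injective Subtype.val Subtype.val_injective _ _ (fun y hy => ?_)
      fun y => ?_
    · rw [Function.extend_apply' _ _ _ (by simpa using hy)]
      simp
    · rw [Subtype.val_injective.extend_apply, smul_eq_mul]
  ext x
  rw [key]
  by_cases hx : Q x
  · rw [extend_val_of_mem _ hx]
    rfl
  · rw [extend_val_of_not _ hx]
    refine Finset.sum_eq_zero fun y _ => ?_
    by_contra h'
    exact hx (h x y (left_ne_zero_of_mul h') y.2)

lemma extend_restrict {P : X → Prop} {w : X → R} (hw : ∀ x, ¬ P x → w x = 0) :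
    Function.extend Subtype.val (fun x : {x // P x} => w x) 0 = w := by
  ext x
  by_cases hx : P x
  · exact extend_val_of_mem _ hx
  · rw [extend_val_of_not _ hx, hw x hx]

lemma extend_val_injective {P : X → Prop} :
    Function.Injective fun v : {x // P x} → R => Function.extend Subtype.val v (0 : X → R) := by
  intro v w h
  ext x
  have := congrFun h x.1
  simpa only [Subtype.val_injective.extend_apply] using this

/-- Exactness of a graded matrix at a spot, in terms of its block matrices. -/
lemma exact_mulVecLin_of_forall [Fintype X] {D : Matrix X X R} (hD : D * D = 0) {P Q S : X → Prop}
    [Fintype {y // P y}] [Fintype {y // Q y}] (hPQ : ∀ x y, D x y ≠ 0 → P y → Q x)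
    (hQS : ∀ x y, D x y ≠ 0 → Q y → S x)
    (h : ∀ z : X → R, (∀ x, ¬ Q x → z x = 0) → D.smulVecLin R z = 0 →
      ∃ v : X → R, (∀ x, ¬ P x → v x = 0) ∧ D.smulVecLin R v = z) :
    Function.Exact
      (Matrix.mulVecLin (Matrix.of fun (x : {x // Q x}) (y : {y // P y}) => D x.1 y.1))
      (Matrix.mulVecLin (Matrix.of fun (x : {x // S x}) (y : {y // Q y}) => D x.1 y.1)) := by
  intro z
  simp only [Set.mem_range, Matrix.mulVecLin_apply]
  constructor
  · intro hz
    obtain ⟨v, hv, hvz⟩ := h (Function.extend Subtype.val z 0) (fun x => extend_val_of_not z) (by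
      rw [D.smulVecLin_extend hQS, hz]
      ext x
      by_cases hx : S x
      · exact extend_val_of_mem _ hx
      · exact extend_val_of_not _ hx)
    refine ⟨fun x => v x, extend_val_injective (R := R) ?_⟩
    simp only
    rw [← D.smulVecLin_extend hPQ, extend_restrict hv, hvz]
  · rintro ⟨v, rfl⟩
    refine extend_val_injective (R := R) ?_
    simp only
    rw [← D.smulVecLin_extend hQS, ← D.smulVecLin_extend hPQ, ← Matrix.smulVecLin_mul, hD]
    ext x
    rw [Matrix.smulVecLin_apply]
    simp only [Matrix.zero_apply, zero_smul, Finset.sum_const_zero]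
    by_cases hx : S x
    · exact (extend_val_of_mem (0 : {x // S x} → R) hx).symm
    · exact (extend_val_of_not (0 : {x // S x} → R) hx).symm

end Graded

section Complexes

open RingTheory.Sequence

variable {R : Type u} [CommRing R] {ι : Type} [LinearOrder ι] [Fintype ι]
  {A : Matrix (Fin 2) ι R} {rs : List R}

omit [LinearOrder ι] in
lemma ENGen.hdeg_add_eq_iff (x : ENGen ι) {i : ℕ} (hi : i ≤ Fintype.card ι - 1) :
    x.hdeg + i = Fintype.card ι - 1 ↔ x.dualDeg = i := by
  have := x.hdeg_le
  unfold ENGen.dualDeg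
  omega

/-- `enMatrix_exact` for the complex of modules. -/
theorem eagonNorthcott_exact (hrs : ∀ r ∈ rs, r ∈ minorIdeal A)
    (hlen : rs.length = Fintype.card ι - 1) (hreg : IsWeaklyRegular R rs) (n : ℕ) :
    Function.Exact ((eagonNorthcott A).d (n + 2) (n + 1)).hom
      ((eagonNorthcott A).d (n + 1) n).hom := by
  refine exact_mulVecLin_of_forall (D := enMatrix A) (P := fun x => x.hdeg = n + 2)
    (Q := fun x => x.hdeg = n + 1) (S := fun x => x.hdeg = n) (enMatrix_mul_self A)
    (fun x y h h' => ?_) (fun x y h h' => ?_) fun z hz hDz => ?_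
  · have := enMatrix_deg A x y h
    omega
  · have := enMatrix_deg A x y h
    omega
  · exact enMatrix_exact hrs hlen hreg (j := n + 1) (by omega) hz hDz

/-- `enMatrix_transpose_exact` for the complex of modules. -/
theorem eagonNorthcottDual_exact (hrs : ∀ r ∈ rs, r ∈ minorIdeal A)
    (hlen : rs.length = Fintype.card ι - 1) (hreg : IsWeaklyRegular R rs) (n : ℕ) :
    Function.Exact ((eagonNorthcottDual A).d (n + 2) (n + 1)).hom
      ((eagonNorthcottDual A).d (n + 1) n).hom := by
  refine exact_mulVecLin_of_forall (D := (enMatrix A).transpose)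
    (P := fun x => x.hdeg + (n + 2) = Fintype.card ι - 1)
    (Q := fun x => x.hdeg + (n + 1) = Fintype.card ι - 1)
    (S := fun x => x.hdeg + n = Fintype.card ι - 1) (enMatrix_transpose_mul_self A)
    (fun x y h h' => ?_) (fun x y h h' => ?_) fun z hz hDz => ?_
  · have := enMatrix_transpose_deg A x y h
    have hn : n + 2 ≤ Fintype.card ι - 1 := by omega
    rw [ENGen.hdeg_add_eq_iff _ hn] at h'
    rw [ENGen.hdeg_add_eq_iff _ (by omega)]
    omega
  · have := enMatrix_transpose_deg A x y h
    have hn : n + 1 ≤ Fintype.card ι - 1 := by omega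
    rw [ENGen.hdeg_add_eq_iff _ hn] at h'
    rw [ENGen.hdeg_add_eq_iff _ (by omega)]
    omega
  · have hle : ∀ x : ENGen ι, x.dualDeg ≤ Fintype.card ι - 1 := fun _ => Nat.sub_le _ _
    by_cases hn : n + 1 ≤ Fintype.card ι - 1
    · obtain ⟨v, hv, hvz⟩ := enMatrix_transpose_exact hrs hlen hreg (j := n + 1) (by omega)
        (fun x hx => hz x (by rwa [ENGen.hdeg_add_eq_iff _ hn])) hDz
      refine ⟨v, fun x hx => hv x fun h' => hx ?_, hvz⟩
      have := hle x
      rwa [ENGen.hdeg_add_eq_iff _ (by omega)]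
    · refine ⟨0, fun x _ => rfl, ?_⟩
      rw [map_zero]
      ext x
      exact (hz x (by omega)).symm

end Complexes

/-! ### Lifting maps of complexes and minimality -/

section Lifting

variable {R : Type u} [CommRing R]

lemma exists_comp_eq_of_forall_mem_range {P Y Z : Type*} [AddCommGroup P] [Module R P]
    [Module.Projective R P] [AddCommGroup Y] [Module R Y] [AddCommGroup Z] [Module R Z]
    (f : Y →ₗ[R] Z) (g : P →ₗ[R] Z) (h : ∀ p, g p ∈ LinearMap.range f) :
    ∃ l : P →ₗ[R] Y, f ∘ₗ l = g := by
  obtain ⟨l, hl⟩ := Module.projective_lifting_property f.rangeRestrict (g.codRestrict _ h)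
    f.surjective_rangeRestrict
  exact ⟨l, LinearMap.ext fun p => congrArg Subtype.val (LinearMap.congr_fun hl p)⟩

lemma map_mem_smul_top {M N : Type*} [AddCommGroup M] [Module R M] [AddCommGroup N] [Module R N]
    (I : Ideal R) (f : M →ₗ[R] N) {x : M} (hx : x ∈ I • (⊤ : Submodule R M)) :
    f x ∈ I • (⊤ : Submodule R N) := by
  have h := Submodule.mem_map_of_mem (f := f) hx
  rw [Submodule.map_smul''] at h
  exact Submodule.smul_mono le_rfl le_top h

variable {C E : ChainComplex (ModuleCat.{u} R) ℕ}

lemma ChainComplex.f_d_apply (Φ : C ⟶ E) (n : ℕ) (c : C.X (n + 1)) :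
    (E.d (n + 1) n).hom ((Φ.f (n + 1)).hom c) = (Φ.f n).hom ((C.d (n + 1) n).hom c) :=
  LinearMap.congr_fun (congrArg ModuleCat.Hom.hom (Φ.comm (n + 1) n)) c

lemma ChainComplex.d_d_apply (n : ℕ) (c : C.X (n + 2)) :
    (C.d (n + 1) n).hom ((C.d (n + 2) (n + 1)).hom c) = 0 :=
  LinearMap.congr_fun (congrArg ModuleCat.Hom.hom (C.d_comp_d (n + 2) (n + 1) n)) c

/-- A map in degree zero which is compatible with the boundaries extends to a map of complexes, if
the source is projective and the target is exact in positive degrees. -/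
theorem exists_chainMap_of_forall_mem_range (hC : ∀ n, Module.Projective R (C.X n))
    (hE : ∀ n, Function.Exact (E.d (n + 2) (n + 1)).hom (E.d (n + 1) n).hom)
    (φ : C.X 0 ⟶ E.X 0)
    (hφ : ∀ c, φ.hom ((C.d 1 0).hom c) ∈ LinearMap.range (E.d 1 0).hom) :
    ∃ Φ : C ⟶ E, Φ.f 0 = φ := by
  obtain ⟨l, hl⟩ := exists_comp_eq_of_forall_mem_range (E.d 1 0).hom (φ.hom ∘ₗ (C.d 1 0).hom) hφ
  have succ : ∀ (n : ℕ) (p : Σ' (f : C.X n ⟶ E.X n) (f' : C.X (n + 1) ⟶ E.X (n + 1)),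
      f' ≫ E.d (n + 1) n = C.d (n + 1) n ≫ f),
      ∃ f'' : C.X (n + 2) ⟶ E.X (n + 2), f'' ≫ E.d (n + 2) (n + 1) =
        C.d (n + 2) (n + 1) ≫ p.2.1 := by
    rintro n ⟨f, f', h⟩
    obtain ⟨m, hm⟩ := exists_comp_eq_of_forall_mem_range (E.d (n + 2) (n + 1)).hom
      (f'.hom ∘ₗ (C.d (n + 2) (n + 1)).hom) (fun c => (hE n _).1 (by
        have h1 := LinearMap.congr_fun (congrArg ModuleCat.Hom.hom h)
          ((C.d (n + 2) (n + 1)).hom c)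
        refine h1.trans ?_
        change f.hom ((C.d (n + 1) n).hom ((C.d (n + 2) (n + 1)).hom c)) = 0
        rw [ChainComplex.d_d_apply, map_zero]))
    exact ⟨ModuleCat.ofHom m, ModuleCat.hom_ext hm⟩
  exact ⟨ChainComplex.mkHom C E φ (ModuleCat.ofHom l) (ModuleCat.hom_ext hl)
    (fun n p => ⟨(succ n p).choose, (succ n p).choose_spec⟩), rfl⟩

/-- A map of minimal complexes which vanishes in degree zero is null-homotopic, so that it vanishes
modulo `I`, if the source is projective and the target is exact in positive degrees. -/
lemma range_f_le_of_f_zero_eq_zero (hC : ∀ n, Module.Projective R (C.X n))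
    (hE : ∀ n, Function.Exact (E.d (n + 2) (n + 1)).hom (E.d (n + 1) n).hom) {I : Ideal R}
    (hCI : ∀ n, LinearMap.range (C.d (n + 1) n).hom ≤ I • ⊤)
    (hEI : ∀ n, LinearMap.range (E.d (n + 1) n).hom ≤ I • ⊤)
    (Φ : C ⟶ E) (hΦ : Φ.f 0 = 0) (n : ℕ) : LinearMap.range (Φ.f n).hom ≤ I • ⊤ := by
  have key : ∀ n, ∃ (h : C.X n →ₗ[R] E.X (n + 1)) (h' : C.X (n + 1) →ₗ[R] E.X (n + 2)),
      ∀ c, (Φ.f (n + 1)).hom c =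
        (E.d (n + 2) (n + 1)).hom (h' c) + h ((C.d (n + 1) n).hom c) := by
    intro n
    induction n with
    | zero =>
      obtain ⟨h', hh'⟩ := exists_comp_eq_of_forall_mem_range (E.d 2 1).hom (Φ.f 1).hom
        (fun c => (hE 0 _).1 (by rw [ChainComplex.f_d_apply, hΦ]; rfl))
      exact ⟨0, h', fun c => by
        rw [LinearMap.zero_apply, add_zero]; exact (LinearMap.congr_fun hh' c).symm⟩
    | succ n ih =>
      obtain ⟨h, h', hh⟩ := ih
      obtain ⟨h'', hh''⟩ := exists_comp_eq_of_forall_mem_range (E.d (n + 3) (n + 2)).hom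
        ((Φ.f (n + 2)).hom - h' ∘ₗ (C.d (n + 2) (n + 1)).hom) (fun c => (hE (n + 1) _).1 (by
          rw [LinearMap.sub_apply, map_sub, ChainComplex.f_d_apply, hh, LinearMap.comp_apply,
            ChainComplex.d_d_apply, map_zero, add_zero, sub_self]))
      refine ⟨h', h'', fun c => ?_⟩
      have := LinearMap.congr_fun hh'' c
      rw [LinearMap.comp_apply, LinearMap.sub_apply, LinearMap.comp_apply] at this
      rw [this, sub_add_cancel]
  rintro _ ⟨c, rfl⟩
  cases n with
  | zero =>
    rw [hΦ]
    exact zero_mem _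
  | succ n =>
    obtain ⟨h, h', hh⟩ := key n
    rw [hh]
    exact add_mem (hEI _ ⟨_, rfl⟩) (map_mem_smul_top I h (hCI _ ⟨_, rfl⟩))

end Lifting

/-! ### The mapping cone as a minimal free resolution -/

section Cone

open HomologicalComplex

variable {R : Type u} [CommRing R] {C E : ChainComplex (ModuleCat.{u} R) ℕ} (Ψ : C ⟶ E)

/-- The degree zero part of the mapping cone of a map of chain complexes. -/
noncomputable def coneZeroEquiv : (homotopyCofiber Ψ).X 0 ≃ₗ[R] E.X 0 :=
  (homotopyCofiber.XIso Ψ 0 (by simp)).toLinearEquiv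

lemma down_rel_succ (n : ℕ) : (ComplexShape.down ℕ).Rel (n + 1) n := rfl

/-- The part of degree `n + 1` of the mapping cone of a map of chain complexes. -/
noncomputable def coneSuccEquiv (n : ℕ) :
    (homotopyCofiber Ψ).X (n + 1) ≃ₗ[R] C.X n × E.X (n + 1) :=
  LinearEquiv.ofLinearMap
    ((homotopyCofiber.fstX Ψ (n + 1) n (down_rel_succ n)).hom.prod (homotopyCofiber.sndX Ψ (n + 1)).hom)
    ((homotopyCofiber.inlX Ψ n (n + 1) (down_rel_succ n)).hom.coprod (homotopyCofiber.inrX Ψ (n + 1)).hom)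
    (by
      have h1 := congrArg ModuleCat.Hom.hom (homotopyCofiber.inlX_fstX Ψ n (n + 1) (down_rel_succ n))
      have h2 := congrArg ModuleCat.Hom.hom (homotopyCofiber.inlX_sndX Ψ n (n + 1) (down_rel_succ n))
      have h3 := congrArg ModuleCat.Hom.hom (homotopyCofiber.inrX_fstX Ψ (n + 1) n (down_rel_succ n))
      have h4 := congrArg ModuleCat.Hom.hom (homotopyCofiber.inrX_sndX Ψ (n + 1))
      rw [ModuleCat.hom_comp] at h1 h2 h3 h4
      ext x
      · simpa using LinearMap.congr_fun h1 x
      · simpa using LinearMap.congr_fun h2 x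
      · simpa using LinearMap.congr_fun h3 x
      · simpa using LinearMap.congr_fun h4 x)
    (by
      have h : homotopyCofiber.fstX Ψ (n + 1) n (down_rel_succ n) ≫
          homotopyCofiber.inlX Ψ n (n + 1) (down_rel_succ n) +
          homotopyCofiber.sndX Ψ (n + 1) ≫ homotopyCofiber.inrX Ψ (n + 1) = 𝟙 _ := by
        apply homotopyCofiber.ext_to_X Ψ (n + 1) n (down_rel_succ n)
        · rw [Preadditive.add_comp, Category.assoc, Category.assoc,
            homotopyCofiber.inlX_fstX Ψ n (n + 1) (down_rel_succ n), homotopyCofiber.inrX_fstX]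
          simp
        · rw [Preadditive.add_comp, Category.assoc, Category.assoc,
            homotopyCofiber.inlX_sndX Ψ n (n + 1) (down_rel_succ n), homotopyCofiber.inrX_sndX]
          simp
      ext x
      exact LinearMap.congr_fun (congrArg ModuleCat.Hom.hom h) x)

lemma coneSuccEquiv_d_fst (n : ℕ) (z : (homotopyCofiber Ψ).X (n + 2)) :
    (coneSuccEquiv Ψ n (((homotopyCofiber Ψ).d (n + 2) (n + 1)).hom z)).1 =
      -(C.d (n + 1) n).hom (coneSuccEquiv Ψ (n + 1) z).1 :=
  LinearMap.congr_fun (congrArg ModuleCat.Hom.hom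
    (homotopyCofiber.d_fstX Ψ (n + 2) (n + 1) n rfl rfl)) z

lemma coneSuccEquiv_d_snd (n : ℕ) (z : (homotopyCofiber Ψ).X (n + 2)) :
    (coneSuccEquiv Ψ n (((homotopyCofiber Ψ).d (n + 2) (n + 1)).hom z)).2 =
      (Ψ.f (n + 1)).hom (coneSuccEquiv Ψ (n + 1) z).1 +
        (E.d (n + 2) (n + 1)).hom (coneSuccEquiv Ψ (n + 1) z).2 :=
  LinearMap.congr_fun (congrArg ModuleCat.Hom.hom
    (homotopyCofiber.d_sndX Ψ (n + 2) (n + 1) rfl)) z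

lemma coneZeroEquiv_d (z : (homotopyCofiber Ψ).X 1) :
    coneZeroEquiv Ψ (((homotopyCofiber Ψ).d 1 0).hom z) =
      (Ψ.f 0).hom (coneSuccEquiv Ψ 0 z).1 + (E.d 1 0).hom (coneSuccEquiv Ψ 0 z).2 := by
  have h : (homotopyCofiber.XIso Ψ 0 (by simp)).hom = homotopyCofiber.sndX Ψ 0 := by
    rw [homotopyCofiber.sndX, dif_neg]
  change (homotopyCofiber.XIso Ψ 0 (by simp)).hom.hom _ = _
  rw [h]
  exact LinearMap.congr_fun (congrArg ModuleCat.Hom.hom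
    (homotopyCofiber.d_sndX Ψ 1 0 rfl)) z

/-- The mapping cone of a map `Ψ` of complexes of free modules of finite rank is a minimal free
resolution of the cokernel of `H₀(C) → H₀(E)`, if both complexes and `Ψ` vanish modulo `I`, both
complexes are exact in positive degrees, and `H₀(C) → H₀(E)` is injective. -/
theorem isMinimalFreeResolution_homotopyCofiber {I : Ideal R}
    (hC : ∀ n, Module.Free R (C.X n) ∧ Module.Finite R (C.X n))
    (hE : ∀ n, Module.Free R (E.X n) ∧ Module.Finite R (E.X n))
    (hCex : ∀ n, Function.Exact (C.d (n + 2) (n + 1)).hom (C.d (n + 1) n).hom)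
    (hEex : ∀ n, Function.Exact (E.d (n + 2) (n + 1)).hom (E.d (n + 1) n).hom)
    (hCI : ∀ n, LinearMap.range (C.d (n + 1) n).hom ≤ I • ⊤)
    (hEI : ∀ n, LinearMap.range (E.d (n + 1) n).hom ≤ I • ⊤)
    (hΨI : ∀ n, LinearMap.range (Ψ.f n).hom ≤ I • ⊤)
    (hinj : ∀ c, (Ψ.f 0).hom c ∈ LinearMap.range (E.d 1 0).hom →
      c ∈ LinearMap.range (C.d 1 0).hom)
    {M : Type u} [AddCommGroup M] [Module R M] (ε : E.X 0 →ₗ[R] M)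
    (hε : Function.Surjective ε)
    (hker : LinearMap.ker ε = LinearMap.range (Ψ.f 0).hom ⊔ LinearMap.range (E.d 1 0).hom) :
    IsMinimalFreeResolution I (homotopyCofiber Ψ) M := by
  refine ⟨fun n => ?_, ⟨ε ∘ₗ (coneZeroEquiv Ψ).toLinearMap, hε.comp (coneZeroEquiv Ψ).surjective,
    fun z => ?_⟩, fun n z => ⟨fun hz => ?_, ?_⟩, fun n => ?_⟩
  · cases n with
    | zero =>
      obtain ⟨h1, h2⟩ := hE 0
      exact ⟨Module.Free.of_equiv (coneZeroEquiv Ψ).symm, Module.Finite.equiv (coneZeroEquiv Ψ).symm⟩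
    | succ n =>
      obtain ⟨h1, h2⟩ := hE (n + 1)
      obtain ⟨h3, h4⟩ := hC n
      exact ⟨Module.Free.of_equiv (coneSuccEquiv Ψ n).symm,
        Module.Finite.equiv (coneSuccEquiv Ψ n).symm⟩
  · change coneZeroEquiv Ψ z ∈ LinearMap.ker ε ↔ _
    rw [hker, Submodule.mem_sup]
    constructor
    · rintro ⟨_, ⟨c, rfl⟩, _, ⟨b, rfl⟩, h⟩
      refine ⟨(coneSuccEquiv Ψ 0).symm (c, b), (coneZeroEquiv Ψ).injective ?_⟩
      rw [coneZeroEquiv_d, LinearEquiv.apply_symm_apply, h]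
    · rintro ⟨w, rfl⟩
      exact ⟨_, ⟨_, rfl⟩, _, ⟨_, rfl⟩, (coneZeroEquiv_d Ψ w).symm⟩
  · -- a cycle `(a, b)` with `a = d c` is the boundary of some `(-c, y)`
    suffices h : ∃ c, (C.d (n + 1) n).hom c = (coneSuccEquiv Ψ n z).1 ∧
        (E.d (n + 1) n).hom ((coneSuccEquiv Ψ n z).2 + (Ψ.f (n + 1)).hom c) = 0 by
      obtain ⟨c, hc, h⟩ := h
      obtain ⟨y, hy⟩ := (hEex n _).1 h
      refine ⟨(coneSuccEquiv Ψ (n + 1)).symm (-c, y), (coneSuccEquiv Ψ n).injective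
        (Prod.ext ?_ ?_)⟩
      · rw [coneSuccEquiv_d_fst, LinearEquiv.apply_symm_apply, map_neg, neg_neg, hc]
      · rw [coneSuccEquiv_d_snd, LinearEquiv.apply_symm_apply, hy, map_neg]
        abel
    cases n with
    | zero =>
      have h1 := coneZeroEquiv_d Ψ z
      rw [hz, map_zero] at h1
      obtain ⟨c, hc⟩ := hinj (coneSuccEquiv Ψ 0 z).1 ⟨-(coneSuccEquiv Ψ 0 z).2, by
        rw [map_neg]
        exact neg_eq_of_add_eq_zero_left h1.symm⟩
      refine ⟨c, hc, ?_⟩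
      rw [map_add, ChainComplex.f_d_apply, hc, add_comm]
      exact h1.symm
    | succ n =>
      have h1 := coneSuccEquiv_d_fst Ψ n z
      have h2 := coneSuccEquiv_d_snd Ψ n z
      rw [hz, map_zero] at h1 h2
      obtain ⟨c, hc⟩ := (hCex n _).1 (neg_eq_zero.1 h1.symm)
      refine ⟨c, hc, ?_⟩
      rw [map_add, ChainComplex.f_d_apply, hc]
      exact (add_comm _ _).trans h2.symm
  · rintro ⟨w, rfl⟩
    exact ChainComplex.d_d_apply n w
  · rintro _ ⟨z, rfl⟩
    cases n with
    | zero =>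
      rw [← (coneZeroEquiv Ψ).symm_apply_apply (((homotopyCofiber Ψ).d (0 + 1) 0).hom z)]
      refine map_mem_smul_top I (coneZeroEquiv Ψ).symm.toLinearMap ?_
      rw [coneZeroEquiv_d]
      exact add_mem (hΨI _ ⟨_, rfl⟩) (hEI _ ⟨_, rfl⟩)
    | succ n =>
      rw [← (coneSuccEquiv Ψ n).symm_apply_apply (((homotopyCofiber Ψ).d (n + 1 + 1) (n + 1)).hom z)]
      refine map_mem_smul_top I (coneSuccEquiv Ψ n).symm.toLinearMap ?_
      generalize hw : coneSuccEquiv Ψ n (((homotopyCofiber Ψ).d (n + 1 + 1) (n + 1)).hom z) = w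
      have h1 := coneSuccEquiv_d_fst Ψ n z
      have h2 := coneSuccEquiv_d_snd Ψ n z
      rw [hw] at h1 h2
      rw [← Prod.fst_add_snd w]
      refine add_mem (map_mem_smul_top I (LinearMap.inl R (C.X n) (E.X (n + 1))) (x := w.1) ?_)
        (map_mem_smul_top I (LinearMap.inr R (C.X n) (E.X (n + 1))) (x := w.2) ?_)
      · rw [h1]
        exact neg_mem (hCI _ ⟨_, rfl⟩)
      · rw [h2]
        exact add_mem (hΨI _ ⟨_, rfl⟩) (hEI _ ⟨_, rfl⟩)

end Cone

/-! ### Boundaries in degree zero, and minimality of the Eagon–Northcott complexes -/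

section MatrixRange

variable {R : Type u} [CommRing R]

lemma Matrix.range_mulVecLin_le {X Y : Type} [Fintype X] [Fintype Y] (M : Matrix X Y R) {I : Ideal R}
    (hM : ∀ x y, M x y ∈ I) : LinearMap.range M.mulVecLin ≤ I • ⊤ := by
  classical
  rintro _ ⟨v, rfl⟩
  rw [pi_eq_sum_univ' (M.mulVecLin v)]
  refine Submodule.sum_mem _ fun x _ => Submodule.smul_mem_smul ?_ trivial
  exact Ideal.sum_mem _ fun y _ => Ideal.mul_mem_right _ _ (hM x y)

lemma Matrix.block_mulVec_eq {X : Type} [Fintype X] (D : Matrix X X R) {P Q : X → Prop}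
    [Fintype {y // P y}] (h : ∀ x y, D x y ≠ 0 → Q x → P y) (w : X → R) (x : {x // Q x}) :
    (Matrix.of fun (x : {x // Q x}) (y : {y // P y}) => D x.1 y.1).mulVec (fun y => w y) x =
      D.smulVecLin R w x := by
  rw [Matrix.smulVecLin_apply]
  refine Fintype.sum_of_injective Subtype.val Subtype.val_injective _ _ (fun y hy => ?_)
    fun y => rfl
  by_contra h'
  exact hy ⟨⟨y, h x y (left_ne_zero_of_mul h') x.2⟩, rfl⟩

end MatrixRange

section DegreeZero

variable {R : Type u} [CommRing R] {ι : Type} [LinearOrder ι]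

lemma enEntry_mem {A : Matrix (Fin 2) ι R} {I : Ideal R} (hA : ∀ i j, A i j ∈ I) (x y : ENGen ι) :
    enEntry A x y ∈ I := by
  rcases y with _ | ⟨T, c⟩
  · rcases x with _ | ⟨U, a⟩ <;> exact zero_mem _
  rcases x with _ | ⟨U, a⟩
  · simp only [enEntry]
    split_ifs
    · refine Ideal.sum_mem _ fun i _ => Ideal.sum_mem _ fun j _ => ?_
      split_ifs
      · exact sub_mem (Ideal.mul_mem_left _ _ (hA _ _)) (Ideal.mul_mem_left _ _ (hA _ _))
      · exact zero_mem _
    · exact zero_mem _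
  · simp only [enEntry, enContract]
    refine Ideal.sum_mem _ fun i _ => ?_
    split_ifs <;> first
      | exact zero_mem _
      | refine Ideal.mul_mem_left _ _ (add_mem ?_ ?_) <;> first
        | exact zero_mem _
        | exact hA _ _

variable [Fintype ι] (A : Matrix (Fin 2) ι R)

/-- The degree zero part `R` of the Eagon–Northcott complex. -/
noncomputable def enZeroEquiv : (eagonNorthcott A).X 0 ≃ₗ[R] R where
  toFun v := (v : {x : ENGen ι // x.hdeg = 0} → R) ⟨none, rfl⟩
  map_add' _ _ := rfl
  map_smul' _ _ := rfl
  invFun r := fun _ : {x : ENGen ι // x.hdeg = 0} => r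
  left_inv v := by
    refine funext fun x : {x : ENGen ι // x.hdeg = 0} => ?_
    obtain ⟨_ | ⟨T, a⟩, hx⟩ := x
    · rfl
    · have := a.2
      simp only [ENGen.hdeg] at hx
      omega
  right_inv r := rfl

lemma mem_range_eagonNorthcott_d_iff {v : (eagonNorthcott A).X 0} :
    v ∈ LinearMap.range ((eagonNorthcott A).d 1 0).hom ↔ enZeroEquiv A v ∈ minorIdeal A := by
  rw [mem_minorIdeal_iff]
  constructor
  · rintro ⟨w, rfl⟩
    refine ⟨Function.extend Subtype.val (w : {x : ENGen ι // x.hdeg = 1} → R) 0, ?_⟩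
    refine ((enMatrix A).smulVecLin_extend (P := fun x => x.hdeg = 1) (Q := fun x => x.hdeg = 0)
      (fun x y h h' => by
        have := enMatrix_deg A x y h
        omega) w).trans ?_
    ext x
    rcases x with _ | ⟨T, a⟩
    · rw [Pi.single_eq_same]
      exact extend_val_of_mem (R := R) (P := fun x : ENGen ι => x.hdeg = 0) _ rfl
    · rw [Pi.single_eq_of_ne (by simp)]
      refine extend_val_of_not (R := R) (P := fun x : ENGen ι => x.hdeg = 0) _ ?_
      have := a.2
      simp only [ENGen.hdeg]
      omega
  · rintro ⟨w, hw⟩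
    refine ⟨fun y : {x : ENGen ι // x.hdeg = 1} => w y, (enZeroEquiv A).injective ?_⟩
    have h := (enMatrix A).block_mulVec_eq (P := fun x => x.hdeg = 1) (Q := fun x => x.hdeg = 0)
      (fun x y h h' => by
        have := enMatrix_deg A x y h
        omega) w ⟨none, rfl⟩
    rw [hw, Pi.single_eq_same] at h
    exact h

/-- An element of a homogeneous component of the dual complex, as an element of the total module. -/
noncomputable def dualExtend (i : ℕ) : (eagonNorthcottDual A).X i →ₗ[R] (ENGen ι → R) :=
  Function.ExtendByZero.linearMap R
    (Subtype.val : {x : ENGen ι // x.hdeg + i = Fintype.card ι - 1} → ENGen ι)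

lemma dualExtend_apply (i : ℕ) (v : {x : ENGen ι // x.hdeg + i = Fintype.card ι - 1} → R) :
    dualExtend A i v = Function.extend Subtype.val v 0 := rfl

lemma dualExtend_d (v : (eagonNorthcottDual A).X 1) :
    dualExtend A 0 (((eagonNorthcottDual A).d 1 0).hom v) =
      (enMatrix A).transpose.smulVecLin R (dualExtend A 1 v) := by
  refine Eq.symm ((enMatrix A).transpose.smulVecLin_extend
    (P := fun x => x.hdeg + 1 = Fintype.card ι - 1)
    (Q := fun x => x.hdeg + 0 = Fintype.card ι - 1) (fun x y h h' => ?_) v)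
  have := enMatrix_transpose_deg A x y h
  rw [ENGen.hdeg_add_eq_iff _ (by omega)] at h' ⊢
  omega

lemma dualExtend_zero_apply (v : (eagonNorthcottDual A).X 0) {y : ENGen ι} (hy : y.dualDeg ≠ 0) :
    dualExtend A 0 v y = 0 :=
  extend_val_of_not _ fun h => hy ((ENGen.hdeg_add_eq_iff _ (Nat.zero_le _)).1 h)

lemma mem_range_eagonNorthcottDual_d (hι : 2 ≤ Fintype.card ι) {v : (eagonNorthcottDual A).X 0}
    (h : ∃ w, (enMatrix A).transpose.smulVecLin R w = dualExtend A 0 v) :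
    v ∈ LinearMap.range ((eagonNorthcottDual A).d 1 0).hom := by
  obtain ⟨w, hw⟩ := h
  refine ⟨fun y : {x : ENGen ι // x.hdeg + 1 = Fintype.card ι - 1} => w y, ?_⟩
  refine funext fun x : {x : ENGen ι // x.hdeg + 0 = Fintype.card ι - 1} => ?_
  refine ((enMatrix A).transpose.block_mulVec_eq (P := fun x => x.hdeg + 1 = Fintype.card ι - 1)
    (Q := fun x => x.hdeg + 0 = Fintype.card ι - 1) (fun x y h h' => ?_) w x).trans ?_
  · have := enMatrix_transpose_deg A x y h
    rw [ENGen.hdeg_add_eq_iff _ (by omega)] at h' ⊢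
    omega
  · rw [hw]
    exact extend_val_of_mem (R := R) (P := fun x : ENGen ι => x.hdeg + 0 = Fintype.card ι - 1) v x.2

lemma sum_dual_zero_eq_enFunctional (hι : 2 ≤ Fintype.card ι) (f : ℕ → R)
    (v : {y : ENGen ι // y.hdeg + 0 = Fintype.card ι - 1} → R) :
    ∑ y : {y : ENGen ι // y.hdeg + 0 = Fintype.card ι - 1},
      (match y.1 with
        | none => 0
        | some ⟨_, j⟩ => f j) * v y = enFunctional f (dualExtend A 0 v) := by
  rw [enFunctional_apply]
  have hc : (Finset.univ : Finset ι).card = Fintype.card ι := Finset.card_univ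
  let g : Fin ((Finset.univ : Finset ι).card - 1) →
      {y : ENGen ι // y.hdeg + 0 = Fintype.card ι - 1} := fun j =>
    ⟨some ⟨Finset.univ, j⟩, by simp only [ENGen.hdeg]; omega⟩
  symm
  refine Fintype.sum_bijective g ⟨fun i j h => ?_, fun y => ?_⟩ _ _ fun j => ?_
  · simpa only [g, Subtype.mk.injEq, Option.some.injEq, Sigma.mk.injEq, heq_eq_eq, true_and] using h
  · obtain ⟨j, hj⟩ := ENGen.exists_of_dualDeg_eq_zero hι
      ((ENGen.hdeg_add_eq_iff _ (Nat.zero_le _)).1 y.2)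
    exact ⟨j, Subtype.ext hj.symm⟩
  · rw [dualExtend_apply, extend_val_of_mem v (g j).2]

end DegreeZero

lemma eagonNorthcott_range_d_le {R : Type u} [CommRing R] {ι : Type} [LinearOrder ι] [Fintype ι]
    {A : Matrix (Fin 2) ι R} {I : Ideal R} (hA : ∀ i j, A i j ∈ I) (n : ℕ) :
    LinearMap.range ((eagonNorthcott A).d (n + 1) n).hom ≤ I • ⊤ :=
  Matrix.range_mulVecLin_le _ fun _ _ => enEntry_mem hA _ _

lemma eagonNorthcottDual_range_d_le {R : Type u} [CommRing R] {ι : Type} [LinearOrder ι] [Fintype ι]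
    {A : Matrix (Fin 2) ι R} {I : Ideal R} (hA : ∀ i j, A i j ∈ I) (n : ℕ) :
    LinearMap.range ((eagonNorthcottDual A).d (n + 1) n).hom ≤ I • ⊤ :=
  Matrix.range_mulVecLin_le _ fun _ _ => enEntry_mem hA _ _

lemma eagonNorthcott_free_finite {R : Type u} [CommRing R] {ι : Type} [LinearOrder ι] [Fintype ι]
    (A : Matrix (Fin 2) ι R) (n : ℕ) : Module.Free R ((eagonNorthcott A).X n) ∧
      Module.Finite R ((eagonNorthcott A).X n) :=
  ⟨inferInstanceAs (Module.Free R ({x : ENGen ι // x.hdeg = n} → R)),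
    inferInstanceAs (Module.Finite R ({x : ENGen ι // x.hdeg = n} → R))⟩

lemma eagonNorthcottDual_free_finite {R : Type u} [CommRing R] {ι : Type} [LinearOrder ι]
    [Fintype ι] (A : Matrix (Fin 2) ι R) (n : ℕ) : Module.Free R ((eagonNorthcottDual A).X n) ∧
      Module.Finite R ((eagonNorthcottDual A).X n) :=
  ⟨inferInstanceAs (Module.Free R ({x : ENGen ι // x.hdeg + n = Fintype.card ι - 1} → R)),
    inferInstanceAs (Module.Finite R ({x : ENGen ι // x.hdeg + n = Fintype.card ι - 1} → R))⟩

/-! ### Extensions of `ψ` and their mapping cones -/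

namespace Sally

variable {e : ℕ} {k : Type u} [Field k]

lemma x_mem_variablesIdeal (i : ℕ) : x e k i ∈ variablesIdeal (VarIdx e) k := by
  have hv : ∀ i : ℕ, (if h : i < e ∧ i ≠ 2 ∧ i ≠ 3 then
      (MvPolynomial.X ⟨⟨i, h.1⟩, h.2⟩ : PolyRing e k) else 0) ∈ variablesIdeal (VarIdx e) k := by
    intro i
    split_ifs
    · exact Ideal.subset_span ⟨_, rfl⟩
    · exact zero_mem _
  simp only [x]
  split
  · exact Ideal.pow_mem_of_mem _ (hv 0) 2 two_pos
  · split
    · exact Ideal.mul_mem_left _ _ (hv 1)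
    · split
      · exact Ideal.pow_mem_of_mem _ (hv 1) 2 two_pos
      · exact hv i

lemma matA_mem_variablesIdeal (i : Fin 2) (j : ColIdx e) :
    matA e k i j ∈ variablesIdeal (VarIdx e) k :=
  x_mem_variablesIdeal _

lemma enZeroEquiv_psi (he : 6 ≤ e) (v : (eagonNorthcottDual (matA e k)).X 0) :
    enZeroEquiv (matA e k) ((psi e k).hom v) = psiTotal e k (dualExtend (matA e k) 0 v) := by
  refine (Finset.sum_congr rfl fun y _ => ?_).trans (sum_dual_zero_eq_enFunctional (matA e k)
    (by rw [card_colIdx he]; omega) (fun j => (-1) ^ j * psiGen e k j) v)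
  obtain ⟨_ | ⟨T, j⟩, hy⟩ := y <;> rfl

variable (e k) in
/-- The map `E*_0 → E_0` with `g₁^j g₂^(e-5-j) ↦ (-1)^j X_(j+c)`. -/
noncomputable def shiftMap (c : ℕ) :
    (eagonNorthcottDual (matA e k)).X 0 ⟶ (eagonNorthcott (matA e k)).X 0 :=
  ModuleCat.ofHom ((enZeroEquiv (matA e k)).symm.toLinearMap ∘ₗ
    enFunctional (fun j => (-1) ^ j * x e k (j + c)) ∘ₗ dualExtend (matA e k) 0)

lemma enZeroEquiv_shiftMap (c : ℕ) (v : (eagonNorthcottDual (matA e k)).X 0) :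
    enZeroEquiv (matA e k) ((shiftMap e k c).hom v) =
      enFunctional (fun j => (-1) ^ j * x e k (j + c)) (dualExtend (matA e k) 0 v) :=
  (enZeroEquiv (matA e k)).apply_symm_apply _

theorem matA_exact (he : 6 ≤ e) (n : ℕ) :
    Function.Exact ((eagonNorthcott (matA e k)).d (n + 2) (n + 1)).hom
      ((eagonNorthcott (matA e k)).d (n + 1) n).hom := by
  obtain ⟨rs, h1, h2, h3, -⟩ := exists_isWeaklyRegular (k := k) he
  exact eagonNorthcott_exact h1 (by rw [h2, card_colIdx he]; omega) h3 n

theorem matA_dual_exact (he : 6 ≤ e) (n : ℕ) :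
    Function.Exact ((eagonNorthcottDual (matA e k)).d (n + 2) (n + 1)).hom
      ((eagonNorthcottDual (matA e k)).d (n + 1) n).hom := by
  obtain ⟨rs, h1, h2, h3, -⟩ := exists_isWeaklyRegular (k := k) he
  exact eagonNorthcottDual_exact h1 (by rw [h2, card_colIdx he]; omega) h3 n

lemma matA_dual_projective (n : ℕ) :
    Module.Projective (PolyRing e k) ((eagonNorthcottDual (matA e k)).X n) := by
  obtain ⟨h, -⟩ := eagonNorthcottDual_free_finite (matA e k) n
  infer_instance

lemma exists_lift_shiftMap (he : 6 ≤ e) {c : ℕ} (hc : 4 ≤ c) (hc' : c ≤ 7) :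
    ∃ Φ : eagonNorthcottDual (matA e k) ⟶ eagonNorthcott (matA e k), Φ.f 0 = shiftMap e k c := by
  refine exists_chainMap_of_forall_mem_range matA_dual_projective (matA_exact he) _ fun v => ?_
  rw [mem_range_eagonNorthcott_d_iff, enZeroEquiv_shiftMap, dualExtend_d]
  exact shiftFunctional_transpose_mem he hc hc' _

/-- Since `ψ = X₁ α - X₄ β` for two maps `α`, `β` which extend to maps of complexes, it has an
extension which vanishes modulo the variables. -/
theorem exists_extension_psi (he : 6 ≤ e) :
    ∃ Ψ : eagonNorthcottDual (matA e k) ⟶ eagonNorthcott (matA e k), Ψ.f 0 = psi e k ∧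
      ∀ n, LinearMap.range (Ψ.f n).hom ≤ variablesIdeal (VarIdx e) k • ⊤ := by
  obtain ⟨α, hα⟩ := exists_lift_shiftMap (k := k) he (c := 7) (by omega) le_rfl
  obtain ⟨β, hβ⟩ := exists_lift_shiftMap (k := k) he (c := 4) le_rfl (by omega)
  refine ⟨x e k 1 • α - x e k 4 • β, ?_, fun n => ?_⟩
  · ext v
    refine (enZeroEquiv (matA e k)).injective ?_
    rw [HomologicalComplex.sub_f_apply, HomologicalComplex.smul_f_apply,
      HomologicalComplex.smul_f_apply, hα, hβ, enZeroEquiv_psi he, psiTotal_apply_eq,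
      ← enZeroEquiv_shiftMap, ← enZeroEquiv_shiftMap]
    rfl
  · rintro _ ⟨v, rfl⟩
    exact sub_mem (Submodule.smul_mem_smul (x_mem_variablesIdeal 1) trivial)
      (Submodule.smul_mem_smul (x_mem_variablesIdeal 4) trivial)

/-- Every extension of `ψ` vanishes modulo the variables, since two extensions are homotopic. -/
lemma range_extension_le (he : 6 ≤ e)
    (Ψ : eagonNorthcottDual (matA e k) ⟶ eagonNorthcott (matA e k)) (hΨ : Ψ.f 0 = psi e k) (n : ℕ) :
    LinearMap.range (Ψ.f n).hom ≤ variablesIdeal (VarIdx e) k • ⊤ := by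
  obtain ⟨Φ, hΦ, h⟩ := exists_extension_psi (k := k) he
  have h1 := range_f_le_of_f_zero_eq_zero matA_dual_projective (matA_exact he)
    (eagonNorthcottDual_range_d_le matA_mem_variablesIdeal)
    (eagonNorthcott_range_d_le matA_mem_variablesIdeal) (Ψ - Φ)
    (by rw [HomologicalComplex.sub_f_apply, hΨ, hΦ, sub_self]) n
  rintro _ ⟨v, rfl⟩
  have h2 := add_mem (h1 ⟨v, rfl⟩) (h n ⟨v, rfl⟩)
  rw [HomologicalComplex.sub_f_apply] at h2
  convert h2 using 1
  exact (sub_add_cancel ((Ψ.f n).hom v) ((Φ.f n).hom v)).symm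

/-- The image of `ψ` in the quotient by the minors is that of the defining ideal. -/
lemma range_psi_sup_range_d (he : 6 ≤ e) :
    (LinearMap.range (psi e k).hom ⊔ LinearMap.range ((eagonNorthcott (matA e k)).d 1 0).hom) =
      Submodule.comap (enZeroEquiv (matA e k)).toLinearMap (coneIdeal e k) := by
  have hcard : (Finset.univ : Finset (ColIdx e)).card = e - 3 := card_colIdx he
  refine le_antisymm (sup_le ?_ ?_) ?_
  · rintro _ ⟨v, rfl⟩
    change enZeroEquiv (matA e k) _ ∈ coneIdeal e k
    rw [enZeroEquiv_psi he, psiTotal, enFunctional_apply]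
    exact Ideal.sum_mem _ fun j _ => Ideal.mul_mem_right _ _ (Ideal.mul_mem_left _ _
      (psiGen_mem_coneIdeal (by have := j.2; omega)))
  · intro v hv
    exact minorIdeal_le_coneIdeal ((mem_range_eagonNorthcott_d_iff _).1 hv)
  · rw [← Submodule.map_le_map_iff_of_injective (enZeroEquiv (matA e k)).injective,
      Submodule.map_comap_eq_of_surjective (enZeroEquiv (matA e k)).surjective, coneIdeal,
      sup_le_iff]
    constructor
    · intro r hr
      refine ⟨(enZeroEquiv (matA e k)).symm r, Submodule.mem_sup_right
        ((mem_range_eagonNorthcott_d_iff _).2 ?_), (enZeroEquiv (matA e k)).apply_symm_apply r⟩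
      rwa [LinearEquiv.apply_symm_apply]
    · refine Ideal.span_le.2 ?_
      rintro _ ⟨j, hj, rfl⟩
      rw [Set.mem_ofPred_eq] at hj
      let i : Fin ((Finset.univ : Finset (ColIdx e)).card - 1) := ⟨j, by omega⟩
      have h1 : ∀ y : ENGen (ColIdx e), ¬ y.hdeg + 0 = Fintype.card (ColIdx e) - 1 →
          topGen (PolyRing e k) (ColIdx e) i y = 0 := by
        intro y hy
        rw [topGen, Pi.single_eq_of_ne]
        rintro rfl
        rw [← Finset.card_univ] at hy
        exact hy rfl
      -- the sign in `ψ` is absorbed by the preimage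
      let v : (eagonNorthcottDual (matA e k)).X 0 := fun y : {y : ENGen (ColIdx e) //
        y.hdeg + 0 = Fintype.card (ColIdx e) - 1} => topGen (PolyRing e k) (ColIdx e) i y.1
      have hv : dualExtend (matA e k) 0 v = topGen (PolyRing e k) (ColIdx e) i :=
        extend_restrict h1
      refine ⟨(psi e k).hom ((-1 : PolyRing e k) ^ j • v), Submodule.mem_sup_left ⟨_, rfl⟩, ?_⟩
      change enZeroEquiv (matA e k) _ = _
      rw [enZeroEquiv_psi he, map_smul, map_smul, hv, psiTotal, enFunctional_topGen, smul_eq_mul,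
        ← mul_assoc, ← mul_pow]
      simp [i]

theorem isMinimalFreeResolution_cone (he : 6 ≤ e)
    (Ψ : eagonNorthcottDual (matA e k) ⟶ eagonNorthcott (matA e k)) (hΨ : Ψ.f 0 = psi e k) :
    IsMinimalFreeResolution (variablesIdeal (VarIdx e) k)
      (HomologicalComplex.homotopyCofiber Ψ) (PolyRing e k ⧸ definingIdeal e k) := by
  refine isMinimalFreeResolution_homotopyCofiber Ψ (eagonNorthcottDual_free_finite _)
    (eagonNorthcott_free_finite _) (matA_dual_exact he) (matA_exact he)
    (eagonNorthcottDual_range_d_le matA_mem_variablesIdeal)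
    (eagonNorthcott_range_d_le matA_mem_variablesIdeal) (range_extension_le he Ψ hΨ)
    (fun v hv => ?_) ((definingIdeal e k).mkQ ∘ₗ (enZeroEquiv (matA e k)).toLinearMap)
    ((Submodule.mkQ_surjective _).comp (enZeroEquiv (matA e k)).surjective) ?_
  · rw [mem_range_eagonNorthcott_d_iff, hΨ, enZeroEquiv_psi he] at hv
    exact mem_range_eagonNorthcottDual_d _ (by rw [card_colIdx he]; omega)
      (exists_of_psiTotal_mem he (fun y hy => dualExtend_zero_apply _ v hy) hv)
  · rw [LinearMap.ker_comp, Submodule.ker_mkQ, hΨ, range_psi_sup_range_d he,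
      definingIdeal_eq_coneIdeal he]

end Sally

/-! ### Betti numbers from a minimal free resolution -/

section Betti

open TensorProduct

/-- An exact augmented complex of free modules as a projective resolution. -/
lemma IsMinimalFreeResolution.exists_projectiveResolution {R : Type u} [CommRing R] {I : Ideal R}
    {C : ChainComplex (ModuleCat.{u} R) ℕ} {M : Type u} [AddCommGroup M] [Module R M]
    (h : IsMinimalFreeResolution I C M) :
    ∃ P : ProjectiveResolution (ModuleCat.of R M), P.complex = C := by
  obtain ⟨h1, ⟨ε, hε, hex⟩, h2, -⟩ := h
  have hw : C.d 1 0 ≫ (ModuleCat.ofHom ε : C.X 0 ⟶ ModuleCat.of R M) = 0 := by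
    ext x
    exact hex.apply_apply_eq_zero x
  refine ⟨⟨C, fun n => ?_, (ChainComplex.toSingle₀Equiv _ _).symm ⟨ModuleCat.ofHom ε, hw⟩,
    ⟨fun n => ?_⟩⟩, rfl⟩
  · have := (h1 n).1
    exact (IsProjective.iff_projective (R := R) _).1 inferInstance
  · cases n
    · rw [ChainComplex.quasiIsoAt₀_iff, ShortComplex.quasiIso_iff_of_zeros']
      · refine (ShortComplex.exact_and_epi_g_iff_of_iso (S₂ := ShortComplex.mk (C.d 1 0)
          (ModuleCat.ofHom ε : C.X 0 ⟶ ModuleCat.of R M) hw) ?_).2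
          ⟨(ShortComplex.ShortExact.moduleCat_exact_iff_function_exact _).2 hex,
            (ModuleCat.epi_iff_surjective _).2 hε⟩
        exact ShortComplex.isoMk (Iso.refl _) (Iso.refl _) (Iso.refl _)
          ((Category.id_comp _).trans (Category.comp_id _).symm)
          ((Category.id_comp _).trans (Category.comp_id _).symm)
      all_goals first
        | rfl
        | exact HomologicalComplex.shape _ _ _ (by simp)
    · rename_i n
      rw [quasiIsoAt_iff_exactAt']
      · rw [HomologicalComplex.exactAt_iff' _ (n + 1 + 1) (n + 1) n (by simp) (by simp)]
        exact (ShortComplex.ShortExact.moduleCat_exact_iff_function_exact _).2 (h2 n)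
      · apply ChainComplex.exactAt_succ_single_obj

/-- The homology of a complex with zero differentials. -/
lemma nonempty_homology_iso_of_d_eq_zero {R : Type u} [CommRing R]
    (K : ChainComplex (ModuleCat.{u} R) ℕ) (hK : ∀ n, K.d (n + 1) n = 0) (n : ℕ) :
    Nonempty (K.homology n ≅ K.X n) := by
  have h : ∀ i j, K.d i j = 0 := by
    intro i j
    by_cases hij : (ComplexShape.down ℕ).Rel i j
    · obtain rfl : j + 1 = i := hij
      exact hK j
    · exact K.shape i j hij
  exact ⟨(ShortComplex.HomologyData.ofZeros (K.sc n) (h _ _) (h _ _)).left.homologyIso⟩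

lemma lTensor_eq_zero_of_range_le {R : Type u} [CommRing R] {I : Ideal R} {M N : Type u}
    [AddCommGroup M] [Module R M] [AddCommGroup N] [Module R N] {f : M →ₗ[R] N}
    (hf : LinearMap.range f ≤ I • ⊤) : f.lTensor (R ⧸ I) = 0 := by
  refine TensorProduct.ext' fun q m => ?_
  have key : ∀ n ∈ I • (⊤ : Submodule R N), q ⊗ₜ[R] n = 0 := by
    intro n hn
    induction hn using Submodule.smul_induction_on' with
    | smul r hr n _ =>
      rw [← TensorProduct.smul_tmul]
      obtain ⟨p, rfl⟩ := Ideal.Quotient.mk_surjective q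
      have h : r • Ideal.Quotient.mk I p = 0 :=
        Ideal.Quotient.eq_zero_iff_mem.2 (Ideal.mul_mem_right _ _ hr)
      rw [h, TensorProduct.zero_tmul]
    | add x _ y _ hx hy => rw [TensorProduct.tmul_add, hx, hy, add_zero]
  rw [LinearMap.lTensor_tmul, LinearMap.zero_apply]
  exact key _ (hf ⟨m, rfl⟩)

/-- The differentials of a minimal resolution of `M` vanish after tensoring with `R ⧸ I`, so that
`Tor_t(R ⧸ I, M)` is the tensor product of `R ⧸ I` with the module in degree `t`. -/
theorem IsMinimalFreeResolution.nonempty_tor_equiv {R : Type u} [CommRing R] {I : Ideal R}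
    {C : ChainComplex (ModuleCat.{u} R) ℕ} {M : Type u} [AddCommGroup M] [Module R M]
    (h : IsMinimalFreeResolution I C M) (t : ℕ) :
    Nonempty ((((Tor (ModuleCat.{u} R) t).obj (ModuleCat.of _ (R ⧸ I))).obj (ModuleCat.of _ M)) ≅
      ModuleCat.of R (TensorProduct R (R ⧸ I) (C.X t))) := by
  obtain ⟨P, rfl⟩ := h.exists_projectiveResolution
  obtain ⟨-, -, -, h⟩ := h
  let F : ModuleCat.{u} R ⥤ ModuleCat.{u} R :=
    (MonoidalCategory.tensoringLeft (ModuleCat.{u} R)).obj (ModuleCat.of R (R ⧸ I))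
  obtain ⟨i⟩ := nonempty_homology_iso_of_d_eq_zero
    ((F.mapHomologicalComplex (ComplexShape.down ℕ)).obj P.complex)
    (fun n => ModuleCat.hom_ext (lTensor_eq_zero_of_range_le (h n))) t
  exact ⟨P.isoLeftDerivedObj F t ≪≫ i⟩

variable {σ : Type} (k : Type u) [Field k]

lemma variablesIdeal_eq_ker_constantCoeff :
    variablesIdeal σ k = RingHom.ker (MvPolynomial.constantCoeff (R := k) (σ := σ)) := by
  ext p
  rw [variablesIdeal, ← Set.image_univ, MvPolynomial.mem_ideal_span_X_image, RingHom.mem_ker,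
    MvPolynomial.constantCoeff_eq]
  constructor
  · intro h
    by_contra h0
    obtain ⟨i, -, hi⟩ := h 0 (MvPolynomial.mem_support_iff.2 h0)
    exact hi rfl
  · intro h m hm
    by_contra! h'
    have h0 : m = 0 := Finsupp.ext fun i => h' i trivial
    rw [h0] at hm
    exact MvPolynomial.mem_support_iff.1 hm h

/-- The residue field of a polynomial ring at the ideal of the variables. -/
noncomputable def residueEquiv : (MvPolynomial σ k ⧸ variablesIdeal σ k) ≃+* k :=
  (Ideal.quotEquivOfEq (variablesIdeal_eq_ker_constantCoeff k)).trans
    (RingHom.quotientKerEquivOfSurjective fun c => ⟨MvPolynomial.C c, by simp⟩)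

/-- The dimension over `k`, which is the residue field of the polynomial ring, of the fibre of a free
module. -/
lemma finrank_restrictScalars_tensor (X : Type u) [AddCommGroup X] [Module (MvPolynomial σ k) X]
    [Module.Free (MvPolynomial σ k) X] [Module.Finite (MvPolynomial σ k) X] :
    Module.finrank k ((ModuleCat.restrictScalars (algebraMap k (MvPolynomial σ k))).obj
      (ModuleCat.of _ (TensorProduct (MvPolynomial σ k)
        (MvPolynomial σ k ⧸ variablesIdeal σ k) X))) =
      Module.finrank (MvPolynomial σ k) X := by
  let e := (TensorProduct.equivFinsuppOfBasisRight
    (M := MvPolynomial σ k ⧸ variablesIdeal σ k) (Module.finBasis (MvPolynomial σ k) X)).trans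
    (Finsupp.linearEquivFunOnFinite _ _ _)
  let f : ((ModuleCat.restrictScalars (algebraMap k (MvPolynomial σ k))).obj
      (ModuleCat.of _ (TensorProduct (MvPolynomial σ k)
        (MvPolynomial σ k ⧸ variablesIdeal σ k) X))) ≃ₗ[k]
      (Fin (Module.finrank (MvPolynomial σ k) X) → k) :=
    { toFun := fun v i => residueEquiv k (e v i)
      invFun := fun w => e.symm fun i => (residueEquiv k).symm (w i)
      left_inv := fun v => by
        simp only [RingEquiv.symm_apply_apply]
        exact e.symm_apply_apply v
      right_inv := fun w => by
        simp only [LinearEquiv.apply_symm_apply, RingEquiv.apply_symm_apply]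
      map_add' := fun v w => by
        funext i
        rw [Pi.add_apply, ← map_add]
        exact congrArg _ (congrFun (e.map_add v w) i)
      map_smul' := fun c v => by
        funext i
        refine (congrArg _ (congrFun (e.map_smul (algebraMap k (MvPolynomial σ k) c) v) i)).trans ?_
        change residueEquiv k (Ideal.Quotient.mk _ (MvPolynomial.C c) * e v i) = c * _
        rw [map_mul]
        congr 1
        change MvPolynomial.constantCoeff (MvPolynomial.C c) = c
        simp }
  rw [f.finrank_eq, Module.finrank_fin_fun]

/-- The Betti numbers are the ranks of the modules in a minimal free resolution. -/
theorem IsMinimalFreeResolution.bettiNumber_eq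
    {C : ChainComplex (ModuleCat.{u} (MvPolynomial σ k)) ℕ}
    {M : Type u} [AddCommGroup M] [Module (MvPolynomial σ k) M]
    (h : IsMinimalFreeResolution (variablesIdeal σ k) C M) (t : ℕ) :
    bettiNumber (σ := σ) k M t = Module.finrank (MvPolynomial σ k) (C.X t) := by
  obtain ⟨i⟩ := h.nonempty_tor_equiv t
  obtain ⟨h1, h2⟩ := h.1 t
  rw [bettiNumber, ← finrank_restrictScalars_tensor]
  exact ((ModuleCat.restrictScalars (algebraMap k (MvPolynomial σ k))).mapIso
    i).toLinearEquiv.finrank_eq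

end Betti

/-! ### Ranks in the mapping cone -/

section Ranks

variable {ι : Type} [Fintype ι]

lemma ENGen.card_hdeg_zero : Fintype.card {x : ENGen ι // x.hdeg = 0} = 1 := by
  rw [Fintype.card_eq_one_iff]
  refine ⟨⟨none, rfl⟩, ?_⟩
  rintro ⟨_ | ⟨T, a⟩, hx⟩
  · rfl
  · have := a.2
    simp only [ENGen.hdeg] at hx
    omega

/-- The rank of `⋀^(n+2) F ⊗ D_n G*`. -/
lemma ENGen.card_hdeg_succ (n : ℕ) : Fintype.card {x : ENGen ι // x.hdeg = n + 1} =
    (Fintype.card ι).choose (n + 2) * (n + 1) := by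
  rw [Fintype.card_subtype, Finset.card_filter, Fintype.sum_option, Fintype.sum_sigma]
  have h : ∀ T : Finset ι, (∑ a : Fin (T.card - 1),
      if ENGen.hdeg (some ⟨T, a⟩) = n + 1 then 1 else 0) = if T.card = n + 2 then n + 1 else 0 := by
    intro T
    change (∑ _a : Fin (T.card - 1), if T.card - 1 = n + 1 then 1 else 0) = _
    rw [Finset.sum_const, Finset.card_univ, Fintype.card_fin, smul_eq_mul]
    split_ifs <;> omega
  rw [Finset.sum_congr rfl fun T _ => h T, ← Finset.sum_filter, Finset.sum_const,
    ← Fintype.card_subtype, Fintype.card_finset_len, smul_eq_mul]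
  simp [ENGen.hdeg]

variable {R : Type u} [CommRing R] [Nontrivial R] [LinearOrder ι] (A : Matrix (Fin 2) ι R)

lemma finrank_eagonNorthcott_zero : Module.finrank R ((eagonNorthcott A).X 0) = 1 :=
  (Module.finrank_fintype_fun_eq_card R).trans ENGen.card_hdeg_zero

lemma finrank_eagonNorthcott_succ (n : ℕ) : Module.finrank R ((eagonNorthcott A).X (n + 1)) =
    (Fintype.card ι).choose (n + 2) * (n + 1) :=
  (Module.finrank_fintype_fun_eq_card R).trans (ENGen.card_hdeg_succ n)

lemma finrank_eagonNorthcottDual {n m : ℕ} (h : m + n = Fintype.card ι - 1) :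
    Module.finrank R ((eagonNorthcottDual A).X n) =
      Module.finrank R ((eagonNorthcott A).X m) := by
  refine (Module.finrank_fintype_fun_eq_card R).trans (Eq.trans ?_
    (Module.finrank_fintype_fun_eq_card R).symm)
  exact Fintype.card_congr (Equiv.subtypeEquivRight fun x => by omega)

end Ranks

/-- The sum of the ranks of the two complexes in the middle degrees `t = s + 1` of the cone, for
matrices with `p` columns. -/
lemma betti_identity {p s : ℕ} (h : s + 1 < p) :
    ((p.choose s * (p - 1 - s) + p.choose (s + 2) * (s + 1) : ℕ) : ℚ) =
      ((s + 1 : ℕ) : ℚ) * (p + 2) / (p - s) * (p.choose (s + 2) : ℚ) := by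
  obtain ⟨d, rfl⟩ : ∃ d, p = s + 1 + d := ⟨p - (s + 1), by omega⟩
  have h1 := Nat.choose_succ_right_eq (s + 1 + d) s
  have h2 := Nat.choose_succ_right_eq (s + 1 + d) (s + 1)
  rw [show s + 1 + d - s = d + 1 by omega] at h1
  rw [show s + 1 + d - (s + 1) = d by omega] at h2
  rw [show s + 1 + d - 1 - s = d by omega]
  have h3 : ((s + 1 + d).choose (s + 1) : ℚ) * (s + 1) = (s + 1 + d).choose s * (d + 1) := by
    exact_mod_cast h1
  have h4 : ((s + 1 + d).choose (s + 2) : ℚ) * (s + 2) = (s + 1 + d).choose (s + 1) * d := by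
    exact_mod_cast h2
  have h5 : (((s + 1 + d : ℕ) : ℚ) - s) ≠ 0 := by
    push_cast
    have : (0 : ℚ) < 1 + d := by positivity
    intro h
    linarith
  field_simp
  push_cast
  linear_combination (-d : ℚ) * h3 - (s + 1 : ℚ) * h4

namespace Sally

variable {e : ℕ} {k : Type u} [Field k]

theorem bettiNumber_zero (he : 6 ≤ e) :
    bettiNumber (σ := VarIdx e) k (PolyRing e k ⧸ definingIdeal e k) 0 = 1 := by
  obtain ⟨Ψ, hΨ, -⟩ := exists_extension_psi (k := k) he
  rw [(isMinimalFreeResolution_cone he Ψ hΨ).bettiNumber_eq, (coneZeroEquiv Ψ).finrank_eq,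
    finrank_eagonNorthcott_zero]

lemma bettiNumber_succ (he : 6 ≤ e) (n : ℕ) :
    bettiNumber (σ := VarIdx e) k (PolyRing e k ⧸ definingIdeal e k) (n + 1) =
      Module.finrank (PolyRing e k) ((eagonNorthcottDual (matA e k)).X n) +
        Module.finrank (PolyRing e k) ((eagonNorthcott (matA e k)).X (n + 1)) := by
  obtain ⟨Ψ, hΨ, -⟩ := exists_extension_psi (k := k) he
  obtain ⟨_, _⟩ := eagonNorthcottDual_free_finite (matA e k) n
  obtain ⟨_, _⟩ := eagonNorthcott_free_finite (matA e k) (n + 1)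
  rw [(isMinimalFreeResolution_cone he Ψ hΨ).bettiNumber_eq, (coneSuccEquiv Ψ n).finrank_eq,
    Module.finrank_prod]

theorem bettiNumber_last (he : 6 ≤ e) :
    bettiNumber (σ := VarIdx e) k (PolyRing e k ⧸ definingIdeal e k) (e - 3) = 1 := by
  have hc := card_colIdx he
  rw [show e - 3 = e - 4 + 1 by omega, bettiNumber_succ he,
    finrank_eagonNorthcottDual _ (m := 0) (by omega), finrank_eagonNorthcott_zero,
    finrank_eagonNorthcott_succ, Nat.choose_eq_zero_of_lt (by omega), zero_mul, add_zero]

theorem bettiNumber_middle (he : 6 ≤ e) {t : ℕ} (ht : 1 ≤ t) (ht' : t ≤ e - 4) :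
    (bettiNumber (σ := VarIdx e) k (PolyRing e k ⧸ definingIdeal e k) t : ℚ) =
      (t * (e - 1) : ℚ) / (e - t - 2) * (Nat.choose (e - 3) (t + 1) : ℚ) := by
  obtain ⟨s, rfl⟩ : ∃ s, t = s + 1 := ⟨t - 1, by omega⟩
  obtain ⟨p, rfl⟩ : ∃ p, e = p + 3 := ⟨e - 3, by omega⟩
  have hc := card_colIdx he
  rw [Nat.add_sub_cancel] at hc ⊢
  rw [bettiNumber_succ he, finrank_eagonNorthcottDual _ (m := p - s - 2 + 1) (by omega),
    finrank_eagonNorthcott_succ, finrank_eagonNorthcott_succ, hc,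
    show p - s - 2 + 2 = p - s by omega, Nat.choose_symm (by omega),
    show p - s - 2 + 1 = p - 1 - s by omega, betti_identity (by omega)]
  push_cast
  ring

end Sally

theorem mainTheorem1 (k : Type u) [Field k] (e : ℕ) (he : 6 ≤ e) :
    -- `ψ` extends to a map of complexes `E* → E`,
    (∃ Ψ : eagonNorthcottDual (Sally.matA e k) ⟶ eagonNorthcott (Sally.matA e k),
      Ψ.f 0 = Sally.psi e k) ∧
    -- whose mapping cone is a minimal free resolution of `R_{2,3} ⧸ I_{2,3} = k[S_{2,3}]`,
    (∀ Ψ : eagonNorthcottDual (Sally.matA e k) ⟶ eagonNorthcott (Sally.matA e k),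
      Ψ.f 0 = Sally.psi e k →
        IsMinimalFreeResolution (variablesIdeal (Sally.VarIdx e) k)
          (HomologicalComplex.homotopyCofiber Ψ)
          (Sally.PolyRing e k ⧸ Sally.definingIdeal e k)) ∧
    -- and the Betti numbers of `k[S_{2,3}]` are the following.
    bettiNumber (σ := Sally.VarIdx e) k (Sally.PolyRing e k ⧸ Sally.definingIdeal e k) 0 = 1 ∧
    bettiNumber (σ := Sally.VarIdx e) k (Sally.PolyRing e k ⧸ Sally.definingIdeal e k) (e - 3) = 1 ∧
    ∀ t : ℕ, 1 ≤ t → t ≤ e - 4 →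
      (bettiNumber (σ := Sally.VarIdx e) k (Sally.PolyRing e k ⧸ Sally.definingIdeal e k) t : ℚ) =
        (t * (e - 1) : ℚ) / (e - t - 2) * (Nat.choose (e - 3) (t + 1) : ℚ) := by
  obtain ⟨Ψ, hΨ, -⟩ := Sally.exists_extension_psi (k := k) he
  exact ⟨⟨Ψ, hΨ⟩, fun Ψ hΨ => Sally.isMinimalFreeResolution_cone he Ψ hΨ,
    Sally.bettiNumber_zero he, Sally.bettiNumber_last he,
    fun t ht ht' => Sally.bettiNumber_middle he ht ht'⟩
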